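/- \textbf{Proposition (Symmetric group).} Let the symmetric group $\mathfrak{S}_n$ act on $V=\mathbb{C}^n/\langle(1,\dots,1)\rangle$ by permuting the coordinates (the reflection representation), and let $H$ be a reflecting hyperplane, i.e. $H=\ker(s-\mathrm{id})$ for some $s\in\mathfrak{S}_n$ whose fixed space in $V$ has dimension $\dim V-1$ (so $n\ge 2$). Let $G_H$ be the pointwise stabilizer of $H$ in $\mathfrak{S}_n$, $e_H=|G_H|$, and $s_H$ the generator of $G_H$ with determinant $\exp(2i\pi/e_H)$ on $V$. For a finite dimensional complex representation $M$ of $\mathfrak{S}_n$ of dimension $r$, let $j_1,\dots,j_r\in\{0,\dots,e_H-1\}$ be such that $\mathrm{Res}_{G_H}M\cong\det^{-j_1}\oplus\cdots\oplus\det^{-j_r}$, where $\det$ is the determinant of $V$; let $n_{j,H}(M)$ be the multiplicity of $\det^{-j}$ in $\mathrm{Res}_{G_H}M$ and $n_H(M)=\sum_{j=0}^{e_H-1} j\,n_{j,H}(M)=\sum_i j_i$. For a linear character $\chi$ let $n_H(\chi)=n_H(\mathbb{C}_\chi)$, where $\mathbb{C}_\chi$ is the one-dimensional representation with character $\chi$.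 One says that $H$ is - $M$-good if $n_H(M)<e_H$; - $M$-excellent if $s_H$ acts on $M$ as the identity or as a reflection (that is, its fixed space in $M$ has dimension $r$ or $r-1$); - $(M,\chi)$-good if $n_H(M)+n_H(\chi)<e_H$; - $(M,\chi)$-acceptable if for every partition of $\{1,\dots,r\}$ into two disjoint sets $I_1,I_2$ one has $e_H-n_H(\chi)>\sum_{i\in I_1}j_i$ or $e_H-n_H(\chi)>\sum_{i\in I_2}j_i$. Let $\rho$ be an irreducible complex representation of $\mathfrak{S}_n$, let $1$ be the trivial and $\varepsilon$ the sign character. Irreducible representations are indexed by the partitions of $n$ through Specht modules (so that $(n)$ corresponds to $1$). Equalities of representations are up to isomorphism. (a) Each of the four properties "$H$ is $\rho$-excellent", "$H$ is $\rho$-good", "$H$ is $(\rho,1)$-good", "$H$ is $(\rho,\varepsilon)$-acceptable" holds if and only if $\rho=1$, or $\rho=\varepsilon$, or $\rho$ is the reflection representation, or $n=4$ and $\rho$ is associated to the partition $(2,2)$. (b) $H$ is $(\rho,\varepsilon)$-good if and only if $\rho=1$. (c) $H$ is $(\rho,1)$-acceptable if and only if $\rho=1$, or $\rho=\varepsilon$,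 or $\rho$ is the reflection representation, or $n\le 5$, or $n=6$ and $\rho$ is associated to one of the partitions $(3,3)$, $(2,2,2)$, $(4,2)$. -/

import Mathlib

noncomputable section

namespace ReflHyp

open Module

/-! ### Hyperplanes of a reflection group

`G` is a (finite) group, `V` a finite dimensional complex vector space and `σ` the (faithful)
representation through which `G` is a reflection group on `V`. -/

section General

variable {G : Type*} [Group G]

/-- `g` acts on the representation space as a reflection: the space of its fixed vectors is a
hyperplane. (For a finite group `g` is automatically of finite order.) -/
def IsReflection {V : Type*} [AddCommGroup V] [Module ℂ V]
    (σ : Representation ℂ G V) (g : G) : Prop :=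
  finrank ℂ (LinearMap.ker (σ g - LinearMap.id)) + 1 = finrank ℂ V

/-- The set of the reflecting hyperplanes `ker (s - id)`, `s` a reflection. -/
def hyperplanes {V : Type*} [AddCommGroup V] [Module ℂ V]
    (σ : Representation ℂ G V) : Set (Submodule ℂ V) :=
  {H | ∃ s : G, IsReflection σ s ∧ H = LinearMap.ker (σ s - LinearMap.id)}

/-- `G_H`, the pointwise stabilizer of `H`. -/
def fixer {V : Type*} [AddCommGroup V] [Module ℂ V]
    (σ : Representation ℂ G V) (H : Submodule ℂ V) : Subgroup G where
  carrier := {g | ∀ x ∈ H, σ g x = x}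
  one_mem' := by
    intro x _
    simp
  mul_mem' := by
    intro a b ha hb x hx
    simp [hb x hx, ha x hx]
  inv_mem' := by
    intro a ha x hx
    have h := congrArg (σ a⁻¹) (ha x hx)
    simpa using h.symm

/-- `e_H`, the order of `G_H`. -/
def eH {V : Type*} [AddCommGroup V] [Module ℂ V]
    (σ : Representation ℂ G V) (H : Submodule ℂ V) : ℕ :=
  Nat.card (fixer σ H)

/-- `s` is the generator `s_H` of `G_H` with determinant `exp (2 i π / e_H)`. -/
def IsDistinguishedGenerator {V : Type*} [AddCommGroup V] [Module ℂ V]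
    (σ : Representation ℂ G V) (H : Submodule ℂ V) (s : G) : Prop :=
  Subgroup.zpowers s = fixer σ H ∧
    LinearMap.det (σ s) = Complex.exp (2 * Complex.I * Real.pi / (eH σ H : ℂ))

/-- `n_{j,H}(M)`, the multiplicity of `det⁻ʲ` in the restriction of `M` to `G_H`, that is the
dimension of the `det⁻ʲ`-isotypic component. -/
def nMult {V : Type*} [AddCommGroup V] [Module ℂ V]
    (σ : Representation ℂ G V) (H : Submodule ℂ V)
    {M : Type*} [AddCommGroup M] [Module ℂ M] (ρ : Representation ℂ G M) (j : ℕ) : ℕ :=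
  finrank ℂ (⨅ g : fixer σ H, Module.End.eigenspace (ρ g) ((LinearMap.det (σ g))⁻¹ ^ j) : Submodule ℂ M)

/-- `n_H(M) = ∑ j n_{j,H}(M)`, the sum over `0 ≤ j ≤ e_H - 1`. -/
def nH {V : Type*} [AddCommGroup V] [Module ℂ V]
    (σ : Representation ℂ G V) (H : Submodule ℂ V)
    {M : Type*} [AddCommGroup M] [Module ℂ M] (ρ : Representation ℂ G M) : ℕ :=
  ∑ j ∈ Finset.range (eH σ H), j * nMult σ H ρ j

/-- The one-dimensional representation `ℂ_χ` attached to a linear character `χ`. -/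
def charRep (χ : G →* ℂˣ) : Representation ℂ G ℂ :=
  (algebraMap ℂ (Module.End ℂ ℂ)).toMonoidHom.comp ((Units.coeHom ℂ).comp χ)

/-- `(j_1, …, j_r)` is a family with `0 ≤ j_i ≤ e_H - 1` such that the restriction of `M` to `G_H`
is `det^{-j_1} ⊕ ⋯ ⊕ det^{-j_r}`. -/
def IsExponentFamily {V : Type*} [AddCommGroup V] [Module ℂ V]
    (σ : Representation ℂ G V) (H : Submodule ℂ V)
    {M : Type*} [AddCommGroup M] [Module ℂ M] (ρ : Representation ℂ G M)
    {r : ℕ} (j : Fin r → ℕ) : Prop :=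
  (∀ i, j i < eH σ H) ∧
    ∃ b : Basis (Fin r) ℂ M, ∀ i, ∀ g ∈ fixer σ H,
      ρ g (b i) = (LinearMap.det (σ g))⁻¹ ^ j i • b i

/-- `H` is `M`-good: `n_H(M) < e_H`. -/
def IsGood {V : Type*} [AddCommGroup V] [Module ℂ V]
    (σ : Representation ℂ G V) (H : Submodule ℂ V)
    {M : Type*} [AddCommGroup M] [Module ℂ M] (ρ : Representation ℂ G M) : Prop :=
  nH σ H ρ < eH σ H

/-- `H` is `M`-excellent: `s_H` acts on `M` as the identity or as a reflection. -/
def IsExcellent {V : Type*} [AddCommGroup V] [Module ℂ V]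
    (σ : Representation ℂ G V) (H : Submodule ℂ V)
    {M : Type*} [AddCommGroup M] [Module ℂ M] (ρ : Representation ℂ G M) : Prop :=
  ∃ s, IsDistinguishedGenerator σ H s ∧ (ρ s = LinearMap.id ∨ IsReflection ρ s)

/-- `H` is `(M, χ)`-good: `n_H(M) + n_H(χ) < e_H`. -/
def IsPairGood {V : Type*} [AddCommGroup V] [Module ℂ V]
    (σ : Representation ℂ G V) (H : Submodule ℂ V)
    {M : Type*} [AddCommGroup M] [Module ℂ M] (ρ : Representation ℂ G M) (χ : G →* ℂˣ) : Prop :=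
  nH σ H ρ + nH σ H (charRep χ) < eH σ H

/-- `H` is `(M, χ)`-acceptable: for every partition of the indices of `(j_1, …, j_r)` into two
disjoint sets, one of the two partial sums is less than `e_H - n_H(χ)`. The family is unique up to
a permutation of the indices, so that the choice of it does not matter. -/
def IsAcceptable {V : Type*} [AddCommGroup V] [Module ℂ V]
    (σ : Representation ℂ G V) (H : Submodule ℂ V)
    {M : Type*} [AddCommGroup M] [Module ℂ M] (ρ : Representation ℂ G M) (χ : G →* ℂˣ) : Prop :=
  ∃ j : Fin (finrank ℂ M) → ℕ, IsExponentFamily σ H ρ j ∧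
    ∀ I₁ I₂ : Finset (Fin (finrank ℂ M)), Disjoint I₁ I₂ → I₁ ∪ I₂ = Finset.univ →
      (∑ i ∈ I₁, (j i : ℤ)) < (eH σ H : ℤ) - nH σ H (charRep χ) ∨
      (∑ i ∈ I₂, (j i : ℤ)) < (eH σ H : ℤ) - nH σ H (charRep χ)

end General

/-! ### The symmetric group -/

/-- `S_n` permutes the coordinates of `ℂⁿ`. -/
def permRep (n : ℕ) : Representation ℂ (Equiv.Perm (Fin n)) (Fin n → ℂ) where
  toFun g := LinearMap.funLeft ℂ ℂ ⇑g⁻¹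
  map_one' := by
    ext
    simp [LinearMap.funLeft]
  map_mul' a b := by
    ext
    simp [LinearMap.funLeft, mul_inv_rev]

/-- The line spanned by `(1, …, 1)`. -/
def diagLine (n : ℕ) : Submodule ℂ (Fin n → ℂ) :=
  Submodule.span ℂ {fun _ => 1}

lemma diagLine_le_comap (n : ℕ) (g : Equiv.Perm (Fin n)) :
    diagLine n ≤ (diagLine n).comap (permRep n g) := by
  refine Submodule.span_le.2 ?_
  rintro _ rfl
  exact Submodule.subset_span rfl

/-- The reflection representation of `S_n` on `ℂⁿ / ⟨(1, …, 1)⟩`. -/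
def reflRep (n : ℕ) : Representation ℂ (Equiv.Perm (Fin n)) ((Fin n → ℂ) ⧸ diagLine n) :=
  (permRep n).quotient (diagLine n) (diagLine_le_comap n)

/-- The sign character `ε` of `S_n`. -/
def signChar (n : ℕ) : Equiv.Perm (Fin n) →* ℂˣ :=
  (Units.map (Int.castRingHom ℂ).toMonoidHom).comp Equiv.Perm.sign

/-! ### Specht modules

A tableau of shape `μ` is a bijection `T` from the set of entries `Fin n` to the cells of `μ`; its
tabloid (the tableau up to permutations within the rows) is recorded as the function that sends an
entry to the index of its row. -/

/-- `S_n` permutes the basis of the vector space on all functions `Fin n → ℕ` (among which are the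
tabloids) by permuting the entries. -/
def tabloidRep (n : ℕ) : Representation ℂ (Equiv.Perm (Fin n)) ((Fin n → ℕ) →₀ ℂ) where
  toFun g := Finsupp.lmapDomain ℂ ℂ fun t : Fin n → ℕ => t ∘ ⇑g⁻¹
  map_one' := by
    ext
    simp
  map_mul' a b := by
    refine Finsupp.lhom_ext' fun t => LinearMap.ext_ring ?_
    simp [mul_inv_rev, Function.comp_assoc]

open Classical in
/-- The polytabloid `e_T = ∑ sgn(π) {π T}`, `π` in the column stabilizer of `T`. -/
def polytabloid {n : ℕ} {μ : YoungDiagram} (T : Fin n ≃ μ.cells) : (Fin n → ℕ) →₀ ℂ :=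
  ∑ π : Equiv.Perm (Fin n) with ∀ i, (T (π i)).1.2 = (T i).1.2,
    Finsupp.single (fun i => (T (π⁻¹ i)).1.1) ((Equiv.Perm.sign π : ℤ) : ℂ)

/-- The Specht module of shape `μ`: the span of the polytabloids. -/
def spechtSubmodule (n : ℕ) (μ : YoungDiagram) : Submodule ℂ ((Fin n → ℕ) →₀ ℂ) :=
  Submodule.span ℂ (Set.range fun T : Fin n ≃ μ.cells => polytabloid T)

lemma tabloidRep_polytabloid {n : ℕ} {μ : YoungDiagram} (g : Equiv.Perm (Fin n))
    (T : Fin n ≃ μ.cells) :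
    tabloidRep n g (polytabloid T) = polytabloid (g⁻¹.trans T) := by
  classical
  simp only [polytabloid, map_sum]
  refine Finset.sum_bij' (fun π _ => g * π * g⁻¹) (fun π _ => g⁻¹ * π * g) ?_ ?_ ?_ ?_ ?_
  · intro π hπ
    simp only [Finset.mem_filter, Finset.mem_univ, true_and] at hπ ⊢
    intro i
    simpa using hπ (g⁻¹ i)
  · intro π hπ
    simp only [Finset.mem_filter, Finset.mem_univ, true_and] at hπ ⊢
    intro i
    simpa using hπ (g i)
  · intro π _
    group
  · intro π _
    group
  · intro π _
    simp only [tabloidRep, MonoidHom.coe_mk, OneHom.coe_mk, Finsupp.lmapDomain_apply,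
      Finsupp.mapDomain_single]
    congr 1
    · funext i
      simp
    · rcases Int.units_eq_one_or (Equiv.Perm.sign g) with h | h <;> simp [h]

lemma spechtSubmodule_le_comap (n : ℕ) (μ : YoungDiagram) (g : Equiv.Perm (Fin n)) :
    spechtSubmodule n μ ≤ (spechtSubmodule n μ).comap (tabloidRep n g) := by
  refine Submodule.span_le.2 ?_
  rintro _ ⟨T, rfl⟩
  change tabloidRep n g (polytabloid T) ∈ spechtSubmodule n μ
  rw [tabloidRep_polytabloid]
  exact Submodule.subset_span ⟨_, rfl⟩

/-- The representation of `S_n` associated to the partition of `n` with Young diagram `μ`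
(to `(n)` is associated the trivial representation, to `(1, …, 1)` the sign). -/
def spechtRep (n : ℕ) (μ : YoungDiagram) :
    Representation ℂ (Equiv.Perm (Fin n)) (spechtSubmodule n μ) :=
  (tabloidRep n).subrepresentation (spechtSubmodule n μ) (spechtSubmodule_le_comap n μ)

/-- Two representations are isomorphic. -/
def Iso {G : Type*} [Group G] {M N : Type*} [AddCommMonoid M] [Module ℂ M]
    [AddCommMonoid N] [Module ℂ N] (ρ : Representation ℂ G M) (τ : Representation ℂ G N) : Prop :=
  Nonempty (ρ.Equiv τ)

/-- `ρ` is associated to the partition with the list `l` of parts. -/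
def HasShape {n : ℕ} {M : Type*} [AddCommGroup M] [Module ℂ M]
    (ρ : Representation ℂ (Equiv.Perm (Fin n)) M) (l : List ℕ) : Prop :=
  ∃ h : l.SortedGE, Iso ρ (spechtRep n (YoungDiagram.ofRowLens l h))

/-- `ρ` is the trivial representation, the sign, the reflection representation, or `n = 4` and `ρ`
is associated to the partition `(2,2)`. -/
def InShortList {n : ℕ} {M : Type*} [AddCommGroup M] [Module ℂ M]
    (ρ : Representation ℂ (Equiv.Perm (Fin n)) M) : Prop :=
  Iso ρ (charRep 1) ∨ Iso ρ (charRep (signChar n)) ∨ Iso ρ (reflRep n) ∨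
    (n = 4 ∧ HasShape ρ [2, 2])

end ReflHyp

end

noncomputable section

namespace ReflHyp

open Module Equiv

/-! ### Irreducible representations -/

section Iso

variable {G : Type*} [Group G] {M N : Type*} [AddCommMonoid M] [Module ℂ M] [AddCommMonoid N]
  [Module ℂ N]

/-! A reflecting hyperplane of `S_n` is some `x_p = x_q`, its pointwise stabilizer is `{1, (p q)}`,
so `e_H = 2` and every exponent `j_i` is 0 or 1. Hence `n_H(ρ)` is the dimension `d` of the
`-1`-eigenspace of a transposition. Excellent, good, `(ρ,1)`-good and `(ρ,ε)`-acceptable all mean `d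
≤ 1`; `(ρ,ε)`-good means `d = 0`; `(ρ,1)`-acceptable means `d ≤ 3`. It remains to find the
irreducible `ρ` with `d = 0`, `d ≤ 1` or `d ≤ 3`.

No branching rule or character formula is used. A nonzero vector fixed by the permutations of a
large subset of the points is spread over its orbit, which gives a spanning family indexed by
points, pairs or triples. When no vector is fixed by a larger subset, the partial sums of the family
vanish, and linear algebra then bounds the eigenspaces of a transposition from both sides. A family
indexed by points is the reflection representation (`PointSystem`). One indexed by pairs
(`PairSystem`) has `d ≤ n - 2`, and `d ≥ n - 2` in the antisymmetric case. Twisting by the sign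
exchanges the two eigenspaces, so the same estimates treat the transposed shapes.

Such vectors are found as follows. If `0 < d ≤ 1`, or `n ≥ 7` and `0 < d ≤ 3`, the permutations of
the other `n - 2` points act on the `-1`-eigenspace of `(p q)`. A representation of `S_m` of
dimension at most 1, or of dimension at most 3 with `m ≥ 5`, has all transpositions acting alike
(`rep_swap_congr`), so some vector of the eigenspace is fixed, or negated, by all these
transpositions (`exists_fixedOn_compl_pair`). For `n ≥ 5` either `ρ` or its twist has a vector fixed
by three points (`not_noFixed_three`), which settles `n = 5`. For `n = 6` the case without vectors
fixed by four points, in `ρ` or its twist, leads to `TripleSystem` (shapes `(3,3)` and `(2,2,2)`) or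
to `MixedSystem`s for both, which force `d ≥ 4`.

Specht modules are recognised by `iso_spechtRep`: an irreducible representation with a nonzero
vector fixed by the row stabilizer of a tableau and one alternating under its column stabilizer is
the Specht module of that shape. Conversely `HasShape.noFixed` and `HasShape.noFixed_signTwist`
supply the vanishing needed to build the systems from a given shape. -/

lemma Iso.exists_equiv {ρ : Representation ℂ G M} {τ : Representation ℂ G N} (h : Iso ρ τ) :
    ∃ e : M ≃ₗ[ℂ] N, ∀ g x, e (ρ g x) = τ g (e x) := by
  obtain ⟨φ⟩ := h
  exact ⟨φ.toLinearEquiv, fun g x => LinearMap.congr_fun (φ.isIntertwining' g) x⟩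

lemma Iso.of_equiv {ρ : Representation ℂ G M} {τ : Representation ℂ G N} (e : M ≃ₗ[ℂ] N)
    (h : ∀ g x, e (ρ g x) = τ g (e x)) : Iso ρ τ :=
  ⟨.mk e fun g => LinearMap.ext fun x => h g x⟩

lemma Iso.symm' {ρ : Representation ℂ G M} {τ : Representation ℂ G N} (h : Iso ρ τ) : Iso τ ρ := by
  obtain ⟨φ⟩ := h
  exact ⟨φ.symm⟩

end Iso

section Simple

variable {G : Type*} [Group G] {M : Type*} [AddCommGroup M] [Module ℂ M]

/-- An irreducible representation, in terms of invariant submodules. -/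
def IsSimpleRep (ρ : Representation ℂ G M) : Prop :=
  Nontrivial M ∧ ∀ U : Submodule ℂ M, (∀ g, ∀ x ∈ U, ρ g x ∈ U) → U = ⊥ ∨ U = ⊤

lemma isSimpleRep_of_isIrreducible {ρ : Representation ℂ G M} (h : ρ.IsIrreducible) :
    IsSimpleRep ρ := by
  constructor
  · by_contra hn
    rw [not_nontrivial_iff_subsingleton] at hn
    obtain ⟨U, V, hUV⟩ := h.toNontrivial
    refine hUV (Subrepresentation.toSubmodule_injective ?_)
    exact Subsingleton.elim _ _
  · intro U hU
    rcases h.eq_bot_or_eq_top (⟨U, fun g x hx => hU g x hx⟩ : Subrepresentation ρ) with h1 | h1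
    · left
      rw [show U = (⟨U, fun g x hx => hU g x hx⟩ : Subrepresentation ρ).toSubmodule from rfl, h1]
      rfl
    · right
      rw [show U = (⟨U, fun g x hx => hU g x hx⟩ : Subrepresentation ρ).toSubmodule from rfl, h1]
      rfl

lemma IsSimpleRep.span_orbit {ρ : Representation ℂ G M} (h : IsSimpleRep ρ) {w : M} (hw : w ≠ 0) :
    Submodule.span ℂ (Set.range fun g => ρ g w) = ⊤ := by
  refine (h.2 _ ?_).resolve_left ?_
  · intro g x hx
    induction hx using Submodule.span_induction with
    | mem x hx =>
      obtain ⟨k, rfl⟩ := hx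
      exact Submodule.subset_span ⟨g * k, by simp⟩
    | zero => simp
    | add x y _ _ hx hy => rw [map_add]; exact Submodule.add_mem _ hx hy
    | smul c x _ hx => rw [map_smul]; exact Submodule.smul_mem _ _ hx
  · intro h0
    refine hw ?_
    have : w ∈ Submodule.span ℂ (Set.range fun g => ρ g w) :=
      Submodule.subset_span ⟨1, by simp⟩
    rwa [h0, Submodule.mem_bot] at this

variable {N : Type*} [AddCommGroup N] [Module ℂ N]

lemma Iso.of_surjective {ρ : Representation ℂ G M} {τ : Representation ℂ G N}
    (hρ : IsSimpleRep ρ) (f : M →ₗ[ℂ] N) (hf : ∀ g x, f (ρ g x) = τ g (f x)) (h0 : f ≠ 0)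
    (hs : Function.Surjective f) : Iso ρ τ := by
  have hk : LinearMap.ker f = ⊥ := by
    refine (hρ.2 _ fun g x hx => ?_).resolve_right fun h => h0 (LinearMap.ker_eq_top.1 h)
    rw [LinearMap.mem_ker] at hx ⊢
    rw [hf, hx, map_zero]
  exact Iso.of_equiv (LinearEquiv.ofBijective f ⟨LinearMap.ker_eq_bot.1 hk, hs⟩)
    fun g x => hf g x

lemma finrank_eigenspace_iso {ρ : Representation ℂ G M} {τ : Representation ℂ G N}
    (h : Iso ρ τ) (g : G) (c : ℂ) :
    finrank ℂ (End.eigenspace (ρ g) c) = finrank ℂ (End.eigenspace (τ g) c) := by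
  obtain ⟨e, he⟩ := h.exists_equiv
  refine LinearEquiv.finrank_eq (e.submoduleMap _ |>.trans (LinearEquiv.ofEq _ _ ?_))
  ext x
  simp only [Submodule.mem_map, End.mem_eigenspace_iff]
  constructor
  · rintro ⟨y, hy, rfl⟩
    exact (he g y).symm.trans (by simp [hy])
  · intro hx
    exact ⟨e.symm x, e.injective (by simp [he, hx]), by simp⟩

lemma finrank_eigenspace_conj (ρ : Representation ℂ G M) (g h : G) (c : ℂ) :
    finrank ℂ (End.eigenspace (ρ (g * h * g⁻¹)) c) = finrank ℂ (End.eigenspace (ρ h) c) := by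
  let e : M ≃ₗ[ℂ] M := LinearEquiv.ofLinearMap (ρ g) (ρ g⁻¹)
    (by rw [← Module.End.mul_eq_comp, ← map_mul]; simp; rfl)
    (by rw [← Module.End.mul_eq_comp, ← map_mul]; simp; rfl)
  symm
  refine LinearEquiv.finrank_eq (e.submoduleMap _ |>.trans (LinearEquiv.ofEq _ _ ?_))
  ext x
  simp only [Submodule.mem_map, End.mem_eigenspace_iff]
  constructor
  · rintro ⟨y, hy, rfl⟩
    change ρ (g * h * g⁻¹) (ρ g y) = c • ρ g y
    rw [← Module.End.mul_apply, ← map_mul, inv_mul_cancel_right, map_mul, Module.End.mul_apply, hy,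
      map_smul]
  · intro hx
    refine ⟨ρ g⁻¹ x, ?_, ?_⟩
    · have := congrArg (ρ g⁻¹) hx
      rw [← Module.End.mul_apply, ← map_mul, map_smul] at this
      rw [← this, ← Module.End.mul_apply, ← map_mul]
      congr 2
      group
    · change ρ g (ρ g⁻¹ x) = x
      simp

end Simple

/-! ### Twisting by the sign -/

section Perm

variable {n : ℕ} {M : Type*} [AddCommGroup M] [Module ℂ M]

/-- The tensor product of a representation with the sign character. -/
def signTwist (ρ : Representation ℂ (Perm (Fin n)) M) : Representation ℂ (Perm (Fin n)) M where
  toFun g := ((Perm.sign g : ℤ) : ℂ) • ρ g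
  map_one' := by simp
  map_mul' a b := by
    rw [map_mul, map_mul]
    push_cast
    rw [smul_mul_smul_comm]

lemma signTwist_apply (ρ : Representation ℂ (Perm (Fin n)) M) (g : Perm (Fin n)) (x : M) :
    signTwist ρ g x = ((Perm.sign g : ℤ) : ℂ) • ρ g x := rfl

lemma sign_mul_self_complex (g : Perm (Fin n)) :
    ((Perm.sign g : ℤ) : ℂ) * ((Perm.sign g : ℤ) : ℂ) = 1 := by
  rcases Int.units_eq_one_or (Perm.sign g) with h | h <;> simp [h]

@[simp] lemma signTwist_signTwist (ρ : Representation ℂ (Perm (Fin n)) M) :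
    signTwist (signTwist ρ) = ρ := by
  ext g x
  rw [signTwist_apply, signTwist_apply, smul_smul, sign_mul_self_complex, one_smul]

lemma signTwist_swap (ρ : Representation ℂ (Perm (Fin n)) M) {i j : Fin n} (h : i ≠ j) (x : M) :
    signTwist ρ (swap i j) x = - ρ (swap i j) x := by
  simp [signTwist_apply, Perm.sign_swap h]

lemma IsSimpleRep.signTwist {ρ : Representation ℂ (Perm (Fin n)) M} (h : IsSimpleRep ρ) :
    IsSimpleRep (signTwist ρ) := by
  refine ⟨h.1, fun U hU => h.2 U fun g x hx => ?_⟩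
  have := U.smul_mem ((Perm.sign g : ℤ) : ℂ) (hU g x hx)
  rwa [signTwist_apply, smul_smul, sign_mul_self_complex, one_smul] at this

/-- Because of this exchange, a bound on the `1`-eigenspace of the twist is a bound on the
`-1`-eigenspace of `ρ`. -/
lemma eigenspace_signTwist (ρ : Representation ℂ (Perm (Fin n)) M) {i j : Fin n} (h : i ≠ j)
    (c : ℂ) :
    End.eigenspace (signTwist ρ (swap i j)) c = End.eigenspace (ρ (swap i j)) (-c) := by
  ext x
  rw [End.mem_eigenspace_iff, End.mem_eigenspace_iff, signTwist_swap ρ h, neg_smul, neg_eq_iff_eq_neg]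

/-- The dimension of the eigenspace of a transposition. -/
def eigDim (ρ : Representation ℂ (Perm (Fin n)) M) (c : ℂ) (i j : Fin n) : ℕ :=
  finrank ℂ (End.eigenspace (ρ (swap i j)) c)

lemma eigDim_signTwist (ρ : Representation ℂ (Perm (Fin n)) M) {i j : Fin n} (h : i ≠ j) (c : ℂ) :
    eigDim (signTwist ρ) c i j = eigDim ρ (-c) i j := by
  rw [eigDim, eigDim, eigenspace_signTwist ρ h]

lemma exists_perm_pair {i j k l : Fin n} (h : i ≠ j) (h' : k ≠ l) :
    ∃ g : Perm (Fin n), g i = k ∧ g j = l := by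
  refine ⟨swap (swap i k j) l * swap i k, ?_, by simp⟩
  rw [Perm.mul_apply, swap_apply_left, swap_apply_of_ne_of_ne _ h']
  intro e
  have := (swap i k).injective (e.symm.trans (swap_apply_left i k).symm)
  exact h this.symm

lemma eigDim_congr (ρ : Representation ℂ (Perm (Fin n)) M) (c : ℂ) {i j k l : Fin n} (h : i ≠ j)
    (h' : k ≠ l) : eigDim ρ c i j = eigDim ρ c k l := by
  obtain ⟨g, rfl, rfl⟩ := exists_perm_pair h h'
  rw [eigDim, eigDim, swap_apply_apply, finrank_eigenspace_conj]

lemma rep_swap_self (ρ : Representation ℂ (Perm (Fin n)) M) (i : Fin n) (x : M) :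
    ρ (swap i i) x = x := by
  rw [swap_self, ← Perm.one_def, map_one, Module.End.one_apply]

lemma rep_swap_swap (ρ : Representation ℂ (Perm (Fin n)) M) (i j : Fin n) (x : M) :
    ρ (swap i j) (ρ (swap i j) x) = x := by
  rw [← Module.End.mul_apply, ← map_mul, swap_mul_self, map_one, Module.End.one_apply]

/-! ### Vectors fixed by the transpositions of a subset -/

/-- Induction on the support: if `g` moves `x`, then `(x, g x)` preserves `f`, and composing with it
shrinks the support. -/
lemma fixed_of_swaps {κ : Type*} (ρ : Representation ℂ (Perm (Fin n)) M) {w : M} (f : Fin n → κ)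
    (h : ∀ i j, f i = f j → ρ (swap i j) w = w) (g : Perm (Fin n)) (hg : ∀ i, f (g i) = f i) :
    ρ g w = w := by
  induction hk : g.support.card using Nat.strong_induction_on generalizing g with
  | _ k ih =>
    by_cases h1 : g = 1
    · simp [h1]
    · obtain ⟨x, hx⟩ : ∃ x, g x ≠ x := by
        by_contra! hc
        exact h1 (Equiv.ext hc)
      have hlt := Perm.card_support_swap_mul hx
      have hs : ∀ y, f (swap x (g x) y) = f y := by
        intro y
        rw [swap_apply_def]
        split_ifs with e e
        · rw [e, hg]
        · rw [e, hg]
        · rfl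
      have := ih _ (hk ▸ hlt) (swap x (g x) * g) (fun i => by rw [Perm.mul_apply, hs, hg]) rfl
      rw [map_mul, Module.End.mul_apply] at this
      rw [← rep_swap_swap ρ x (g x) (ρ g w), this, h _ _ (hg x).symm]

lemma sign_of_swaps {κ : Type*} (ρ : Representation ℂ (Perm (Fin n)) M) {w : M} (f : Fin n → κ)
    (h : ∀ i j, i ≠ j → f i = f j → ρ (swap i j) w = -w) (g : Perm (Fin n))
    (hg : ∀ i, f (g i) = f i) : ρ g w = ((Perm.sign g : ℤ) : ℂ) • w := by
  have := fixed_of_swaps (signTwist ρ) (w := w) f (fun i j hij => by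
    by_cases e : i = j
    · subst e; exact rep_swap_self _ _ _
    · rw [signTwist_swap _ e, h i j e hij, neg_neg]) g hg
  rw [signTwist_apply] at this
  have h2 := congrArg (((Perm.sign g : ℤ) : ℂ) • ·) this
  simpa only [smul_smul, sign_mul_self_complex, one_smul] using h2

/-- `w` is fixed by all the permutations of `A`. -/
def FixedOn (ρ : Representation ℂ (Perm (Fin n)) M) (A : Finset (Fin n)) (w : M) : Prop :=
  ∀ i ∈ A, ∀ j ∈ A, ρ (swap i j) w = w

lemma FixedOn.apply {ρ : Representation ℂ (Perm (Fin n)) M} {A : Finset (Fin n)} {w : M}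
    (h : FixedOn ρ A w) (g : Perm (Fin n)) (hg : ∀ i ∉ A, g i = i) : ρ g w = w := by
  classical
  refine fixed_of_swaps ρ (fun i => if i ∈ A then none else some i) (fun i j hij => ?_) g fun i => ?_
  · by_cases hi : i ∈ A <;> by_cases hj : j ∈ A <;> simp [hi, hj] at hij
    · exact h i hi j hj
    · rw [hij]; exact rep_swap_self _ _ _
  · by_cases hi : i ∈ A
    · have : g i ∈ A := by
        by_contra hc
        exact hc (by rwa [g.injective (hg _ hc)])
      simp [hi, this]
    · simp [hg i hi]

lemma FixedOn.conj {ρ : Representation ℂ (Perm (Fin n)) M} {A : Finset (Fin n)} {w : M}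
    (h : FixedOn ρ A w) (g : Perm (Fin n)) : FixedOn ρ (A.map g.toEmbedding) (ρ g w) := by
  simp only [FixedOn, Finset.mem_map, Equiv.coe_toEmbedding]
  rintro _ ⟨i, hi, rfl⟩ _ ⟨j, hj, rfl⟩
  rw [← Module.End.mul_apply, ← map_mul, swap_apply_apply, inv_mul_cancel_right, map_mul,
    Module.End.mul_apply, h i hi j hj]

lemma FixedOn.add {ρ : Representation ℂ (Perm (Fin n)) M} {A : Finset (Fin n)} {v w : M}
    (h : FixedOn ρ A v) (h' : FixedOn ρ A w) : FixedOn ρ A (v + w) :=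
  fun i hi j hj => by rw [map_add, h i hi j hj, h' i hi j hj]

lemma exists_perm_map {A B : Finset (Fin n)} (h : A.card = B.card) :
    ∃ g : Perm (Fin n), A.map g.toEmbedding = B := by
  classical
  obtain ⟨e⟩ : Nonempty (A ≃ B) := ⟨Finset.equivOfCardEq h⟩
  refine ⟨e.extendSubtype, ?_⟩
  refine Finset.eq_of_subset_of_card_le ?_ (by simp [h])
  intro x hx
  obtain ⟨y, hy, rfl⟩ := Finset.mem_map.1 hx
  exact e.extendSubtype_mem y hy

/-- The representation has no nonzero vector fixed by the permutations of a `k`-subset. -/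
def NoFixed (ρ : Representation ℂ (Perm (Fin n)) M) (k : ℕ) : Prop :=
  ∀ A : Finset (Fin n), A.card = k → ∀ w, FixedOn ρ A w → w = 0

lemma exists_fixedOn_of_not_noFixed {ρ : Representation ℂ (Perm (Fin n)) M} {k : ℕ}
    (h : ¬ NoFixed ρ k) {B : Finset (Fin n)} (hB : B.card = k) : ∃ w ≠ 0, FixedOn ρ B w := by
  simp only [NoFixed, not_forall] at h
  obtain ⟨A, hA, w, hw, h0⟩ := h
  obtain ⟨g, rfl⟩ := exists_perm_map (hA.trans hB.symm)
  refine ⟨ρ g w, fun h1 => h0 ?_, hw.conj g⟩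
  have := congrArg (ρ g⁻¹) h1
  simpa using this

/-- Symmetrizing a vector fixed by the permutations of `A` over `A ∪ {l}`. -/
lemma FixedOn.insert {ρ : Representation ℂ (Perm (Fin n)) M} {A : Finset (Fin n)} {w : M}
    (h : FixedOn ρ A w) {l : Fin n} (hl : l ∉ A) :
    FixedOn ρ (insert l A) (w + ∑ k ∈ A, ρ (swap k l) w) := by
  classical
  have key : ∀ i ∈ A, ρ (swap i l) (w + ∑ k ∈ A, ρ (swap k l) w) = w + ∑ k ∈ A, ρ (swap k l) w := by
    intro i hi
    rw [map_add, map_sum, ← Finset.add_sum_erase _ _ hi, ← Finset.add_sum_erase A _ hi,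
      rep_swap_swap, ← add_assoc, ← add_assoc, add_comm (ρ (swap i l) w)]
    congr 1
    refine Finset.sum_congr rfl fun k hk => ?_
    obtain ⟨hki, hk⟩ := Finset.mem_erase.1 hk
    -- The elements `1` and `(k l)`, `k ∈ A`, represent the cosets of the permutations of `A` in
    -- those of `A ∪ {l}`. This identity shows that `(i l)` permutes them modulo transpositions that
    -- fix `w`.
    have e : swap i l * swap k l = swap k l * swap k i := by
      have hil : i ≠ l := fun e => hl (e ▸ hi)
      have hkl : k ≠ l := fun e => hl (e ▸ hk)
      have : swap (swap k l i) (swap k l l) = swap k l * swap i l * (swap k l)⁻¹ :=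
        swap_apply_apply _ _ _
      rw [swap_apply_right, swap_apply_of_ne_of_ne hki.symm hil] at this
      have h2 : swap k i = swap k l * (swap i l * swap k l) := by
        rw [swap_comm k i, this, swap_inv, mul_assoc]
      rw [h2, ← mul_assoc (swap k l), swap_mul_self, one_mul]
    rw [← Module.End.mul_apply, ← map_mul, e, map_mul, Module.End.mul_apply, h k hk i hi]
  have key2 : ∀ i ∈ A, ∀ j ∈ A,
      ρ (swap i j) (w + ∑ k ∈ A, ρ (swap k l) w) = w + ∑ k ∈ A, ρ (swap k l) w := by
    intro i hi j hj
    by_cases hij : i = j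
    · rw [hij]; exact rep_swap_self _ _ _
    have hil : i ≠ l := fun e => hl (e ▸ hi)
    have hjl : j ≠ l := fun e => hl (e ▸ hj)
    have e : swap i j = swap i l * swap j l * swap i l := by
      have : swap (swap i l j) (swap i l l) = swap i l * swap j l * (swap i l)⁻¹ :=
        swap_apply_apply _ _ _
      rw [swap_apply_right, swap_apply_of_ne_of_ne (Ne.symm hij) hjl, swap_inv] at this
      rw [swap_comm, this]
    rw [e, map_mul, map_mul, Module.End.mul_apply, Module.End.mul_apply, key i hi, key j hj,
      key i hi]
  intro i hi j hj
  rcases Finset.mem_insert.1 hi with hi | hi <;> rcases Finset.mem_insert.1 hj with hj | hj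
  · rw [hi, hj]; exact rep_swap_self _ _ _
  · rw [hi, swap_comm, key j hj]
  · rw [hj, key i hi]
  · exact key2 i hi j hj

/-- A vector fixed by the stabilizer of a point spreads over the orbit of the point. -/
lemma exists_equivariant {G X : Type*} [Group G] [MulAction G X] (ρ : Representation ℂ G M) (w : M)
    (x₀ : X) (h : ∀ g : G, g • x₀ = x₀ → ρ g w = w) :
    ∃ W : X → M, W x₀ = w ∧ (∀ g x, ρ g (W x) = W (g • x)) ∧
      ∀ x, (∀ g : G, g • x₀ ≠ x) → W x = 0 := by
  classical
  -- The value 0 off the orbit is what makes the systems below vanish at repeated indices.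
  let W : X → M := fun x => if hx : ∃ g : G, g • x₀ = x then ρ hx.choose w else 0
  have hW : ∀ g : G, W (g • x₀) = ρ g w := by
    intro g
    have hx : ∃ k : G, k • x₀ = g • x₀ := ⟨g, rfl⟩
    have h1 : W (g • x₀) = ρ hx.choose w := dif_pos hx
    have h2 := h (g⁻¹ * hx.choose) (by rw [mul_smul, hx.choose_spec, inv_smul_smul])
    rw [h1]
    have h3 := congrArg (ρ g) h2
    rwa [← Module.End.mul_apply, ← map_mul, mul_inv_cancel_left] at h3
  have h0 : ∀ x, (∀ g : G, g • x₀ ≠ x) → W x = 0 := fun x hx => dif_neg (by simpa using hx)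
  refine ⟨W, ?_, ?_, h0⟩
  · simpa using hW 1
  · intro g x
    by_cases hx : ∃ k : G, k • x₀ = x
    · obtain ⟨k, rfl⟩ := hx
      rw [hW, ← mul_smul, hW, map_mul, Module.End.mul_apply]
    · push Not at hx
      rw [h0 x hx, h0 (g • x), map_zero]
      intro k hk
      exact hx (g⁻¹ * k) (by rw [mul_smul, hk, inv_smul_smul])

end Perm

/-! ### The reflecting hyperplanes of the symmetric group -/

section Hyperplane

variable {n : ℕ}

lemma reflRep_mk (g : Perm (Fin n)) (x : Fin n → ℂ) :
    reflRep n g ((diagLine n).mkQ x) = (diagLine n).mkQ (x ∘ ⇑g⁻¹) := rfl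

lemma mem_diagLine {x : Fin n → ℂ} : x ∈ diagLine n ↔ ∃ c : ℂ, ∀ i, x i = c := by
  rw [diagLine, Submodule.mem_span_singleton]
  constructor
  · rintro ⟨c, rfl⟩
    exact ⟨c, fun i => by simp⟩
  · rintro ⟨c, hc⟩
    exact ⟨c, funext fun i => by simp [hc]⟩

/-- The linear form `x ↦ x i - x j` on the reflection representation. -/
def coordDiff (i j : Fin n) : Dual ℂ ((Fin n → ℂ) ⧸ diagLine n) :=
  (diagLine n).liftQ ((LinearMap.proj i : (Fin n → ℂ) →ₗ[ℂ] ℂ) - LinearMap.proj j) fun x hx => by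
    obtain ⟨c, hc⟩ := mem_diagLine.1 hx
    rw [LinearMap.mem_ker, LinearMap.sub_apply, LinearMap.proj_apply, LinearMap.proj_apply, hc, hc,
      sub_self]

lemma coordDiff_mk (i j : Fin n) (x : Fin n → ℂ) :
    coordDiff i j ((diagLine n).mkQ x) = x i - x j := rfl

lemma coordDiff_single {i j : Fin n} (h : i ≠ j) :
    coordDiff i j ((diagLine n).mkQ (Pi.single i 1)) = 1 := by
  rw [coordDiff_mk]
  simp [h]

lemma coordDiff_ne_zero {i j : Fin n} (h : i ≠ j) : coordDiff i j ≠ 0 := by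
  intro h0
  have := coordDiff_single h
  rw [h0] at this
  simp at this

/-- The class of the basis vector `e_k` lies in the hyperplane. If `g` moved `k`, then `e_{g k} -
e_k` would be constant, although it takes the values 1 and -1. -/
lemma fixer_coordDiff_apply {i j : Fin n} {g : Perm (Fin n)}
    (hg : ∀ x ∈ LinearMap.ker (coordDiff i j), reflRep n g x = x) {k : Fin n} (hi : k ≠ i)
    (hj : k ≠ j) : g k = k := by
  by_contra hne
  have h1 := hg ((diagLine n).mkQ (Pi.single k 1)) (by
    rw [LinearMap.mem_ker, coordDiff_mk]
    simp [hi.symm, hj.symm])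
  rw [reflRep_mk, ← sub_eq_zero, ← map_sub, Submodule.mkQ_apply, Submodule.Quotient.mk_eq_zero,
    mem_diagLine] at h1
  obtain ⟨c, hc⟩ := h1
  have h2 := hc (g k)
  have h3 := hc k
  have h4 : g⁻¹ k ≠ k := fun e => hne (by
    have := congrArg g e
    simpa using this.symm)
  have h5 : (Equiv.symm g) k ≠ k := h4
  simp [hne] at h2
  simp [h5] at h3
  rw [← h2] at h3
  norm_num at h3

lemma eq_one_or_eq_swap {i j : Fin n} {g : Perm (Fin n)}
    (hg : ∀ k, k ≠ i → k ≠ j → g k = k) : g = 1 ∨ g = swap i j := by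
  by_cases h : g i = i
  · left
    have hj : g j = j := by
      by_contra hne
      by_cases h2 : g j = i
      · exact hne (by rw [g.injective (h2.trans h.symm)]; exact h)
      · exact hne (g.injective (hg _ h2 hne))
    ext k
    by_cases hi : k = i
    · simp [hi, h]
    by_cases hj' : k = j
    · simp [hj', hj]
    · simp [hg k hi hj']
  · right
    have h1 : g i = j := by
      by_contra hne
      exact h (g.injective (hg _ h hne))
    have h2 : g j = i := by
      by_contra hne
      by_cases h3 : g j = j
      · have h4 : i = j := g.injective (h1.trans h3.symm)
        exact h (h1.trans h4.symm)
      · exact h3 (g.injective (hg _ hne h3))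
    ext k
    by_cases hi : k = i
    · simp [hi, h1]
    by_cases hj' : k = j
    · simp [hj', h2]
    · rw [hg k hi hj', swap_apply_of_ne_of_ne hi hj']

/-- In this form the determinant is 1 plus the value of the linear form on the vector, that is `1 -
2`. -/
lemma reflRep_swap (i j : Fin n) :
    reflRep n (swap i j) = LinearMap.transvection (coordDiff i j)
      ((diagLine n).mkQ (Pi.single j 1 - Pi.single i 1)) := by
  refine LinearMap.ext fun x => ?_
  obtain ⟨x, rfl⟩ := (diagLine n).mkQ_surjective x
  rw [reflRep_mk, LinearMap.transvection.apply, coordDiff_mk, ← map_smul, ← map_add]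
  congr 1
  ext k
  simp only [swap_inv, Function.comp_apply, Pi.add_apply, Pi.smul_apply, Pi.sub_apply,
    Pi.single_apply, smul_eq_mul, swap_apply_def]
  split_ifs with h1 h2 h2 <;> simp_all

lemma det_reflRep_swap {i j : Fin n} (h : i ≠ j) :
    LinearMap.det (reflRep n (swap i j)) = -1 := by
  rw [reflRep_swap, LinearMap.transvection.det, coordDiff_mk]
  simp [h, h.symm]

lemma swap_mem_fixer (i j : Fin n) :
    swap i j ∈ fixer (reflRep n) (LinearMap.ker (coordDiff i j)) := by
  intro x hx
  rw [reflRep_swap, LinearMap.transvection.apply, LinearMap.mem_ker.1 hx, zero_smul, add_zero]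

lemma mem_fixer_coordDiff {i j : Fin n} {g : Perm (Fin n)} :
    g ∈ fixer (reflRep n) (LinearMap.ker (coordDiff i j)) ↔ g = 1 ∨ g = swap i j := by
  constructor
  · intro hg
    exact eq_one_or_eq_swap fun k => fixer_coordDiff_apply hg
  · rintro (rfl | rfl)
    · exact one_mem _
    · exact swap_mem_fixer i j

/-- If `s` fixes the class of `x`, then `x ∘ s⁻¹ - x` is a constant, which is 0 because its
coordinates sum to 0. So `x (s i) = x i` for any point `i` moved by `s`, and the dimensions agree.
That `s` is a transposition need not be proved. -/
lemma exists_eq_ker_coordDiff {H : Submodule ℂ ((Fin n → ℂ) ⧸ diagLine n)}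
    (hH : H ∈ hyperplanes (reflRep n)) :
    ∃ i j : Fin n, i ≠ j ∧ H = LinearMap.ker (coordDiff i j) := by
  obtain ⟨s, hs, rfl⟩ := hH
  obtain ⟨i, hi⟩ : ∃ i, s i ≠ i := by
    by_contra! hc
    have : s = 1 := Equiv.ext hc
    subst this
    rw [IsReflection, map_one, show (1 : End ℂ ((Fin n → ℂ) ⧸ diagLine n)) - LinearMap.id = 0 from
      sub_self _, LinearMap.ker_zero, finrank_top] at hs
    omega
  refine ⟨s i, i, hi, Submodule.eq_of_le_of_finrank_eq ?_ ?_⟩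
  · intro x hx
    obtain ⟨x, rfl⟩ := (diagLine n).mkQ_surjective x
    rw [LinearMap.mem_ker, LinearMap.sub_apply, LinearMap.id_apply, reflRep_mk, ← map_sub,
      Submodule.mkQ_apply, Submodule.Quotient.mk_eq_zero, mem_diagLine] at hx
    obtain ⟨c, hc⟩ := hx
    have hsum : ∑ k, (x ∘ ⇑s⁻¹ - x) k = 0 := by
      simp only [Pi.sub_apply, Function.comp_apply, Finset.sum_sub_distrib]
      rw [Equiv.sum_comp s⁻¹ x, sub_self]
    simp only [hc, Finset.sum_const, Finset.card_univ, Fintype.card_fin, nsmul_eq_mul,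
      mul_eq_zero, Nat.cast_eq_zero] at hsum
    have hn : n ≠ 0 := fun h => (h ▸ i).elim0
    have h1 := hc (s i)
    rw [hsum.resolve_left hn] at h1
    rw [LinearMap.mem_ker, coordDiff_mk, ← neg_eq_zero, ← h1]
    simp
  · have := Dual.finrank_ker_add_one_of_ne_zero (coordDiff_ne_zero hi)
    rw [IsReflection] at hs
    omega

end Hyperplane

/-! ### The four properties in terms of the eigenvalues of a transposition -/

section Properties

variable {n : ℕ} {p q : Fin n}

lemma eH_coordDiff (h : p ≠ q) : eH (reflRep n) (LinearMap.ker (coordDiff p q)) = 2 := by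
  have e : (fixer (reflRep n) (LinearMap.ker (coordDiff p q)) : Set (Perm (Fin n))) =
      {1, swap p q} := by
    ext g
    exact mem_fixer_coordDiff
  rw [eH, ← SetLike.coe_sort_coe, e, Nat.card_coe_set_eq, Set.ncard_pair]
  intro h1
  exact h (by simpa using congrArg (fun g : Perm (Fin n) => g q) h1.symm)

variable {M : Type*} [AddCommGroup M] [Module ℂ M] (ρ : Representation ℂ (Perm (Fin n)) M)

lemma nMult_coordDiff (h : p ≠ q) :
    nMult (reflRep n) (LinearMap.ker (coordDiff p q)) ρ 1 = eigDim ρ (-1) p q := by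
  have h' : (⨅ g : fixer (reflRep n) (LinearMap.ker (coordDiff p q)),
      End.eigenspace (ρ g) ((LinearMap.det (reflRep n g))⁻¹ ^ 1)) =
      End.eigenspace (ρ (swap p q)) (-1) := by
    have hd : (LinearMap.det (reflRep n (swap p q)))⁻¹ ^ 1 = -1 := by
      rw [det_reflRep_swap h]
      norm_num
    ext x
    simp only [Submodule.mem_iInf, End.mem_eigenspace_iff, Subtype.forall]
    constructor
    · intro hx
      have := hx _ (swap_mem_fixer p q)
      rwa [hd] at this
    · intro hx g hg
      rcases mem_fixer_coordDiff.1 hg with rfl | rfl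
      · simp
      · rw [hd, hx]
  rw [nMult, eigDim, h']

lemma nH_coordDiff (h : p ≠ q) :
    nH (reflRep n) (LinearMap.ker (coordDiff p q)) ρ = eigDim ρ (-1) p q := by
  rw [nH, eH_coordDiff h, Finset.sum_range_succ, Finset.sum_range_one, nMult_coordDiff ρ h]
  simp

lemma charRep_apply {G : Type*} [Group G] (χ : G →* ℂˣ) (g : G) (x : ℂ) :
    charRep χ g x = (χ g : ℂ) * x := rfl

lemma signChar_apply (g : Perm (Fin n)) : (signChar n g : ℂ) = ((Perm.sign g : ℤ) : ℂ) := rfl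

lemma eigDim_charRep_one (c : ℂ) (hc : c ≠ 1) : eigDim (charRep (1 : Perm (Fin n) →* ℂˣ)) c p q = 0 := by
  have : End.eigenspace (charRep (1 : Perm (Fin n) →* ℂˣ) (swap p q)) c = ⊥ := by
    rw [eq_bot_iff]
    intro x hx
    rw [End.mem_eigenspace_iff, charRep_apply] at hx
    simp only [MonoidHom.one_apply, Units.val_one, one_mul, smul_eq_mul] at hx
    have : (1 - c) * x = 0 := by linear_combination hx
    exact (mul_eq_zero.1 this).resolve_left (sub_ne_zero.2 hc.symm)
  rw [eigDim, this, finrank_bot]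

lemma eigDim_charRep_sign (h : p ≠ q) : eigDim (charRep (signChar n)) (-1) p q = 1 := by
  have : End.eigenspace (charRep (signChar n) (swap p q)) (-1) = ⊤ := by
    rw [eq_top_iff]
    intro x hx
    rw [End.mem_eigenspace_iff, charRep_apply, signChar_apply, Perm.sign_swap h]
    simp
  rw [eigDim, this, finrank_top, finrank_self]

lemma isGood_iff (h : p ≠ q) :
    IsGood (reflRep n) (LinearMap.ker (coordDiff p q)) ρ ↔ eigDim ρ (-1) p q ≤ 1 := by
  rw [IsGood, nH_coordDiff ρ h, eH_coordDiff h]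
  omega

lemma isPairGood_one_iff (h : p ≠ q) :
    IsPairGood (reflRep n) (LinearMap.ker (coordDiff p q)) ρ 1 ↔ eigDim ρ (-1) p q ≤ 1 := by
  rw [IsPairGood, nH_coordDiff ρ h, eH_coordDiff h, nH_coordDiff _ h,
    eigDim_charRep_one _ (by norm_num)]
  omega

lemma isPairGood_sign_iff (h : p ≠ q) :
    IsPairGood (reflRep n) (LinearMap.ker (coordDiff p q)) ρ (signChar n) ↔
      eigDim ρ (-1) p q = 0 := by
  rw [IsPairGood, nH_coordDiff ρ h, eH_coordDiff h, nH_coordDiff _ h, eigDim_charRep_sign h]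
  omega

lemma eq_zero_of_eq_neg {x : M} (h : x = -x) : x = 0 := by
  have h2 : (2 : ℂ) • x = 0 := by
    rw [two_smul]
    nth_rewrite 1 [h]
    exact neg_add_cancel x
  exact (smul_eq_zero.1 h2).resolve_left two_ne_zero

lemma isCompl_eigenspace_swap (p q : Fin n) :
    IsCompl (End.eigenspace (ρ (swap p q)) 1) (End.eigenspace (ρ (swap p q)) (-1)) := by
  constructor
  · rw [disjoint_iff, eq_bot_iff]
    rintro x ⟨h1, h2⟩
    rw [SetLike.mem_coe, End.mem_eigenspace_iff] at h1 h2
    rw [h1, one_smul, neg_one_smul] at h2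
    exact eq_zero_of_eq_neg h2
  · rw [codisjoint_iff, eq_top_iff]
    intro x _
    rw [Submodule.mem_sup]
    refine ⟨(2⁻¹ : ℂ) • (x + ρ (swap p q) x), ?_, (2⁻¹ : ℂ) • (x - ρ (swap p q) x), ?_, ?_⟩
    · rw [End.mem_eigenspace_iff, map_smul, map_add, rep_swap_swap]
      module
    · rw [End.mem_eigenspace_iff, map_smul, map_sub, rep_swap_swap]
      module
    · module

lemma eigDim_add_eigDim [FiniteDimensional ℂ M] (p q : Fin n) :
    eigDim ρ 1 p q + eigDim ρ (-1) p q = finrank ℂ M :=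
  Submodule.finrank_add_eq_of_isCompl (isCompl_eigenspace_swap ρ p q)

lemma eigDim_neg_one_eq_zero_iff [FiniteDimensional ℂ M] :
    eigDim ρ (-1) p q = 0 ↔ ρ (swap p q) = LinearMap.id := by
  constructor
  · intro h
    rw [eigDim, Submodule.finrank_eq_zero] at h
    have := (isCompl_eigenspace_swap ρ p q).sup_eq_top
    rw [h, sup_bot_eq] at this
    refine LinearMap.ext fun x => ?_
    have hx : x ∈ End.eigenspace (ρ (swap p q)) 1 := this ▸ Submodule.mem_top
    simpa [End.mem_eigenspace_iff] using hx
  · intro h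
    rw [eigDim, Submodule.finrank_eq_zero, eq_bot_iff]
    intro x hx
    rw [End.mem_eigenspace_iff, h, LinearMap.id_apply, neg_one_smul] at hx
    exact eq_zero_of_eq_neg hx

lemma isReflection_swap_iff [FiniteDimensional ℂ M] :
    IsReflection ρ (swap p q) ↔ eigDim ρ (-1) p q = 1 := by
  have h := eigDim_add_eigDim ρ p q
  have e : LinearMap.ker (ρ (swap p q) - LinearMap.id) = End.eigenspace (ρ (swap p q)) 1 := by
    ext x
    rw [LinearMap.mem_ker, LinearMap.sub_apply, LinearMap.id_apply, End.mem_eigenspace_iff,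
      one_smul, sub_eq_zero]
  rw [IsReflection, e]
  rw [eigDim] at h
  omega

lemma isDistinguishedGenerator_iff (h : p ≠ q) (s : Perm (Fin n)) :
    IsDistinguishedGenerator (reflRep n) (LinearMap.ker (coordDiff p q)) s ↔ s = swap p q := by
  rw [IsDistinguishedGenerator, eH_coordDiff h]
  constructor
  · rintro ⟨h1, -⟩
    have hs : s ∈ fixer (reflRep n) (LinearMap.ker (coordDiff p q)) :=
      h1 ▸ Subgroup.mem_zpowers s
    refine (mem_fixer_coordDiff.1 hs).resolve_left ?_
    rintro rfl
    have h2 : swap p q ∈ Subgroup.zpowers (1 : Perm (Fin n)) := h1 ▸ swap_mem_fixer p q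
    rw [Subgroup.zpowers_one_eq_bot, Subgroup.mem_bot] at h2
    exact h (by simpa using congrArg (fun g : Perm (Fin n) => g q) h2)
  · rintro rfl
    constructor
    · refine le_antisymm ?_ ?_
      · rw [Subgroup.zpowers_le]
        exact swap_mem_fixer p q
      · intro g hg
        rcases mem_fixer_coordDiff.1 hg with rfl | rfl
        · exact one_mem _
        · exact Subgroup.mem_zpowers _
    · rw [det_reflRep_swap h, show 2 * Complex.I * Real.pi / ((2 : ℕ) : ℂ) = Real.pi * Complex.I by
        push_cast; ring, Complex.exp_pi_mul_I]

lemma isExcellent_iff [FiniteDimensional ℂ M] (h : p ≠ q) :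
    IsExcellent (reflRep n) (LinearMap.ker (coordDiff p q)) ρ ↔ eigDim ρ (-1) p q ≤ 1 := by
  simp only [IsExcellent, isDistinguishedGenerator_iff h, exists_eq_left, isReflection_swap_iff,
    ← eigDim_neg_one_eq_zero_iff]
  omega

/-- The number of exponents equal to 1 does not depend on the family, and acceptability depends on
nothing else. -/
lemma IsExponentFamily.card_eq (h : p ≠ q) {r : ℕ} {j : Fin r → ℕ}
    (hj : IsExponentFamily (reflRep n) (LinearMap.ker (coordDiff p q)) ρ j) :
    (Finset.univ.filter fun i => j i = 1).card = eigDim ρ (-1) p q := by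
  obtain ⟨hlt, b, hb⟩ := hj
  rw [eH_coordDiff h] at hlt
  have hb' : ∀ i, ρ (swap p q) (b i) = (-1 : ℂ) ^ j i • b i := by
    intro i
    rw [hb i _ (swap_mem_fixer p q), det_reflRep_swap h]
    norm_num
  have e : End.eigenspace (ρ (swap p q)) (-1) =
      Submodule.span ℂ (Set.range fun i : {i // j i = 1} => b i) := by
    apply le_antisymm
    · intro x hx
      rw [End.mem_eigenspace_iff] at hx
      have h0 : ∀ i, j i ≠ 1 → b.repr x i = 0 := by
        intro i hi
        have h1 : j i = 0 := by have := hlt i; omega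
        have hc := congrArg (fun y => b.repr y i) hx
        simp only [map_smul, Finsupp.smul_apply] at hc
        have h2 : b.repr (ρ (swap p q) x) i = b.repr x i := by
          conv_lhs => rw [← b.sum_repr x]
          simp only [map_sum, map_smul, hb', Finsupp.coe_finsetSum, Finset.sum_apply,
            Finsupp.smul_apply, Basis.repr_self, smul_eq_mul, Finsupp.single_apply]
          rw [Finset.sum_eq_single i (fun k _ hk => by simp [hk]) (by simp)]
          simp [h1]
        rw [h2, neg_one_smul, self_eq_neg] at hc
        exact hc
      rw [← b.sum_repr x]
      refine Submodule.sum_mem _ fun i _ => ?_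
      by_cases hi : j i = 1
      · exact Submodule.smul_mem _ _ (Submodule.subset_span ⟨⟨i, hi⟩, rfl⟩)
      · rw [h0 i hi, zero_smul]
        exact Submodule.zero_mem _
    · rw [Submodule.span_le]
      rintro _ ⟨⟨i, hi⟩, rfl⟩
      rw [SetLike.mem_coe, End.mem_eigenspace_iff, hb', hi, pow_one]
  rw [eigDim, e, finrank_span_eq_card
    (b := fun i : {i // j i = 1} => b i) (b.linearIndependent.comp _ Subtype.val_injective),
    Fintype.card_subtype]

lemma exists_isExponentFamily [FiniteDimensional ℂ M] (h : p ≠ q) :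
    ∃ j : Fin (finrank ℂ M) → ℕ,
      IsExponentFamily (reflRep n) (LinearMap.ker (coordDiff p q)) ρ j := by
  let E := End.eigenspace (ρ (swap p q)) 1
  let F := End.eigenspace (ρ (swap p q)) (-1)
  let b := ((finBasis ℂ E).prod (finBasis ℂ F)).map
    (Submodule.prodEquivOfIsCompl _ _ (isCompl_eigenspace_swap ρ p q))
  let e : Fin (finrank ℂ E) ⊕ Fin (finrank ℂ F) ≃ Fin (finrank ℂ M) :=
    finSumFinEquiv.trans (finCongr (eigDim_add_eigDim ρ p q))
  have hb : ∀ i, ρ (swap p q) (b i) = (-1 : ℂ) ^ (Sum.elim (fun _ => 0) (fun _ => 1) i : ℕ) • b i := by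
    rintro (i | i)
    · have := (finBasis ℂ E i).2
      rw [End.mem_eigenspace_iff] at this
      simpa [b] using this
    · have := (finBasis ℂ F i).2
      rw [End.mem_eigenspace_iff] at this
      simpa [b] using this
  refine ⟨fun i => Sum.elim (fun _ => 0) (fun _ => 1) (e.symm i), ?_, b.reindex e, ?_⟩
  · intro i
    rw [eH_coordDiff h]
    change (Sum.elim (fun _ => 0) (fun _ => 1) (e.symm i) : ℕ) < 2
    rcases e.symm i with k | k <;> norm_num
  · intro i g hg
    rw [Basis.reindex_apply]
    rcases mem_fixer_coordDiff.1 hg with rfl | rfl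
    · simp
    · rw [hb, det_reflRep_swap h]
      norm_num

/-- Here `c` is `e_H - n_H(χ)`. The exponents are 0 or 1, so a partial sum counts ones; both parts
can contain at least `c` of them exactly when there are at least `2 * c` in all. -/
lemma isAcceptable_iff_of_nH [FiniteDimensional ℂ M] (h : p ≠ q) (χ : Perm (Fin n) →* ℂˣ) (c : ℕ)
    (hc : nH (reflRep n) (LinearMap.ker (coordDiff p q)) (charRep χ) + c = 2) :
    IsAcceptable (reflRep n) (LinearMap.ker (coordDiff p q)) ρ χ ↔ eigDim ρ (-1) p q < 2 * c := by
  have hc' : (eH (reflRep n) (LinearMap.ker (coordDiff p q)) : ℤ) -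
      nH (reflRep n) (LinearMap.ker (coordDiff p q)) (charRep χ) = c := by
    rw [eH_coordDiff h]
    omega
  have hsum : ∀ j : Fin (finrank ℂ M) → ℕ,
      IsExponentFamily (reflRep n) (LinearMap.ker (coordDiff p q)) ρ j →
      ∀ I : Finset (Fin (finrank ℂ M)), (∑ i ∈ I, (j i : ℤ)) = (I.filter fun i => j i = 1).card := by
    intro j hj I
    rw [Finset.card_filter]
    push_cast
    refine Finset.sum_congr rfl fun i _ => ?_
    have := hj.1 i
    rw [eH_coordDiff h] at this
    split_ifs with h1 <;> omega
  simp only [IsAcceptable, hc']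
  constructor
  · rintro ⟨j, hj, hI⟩
    by_contra! hlt
    rw [← hj.card_eq ρ h] at hlt
    obtain ⟨S, hS, hcard⟩ := Finset.exists_subset_card_eq
      (s := Finset.univ.filter fun i => j i = 1) (n := c) (by omega)
    have h1 := hsum j hj S
    have h2 := hsum j hj Sᶜ
    have hS1 : S.filter (fun i => j i = 1) = S := by
      refine Finset.filter_true_of_mem fun i hi => ?_
      simpa using hS hi
    have hS2 : Sᶜ.filter (fun i => j i = 1) = (Finset.univ.filter fun i => j i = 1) \ S := by
      ext i
      simp [and_comm]
    rw [hS1, hcard] at h1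
    rw [hS2, Finset.card_sdiff_of_subset hS, hcard] at h2
    rcases hI S Sᶜ disjoint_compl_right (Finset.union_compl S) with h3 | h3 <;> omega
  · intro hlt
    obtain ⟨j, hj⟩ := exists_isExponentFamily ρ h
    refine ⟨j, hj, fun I₁ I₂ hd hu => ?_⟩
    have h1 := hsum j hj I₁
    have h2 := hsum j hj I₂
    have h3 := hj.card_eq ρ h
    rw [← hu, Finset.filter_union, Finset.card_union_of_disjoint
      (Finset.disjoint_filter_filter hd)] at h3
    omega

lemma isAcceptable_sign_iff [FiniteDimensional ℂ M] (h : p ≠ q) :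
    IsAcceptable (reflRep n) (LinearMap.ker (coordDiff p q)) ρ (signChar n) ↔
      eigDim ρ (-1) p q ≤ 1 := by
  rw [isAcceptable_iff_of_nH ρ h _ 1 (by rw [nH_coordDiff _ h, eigDim_charRep_sign h])]
  omega

lemma isAcceptable_one_iff [FiniteDimensional ℂ M] (h : p ≠ q) :
    IsAcceptable (reflRep n) (LinearMap.ker (coordDiff p q)) ρ 1 ↔ eigDim ρ (-1) p q ≤ 3 := by
  rw [isAcceptable_iff_of_nH ρ h _ 2
    (by rw [nH_coordDiff _ h, eigDim_charRep_one _ (by norm_num)])]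
  omega

end Properties

/-! ### Dimension estimates -/

section Dimension

variable {α : Type*} {M : Type*} [AddCommGroup M] [Module ℂ M]

lemma card_le_finrank [FiniteDimensional ℂ M] (N : Submodule ℂ M) (v : α → M) (S : Finset α)
    (hv : ∀ k ∈ S, v k ∈ N) (h : ∀ c : α → ℂ, ∑ k ∈ S, c k • v k = 0 → ∀ k ∈ S, c k = 0) :
    S.card ≤ finrank ℂ N := by
  have hli : LinearIndepOn ℂ v (S : Set α) := linearIndepOn_finset_iff.2 h
  have hli' : LinearIndependent ℂ (fun k : S => (⟨v k, hv k k.2⟩ : N)) :=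
    LinearIndependent.of_comp N.subtype hli
  simpa using hli'.fintype_card_le_finrank

lemma finrank_le_card (N : Submodule ℂ M) (v : α → M) (S : Finset α)
    (hN : N ≤ Submodule.span ℂ (v '' S)) : finrank ℂ N ≤ S.card := by
  classical
  rw [← Finset.coe_image] at hN
  exact (Submodule.finrank_mono hN).trans ((finrank_span_finset_le_card _).trans
    Finset.card_image_le)

variable [DecidableEq α]

/-- In a relation between vectors permuted by a transposition the two coefficients agree. -/
lemma coeff_eq_of_swap (v : α → M) (S : Finset α) (T : M →ₗ[ℂ] M) {i j : α} (hi : i ∈ S)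
    (hj : j ∈ S) (hT : ∀ k ∈ S, T (v k) = v (swap i j k)) (hne : v i ≠ v j) (c : α → ℂ)
    (h : ∑ k ∈ S, c k • v k = 0) : c i = c j := by
  by_cases hij : i = j
  · rw [hij]
  -- Subtracting from the relation its image under `T` leaves only the terms of `i` and `j`, which
  -- combine to `(c i - c j) • (v i - v j)`.
  have h1 : ∑ k ∈ S, c k • (v k - v (swap i j k)) = 0 := by
    have h2 := congrArg T h
    rw [map_sum, map_zero] at h2
    simp only [smul_sub, Finset.sum_sub_distrib, h, zero_sub, neg_eq_zero]
    rw [← h2]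
    exact Finset.sum_congr rfl fun k hk => by rw [map_smul, hT k hk]
  rw [Finset.sum_eq_add_of_mem i j hi hj hij (fun k _ hk => by
    rw [swap_apply_of_ne_of_ne hk.1 hk.2, sub_self, smul_zero]), swap_apply_left,
    swap_apply_right] at h1
  have h2 : (c i - c j) • (v i - v j) = 0 := by
    rw [← h1]
    module
  exact sub_eq_zero.1 ((smul_eq_zero.1 h2).resolve_right (sub_ne_zero.2 hne))

/-- Distinct vectors permuted by all the transpositions. -/
structure IsSwapFamily (v : α → M) (S : Finset α) : Prop where
  swap : ∀ i ∈ S, ∀ j ∈ S, ∃ T : M →ₗ[ℂ] M, ∀ k ∈ S, T (v k) = v (swap i j k)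
  ne : ∀ i ∈ S, ∀ j ∈ S, i ≠ j → v i ≠ v j

lemma IsSwapFamily.coeff_eq {v : α → M} {S : Finset α} (h : IsSwapFamily v S) {c : α → ℂ}
    (hc : ∑ k ∈ S, c k • v k = 0) {i j : α} (hi : i ∈ S) (hj : j ∈ S) : c i = c j := by
  by_cases hij : i = j
  · rw [hij]
  obtain ⟨T, hT⟩ := h.swap i hi j hj
  exact coeff_eq_of_swap v S T hi hj hT (h.ne i hi j hj hij) c hc

/-- Extended by the coefficient 0 at `l`, the relation has all its coefficients equal, hence all 0:
a swap family with one vector removed is independent. -/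
lemma IsSwapFamily.coeff_eq_zero_erase {v : α → M} {S : Finset α} (h : IsSwapFamily v S) {l : α}
    (hl : l ∈ S) {c : α → ℂ} (hc : ∑ k ∈ S.erase l, c k • v k = 0) {i : α} (hi : i ∈ S.erase l) :
    c i = 0 := by
  have h1 : ∑ k ∈ S, (if k = l then 0 else c k) • v k = 0 := by
    rw [← Finset.add_sum_erase _ _ hl, if_pos rfl, zero_smul, zero_add, ← hc]
    exact Finset.sum_congr rfl fun k hk => by rw [if_neg (Finset.ne_of_mem_erase hk)]
  have := h.coeff_eq h1 (Finset.mem_of_mem_erase hi) hl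
  simpa [Finset.ne_of_mem_erase hi] using this

/-- A relation has equal coefficients, so it is a multiple of the sum of the family. -/
lemma IsSwapFamily.card_le_of_sum_ne_zero [FiniteDimensional ℂ M] {v : α → M} {S : Finset α}
    (h : IsSwapFamily v S) {N : Submodule ℂ M} (hv : ∀ k ∈ S, v k ∈ N) (h0 : ∑ k ∈ S, v k ≠ 0) :
    S.card ≤ finrank ℂ N := by
  refine card_le_finrank N v S hv fun c hc k hk => ?_
  have : ∑ i ∈ S, c i • v i = c k • ∑ i ∈ S, v i := by
    rw [Finset.smul_sum]
    exact Finset.sum_congr rfl fun i hi => by rw [h.coeff_eq hc hi hk]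
  rw [this] at hc
  exact (smul_eq_zero.1 hc).resolve_right h0

end Dimension

/-! ### Eigenspaces of a transposition, and families of vectors indexed by the points -/

section Systems

variable {n : ℕ} {M : Type*} [AddCommGroup M] [Module ℂ M]
  {ρ : Representation ℂ (Perm (Fin n)) M}

/-- The `ε`-eigenspace of an involution is the image of the projection `(1 + ε s) / 2`, so it is
spanned by the images of a spanning family. All the upper bounds on `eigDim` for the systems rest on
this. -/
lemma eigenspace_swap_le {ι : Type*} {X : ι → M} (hX : Submodule.span ℂ (Set.range X) = ⊤)
    {ε : ℂ} (hε : ε = 1 ∨ ε = -1) {p q : Fin n} {S : Submodule ℂ M}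
    (h : ∀ i, X i + ε • ρ (swap p q) (X i) ∈ S) : End.eigenspace (ρ (swap p q)) ε ≤ S := by
  intro x hx
  rw [End.mem_eigenspace_iff] at hx
  have hall : ∀ y, y + ε • ρ (swap p q) y ∈ S := by
    intro y
    have hy : y ∈ Submodule.span ℂ (Set.range X) := hX ▸ Submodule.mem_top
    induction hy using Submodule.span_induction with
    | mem y hy => obtain ⟨i, rfl⟩ := hy; exact h i
    | zero => simp
    | add y z _ _ hy hz =>
      convert S.add_mem hy hz using 1
      rw [map_add]
      module
    | smul c y _ hy =>
      convert S.smul_mem c hy using 1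
      rw [map_smul]
      module
  have h2 := S.smul_mem (2⁻¹ : ℂ) (hall x)
  convert h2 using 1
  rw [hx]
  rcases hε with rfl | rfl <;> module

/-! ### The trivial representation -/

lemma iso_trivial_of_fixedOn_univ (hρ : IsSimpleRep ρ) {w : M} (hw : w ≠ 0)
    (h : FixedOn ρ Finset.univ w) : Iso ρ (charRep 1) := by
  have hg : ∀ g, ρ g w = w := fun g => h.apply g (by simp)
  have hs := hρ.span_orbit hw
  simp only [hg, Set.range_const] at hs
  let f : ℂ →ₗ[ℂ] M := LinearMap.toSpanSingleton ℂ M w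
  have hb : Function.Bijective f := by
    constructor
    · intro a b hab
      exact smul_left_injective ℂ hw hab
    · intro x
      have hx : x ∈ Submodule.span ℂ {w} := hs ▸ Submodule.mem_top
      exact Submodule.mem_span_singleton.1 hx
  refine (Iso.of_equiv (LinearEquiv.ofBijective f hb) fun g x => ?_).symm'
  change (charRep 1 g x) • w = ρ g (x • w)
  rw [map_smul, hg, charRep_apply]
  simp

lemma iso_trivial_iff [FiniteDimensional ℂ M] (hρ : IsSimpleRep ρ) {p q : Fin n} (hpq : p ≠ q) :
    eigDim ρ (-1) p q = 0 ↔ Iso ρ (charRep 1) := by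
  constructor
  · intro h
    have := hρ.1
    obtain ⟨w, hw⟩ := exists_ne (0 : M)
    refine iso_trivial_of_fixedOn_univ hρ hw fun i _ j _ => ?_
    by_cases hij : i = j
    · rw [hij, rep_swap_self]
    · rw [eigDim_congr ρ _ hpq hij, eigDim_neg_one_eq_zero_iff] at h
      rw [h, LinearMap.id_apply]
  · intro h
    rw [eigDim, finrank_eigenspace_iso h]
    exact eigDim_charRep_one _ (by norm_num)

/-! ### The reflection representation -/

/-- Vectors indexed by the points, permuted by the group, with vanishing sum. -/
structure PointSystem (ρ : Representation ℂ (Perm (Fin n)) M) (W : Fin n → M) : Prop where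
  map : ∀ g i, ρ g (W i) = W (g i)
  sum : ∑ i, W i = 0
  ne : ∃ i, W i ≠ 0

namespace PointSystem

variable {W : Fin n → M}

/-- If two of the vectors coincided, transpositions would make them all equal, and the vanishing sum
would then make them 0. -/
lemma isSwapFamily (h : PointSystem ρ W) : IsSwapFamily W Finset.univ := by
  refine ⟨fun i _ j _ => ⟨ρ (swap i j), fun k _ => h.map _ _⟩, fun i _ j _ hij e => ?_⟩
  have hall : ∀ l, W l = W i := by
    intro l
    by_cases hl : l = i
    · rw [hl]
    · have := congrArg (ρ (swap j l)) e
      rw [h.map, h.map, swap_apply_left, swap_apply_of_ne_of_ne hij (Ne.symm hl)] at this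
      exact this.symm
  have hsum := h.sum
  simp only [hall, Finset.sum_const, Finset.card_univ, Fintype.card_fin] at hsum
  obtain ⟨k, hk⟩ := h.ne
  rw [hall k] at hk
  rw [← Nat.cast_smul_eq_nsmul ℂ, smul_eq_zero] at hsum
  exact (Nat.cast_ne_zero.2 fun h => (h ▸ i).elim0) (hsum.resolve_right hk)

lemma span_eq_top (h : PointSystem ρ W) (hρ : IsSimpleRep ρ) :
    Submodule.span ℂ (Set.range W) = ⊤ := by
  obtain ⟨i, hi⟩ := h.ne
  rw [eq_top_iff, ← hρ.span_orbit hi]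
  refine Submodule.span_mono ?_
  rintro _ ⟨g, rfl⟩
  exact ⟨g i, (h.map g i).symm⟩

lemma eigDim_neg_one_le (h : PointSystem ρ W) (hρ : IsSimpleRep ρ) (p q : Fin n) :
    eigDim ρ (-1) p q ≤ 1 := by
  refine (finrank_le_card _ (fun _ : Unit => W p - W q) Finset.univ ?_).trans (by simp)
  have hm : W p - W q ∈ Submodule.span ℂ
      ((fun _ : Unit => W p - W q) '' ((Finset.univ : Finset Unit) : Set Unit)) :=
    Submodule.subset_span ⟨(), by simp, rfl⟩
  refine eigenspace_swap_le (h.span_eq_top hρ) (Or.inr rfl) fun i => ?_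
  rw [h.map, neg_one_smul, ← sub_eq_add_neg]
  by_cases hp : i = p
  · rw [hp, swap_apply_left]
    exact hm
  by_cases hq : i = q
  · rw [hq, swap_apply_right]
    simpa using Submodule.neg_mem _ hm
  · rw [swap_apply_of_ne_of_ne hp hq, sub_self]
    exact Submodule.zero_mem _

/-- The vanishing sum expresses `W p + W q` through the other vectors. -/
lemma eigDim_one_le (h : PointSystem ρ W) (hρ : IsSimpleRep ρ) {p q : Fin n} (hpq : p ≠ q) :
    eigDim ρ 1 p q ≤ n - 2 := by
  have hcard : ({p, q}ᶜ : Finset (Fin n)).card = n - 2 := by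
    rw [Finset.card_compl, Finset.card_pair hpq, Fintype.card_fin]
  rw [← hcard]
  refine finrank_le_card _ W _ ?_
  have hm : ∀ i, i ≠ p → i ≠ q → W i ∈ Submodule.span ℂ (W '' (({p, q}ᶜ : Finset (Fin n)) : Set _)) :=
    fun i hp hq => Submodule.subset_span ⟨i, by simp [hp, hq], rfl⟩
  have hs : W p + W q ∈ Submodule.span ℂ (W '' (({p, q}ᶜ : Finset (Fin n)) : Set _)) := by
    have := h.sum
    rw [← Finset.sum_add_sum_compl {p, q}, Finset.sum_pair hpq] at this
    rw [eq_neg_of_add_eq_zero_left this]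
    exact Submodule.neg_mem _ (Submodule.sum_mem _ fun i hi => by
      simp at hi
      exact hm i hi.1 hi.2)
  refine eigenspace_swap_le (h.span_eq_top hρ) (Or.inl rfl) fun i => ?_
  rw [h.map, one_smul]
  by_cases hp : i = p
  · rw [hp, swap_apply_left]
    exact hs
  by_cases hq : i = q
  · rw [hq, swap_apply_right, add_comm]
    exact hs
  · rw [swap_apply_of_ne_of_ne hp hq]
    exact Submodule.add_mem _ (hm i hp hq) (hm i hp hq)

lemma le_eigDim_one [FiniteDimensional ℂ M] (h : PointSystem ρ W) {p q : Fin n} (hpq : p ≠ q) :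
    n - 2 ≤ eigDim ρ 1 p q := by
  have hcard : ({p, q}ᶜ : Finset (Fin n)).card = n - 2 := by
    rw [Finset.card_compl, Finset.card_pair hpq, Fintype.card_fin]
  rw [← hcard]
  refine card_le_finrank _ W _ (fun k hk => ?_) fun c hc k hk => ?_
  · simp only [Finset.mem_compl, Finset.mem_insert, Finset.mem_singleton, not_or] at hk
    rw [End.mem_eigenspace_iff, h.map, swap_apply_of_ne_of_ne hk.1 hk.2, one_smul]
  · have hp : p ∉ ({p, q}ᶜ : Finset (Fin n)) := by simp
    have hk' : k ≠ p := fun e => hp (e ▸ hk)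
    have h1 : ∑ i, (if i ∈ ({p, q}ᶜ : Finset (Fin n)) then c i else 0) • W i = 0 := by
      rw [← hc]
      simp only [ite_smul, zero_smul, Finset.sum_ite_mem, Finset.univ_inter]
    have := h.isSwapFamily.coeff_eq h1 (Finset.mem_univ k) (Finset.mem_univ p)
    rwa [if_pos hk, if_neg hp] at this

lemma iso_reflRep (h : PointSystem ρ W) (hρ : IsSimpleRep ρ) : Iso ρ (reflRep n) := by
  let f₀ : (Fin n → ℂ) →ₗ[ℂ] M := Fintype.linearCombination ℂ W
  have hf₀ : ∀ x, f₀ x = ∑ i, x i • W i := fun x => rfl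
  let f : ((Fin n → ℂ) ⧸ diagLine n) →ₗ[ℂ] M := (diagLine n).liftQ f₀ fun x hx => by
    obtain ⟨c, hc⟩ := mem_diagLine.1 hx
    rw [LinearMap.mem_ker, hf₀]
    simp only [hc, ← Finset.smul_sum, h.sum, smul_zero]
  have hf : ∀ x, f ((diagLine n).mkQ x) = ∑ i, x i • W i := fun x => rfl
  have hinj : Function.Injective f := by
    rw [← LinearMap.ker_eq_bot, eq_bot_iff]
    intro x hx
    obtain ⟨x, rfl⟩ := (diagLine n).mkQ_surjective x
    rw [LinearMap.mem_ker, hf] at hx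
    rw [Submodule.mem_bot, Submodule.mkQ_apply, Submodule.Quotient.mk_eq_zero, mem_diagLine]
    obtain ⟨i, -⟩ := h.ne
    exact ⟨x i, fun j => h.isSwapFamily.coeff_eq hx (Finset.mem_univ _) (Finset.mem_univ _)⟩
  have hsurj : Function.Surjective f := by
    rw [← LinearMap.range_eq_top, eq_top_iff, ← h.span_eq_top hρ, Submodule.span_le]
    rintro _ ⟨i, rfl⟩
    refine ⟨(diagLine n).mkQ (Pi.single i 1), ?_⟩
    rw [hf, Finset.sum_eq_single i (fun k _ hk => by simp [hk]) (by simp)]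
    simp
  refine (Iso.of_equiv (LinearEquiv.ofBijective f ⟨hinj, hsurj⟩) fun g x => ?_).symm'
  obtain ⟨x, rfl⟩ := (diagLine n).mkQ_surjective x
  change f (reflRep n g ((diagLine n).mkQ x)) = ρ g (f ((diagLine n).mkQ x))
  rw [reflRep_mk, hf, hf, map_sum, ← Equiv.sum_comp g]
  refine Finset.sum_congr rfl fun i _ => ?_
  rw [map_smul, h.map]
  simp

end PointSystem

lemma exists_pointSystem_of_iso (hρ : IsSimpleRep ρ) (h : Iso ρ (reflRep n)) :
    ∃ W, PointSystem ρ W := by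
  obtain ⟨e, he⟩ := h.symm'.exists_equiv
  refine ⟨fun i => e ((diagLine n).mkQ (Pi.single i 1)), fun g i => ?_, ?_, ?_⟩
  · rw [← he, reflRep_mk]
    congr 2
    ext k
    simp only [Function.comp_apply, Pi.single_apply, Perm.inv_eq_iff_eq]
  · rw [← map_sum, ← map_sum, Finset.univ_sum_single (fun _ : Fin n => (1 : ℂ))]
    have : (diagLine n).mkQ (fun _ => 1) = 0 := by
      rw [Submodule.mkQ_apply, Submodule.Quotient.mk_eq_zero]
      exact mem_diagLine.2 ⟨1, fun _ => rfl⟩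
    rw [this, map_zero]
  · by_contra! hc
    have := hρ.1
    obtain ⟨x, hx⟩ := exists_ne (0 : M)
    apply hx
    obtain ⟨y, rfl⟩ := e.surjective x
    obtain ⟨y, rfl⟩ := (diagLine n).mkQ_surjective y
    rw [← Finset.univ_sum_single y, map_sum, map_sum]
    refine Finset.sum_eq_zero fun i _ => ?_
    rw [show Pi.single i (y i) = y i • (Pi.single i 1 : Fin n → ℂ) by
      rw [← Pi.single_smul, smul_eq_mul, mul_one], map_smul, map_smul, hc, smul_zero]

/-- The sum over the orbit of `w` is invariant: either it is a nonzero fixed vector or it vanishes,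
as a `PointSystem` requires. -/
lemma iso_trivial_or_pointSystem (hρ : IsSimpleRep ρ) {p : Fin n} {w : M} (hw : w ≠ 0)
    (h : FixedOn ρ {p}ᶜ w) : Iso ρ (charRep 1) ∨ ∃ W, PointSystem ρ W := by
  obtain ⟨W, hp, hW, -⟩ := exists_equivariant ρ w p fun g hg => h.apply g (by simpa using hg)
  have hW' : ∀ g i, ρ g (W i) = W (g i) := hW
  by_cases h0 : ∑ i, W i = 0
  · exact Or.inr ⟨W, hW', h0, p, hp ▸ hw⟩
  · refine Or.inl (iso_trivial_of_fixedOn_univ hρ h0 fun i _ j _ => ?_)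
    rw [map_sum]
    simp only [hW']
    exact Equiv.sum_comp _ W

end Systems

/-! ### Systems of vectors indexed by pairs -/

section Pairs

variable {n : ℕ} {M : Type*} [AddCommGroup M] [Module ℂ M]
  {ρ : Representation ℂ (Perm (Fin n)) M}

/-- Vectors indexed by the pairs of points, (anti)symmetric and permuted by the group, with
vanishing row sums. -/
structure PairSystem (ρ : Representation ℂ (Perm (Fin n)) M) (ε : ℂ) (W : Fin n → Fin n → M) :
    Prop where
  map : ∀ g i j, ρ g (W i j) = W (g i) (g j)
  diag : ∀ i, W i i = 0
  symm : ∀ i j, W j i = ε • W i j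
  sum : ∀ i, ∑ j, W i j = 0
  ne : ∀ i j, i ≠ j → W i j ≠ 0

lemma rep_ne_zero (g : Perm (Fin n)) {w : M} (hw : w ≠ 0) : ρ g w ≠ 0 := by
  intro h
  have := congrArg (ρ g⁻¹) h
  exact hw (by simpa using this)

/-- The row sum at `i` is fixed by the permutations of the other `n - 1` points, so `hf` makes it
vanish. -/
lemma exists_pairSystem (hf : NoFixed ρ (n - 1)) {p q : Fin n} (hpq : p ≠ q) {w : M} (hw : w ≠ 0)
    (h : FixedOn ρ {p, q}ᶜ w) {ε : ℂ} (hε : ρ (swap p q) w = ε • w) :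
    ∃ W, PairSystem ρ ε W ∧ W p q = w := by
  obtain ⟨W, h0, hW, hoff⟩ := exists_equivariant ρ w (p, q) fun g hg => h.apply g (by
    rw [Prod.smul_mk, Prod.mk.injEq] at hg
    intro i hi
    simp only [Finset.mem_compl, Finset.mem_insert, Finset.mem_singleton, not_not] at hi
    rcases hi with rfl | rfl
    · exact hg.1
    · exact hg.2)
  have hmap : ∀ g i j, ρ g (W (i, j)) = W (g i, g j) := fun g i j => hW g (i, j)
  have hdiag : ∀ i, W (i, i) = 0 := fun i => hoff _ fun g hg => by
    rw [Prod.smul_mk, Prod.mk.injEq] at hg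
    exact hpq (g.injective (hg.1.trans hg.2.symm))
  have hval : ∀ g : Perm (Fin n), W (g p, g q) = ρ g w := fun g => by rw [← hmap, h0]
  refine ⟨fun i j => W (i, j), ⟨hmap, hdiag, fun i j => ?_, fun i => ?_, fun i j hij => ?_⟩, h0⟩
  · by_cases hij : i = j
    · rw [hij, hdiag, smul_zero]
    · obtain ⟨g, rfl, rfl⟩ := exists_perm_pair hpq hij
      have := hval (g * swap p q)
      rw [Perm.mul_apply, Perm.mul_apply, swap_apply_left, swap_apply_right, map_mul,
        Module.End.mul_apply, hε, map_smul, ← hval] at this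
      exact this
  · refine hf {i}ᶜ (by rw [Finset.card_compl, Finset.card_singleton, Fintype.card_fin]) _
      fun k hk l hl => ?_
    simp only [Finset.mem_compl, Finset.mem_singleton] at hk hl
    rw [map_sum]
    simp only [hmap, swap_apply_of_ne_of_ne (Ne.symm hk) (Ne.symm hl)]
    exact Equiv.sum_comp (swap k l) fun j => W (i, j)
  · obtain ⟨g, rfl, rfl⟩ := exists_perm_pair hpq hij
    rw [hval]
    exact rep_ne_zero g hw

lemma iso_trivial_or_pointSystem_or_pairSystem (hρ : IsSimpleRep ρ) {p q : Fin n} (hpq : p ≠ q)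
    {w : M} (hw : w ≠ 0) (h : FixedOn ρ {p, q}ᶜ w) {ε : ℂ} (hε : ρ (swap p q) w = ε • w) :
    Iso ρ (charRep 1) ∨ (∃ W, PointSystem ρ W) ∨ ∃ W, PairSystem ρ ε W := by
  by_cases hf : NoFixed ρ (n - 1)
  · obtain ⟨W, hW, -⟩ := exists_pairSystem hf hpq hw h hε
    exact Or.inr (Or.inr ⟨W, hW⟩)
  · obtain ⟨v, hv, hfix⟩ := exists_fixedOn_of_not_noFixed hf (B := {p}ᶜ)
      (by rw [Finset.card_compl, Finset.card_singleton, Fintype.card_fin])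
    rcases iso_trivial_or_pointSystem hρ hv hfix with h1 | h1
    · exact Or.inl h1
    · exact Or.inr (Or.inl h1)

namespace PairSystem

variable {ε : ℂ} {W : Fin n → Fin n → M}

/-- Otherwise `W i m - W k m` would not depend on `m ∉ {i, k}`, and the row sums would give `(n - 2)
• (W i j - W k j) = (ε - 1) • W i k`. The two signs are then excluded separately. -/
lemma diff_ne (h : PairSystem ρ ε W) (hε : ε = 1 ∨ ε = -1) (hn : 4 ≤ n) {i j k l : Fin n}
    (hik : i ≠ k) (hij : i ≠ j) (hil : i ≠ l) (hkj : k ≠ j) (hkl : k ≠ l) (hjl : j ≠ l) :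
    W i j - W k j ≠ W i l - W k l := by
  intro e
  have hall : ∀ m, m ≠ i → m ≠ k → W i m - W k m = W i j - W k j := by
    intro m hmi hmk
    by_cases hmj : m = j
    · rw [hmj]
    · have := congrArg (ρ (swap l m)) e
      rw [map_sub, map_sub, h.map, h.map, h.map, h.map, swap_apply_left,
        swap_apply_of_ne_of_ne hil hmi.symm, swap_apply_of_ne_of_ne hkl hmk.symm,
        swap_apply_of_ne_of_ne hjl (Ne.symm hmj)] at this
      exact this.symm
  have hsum : ∑ m, (W i m - W k m - (W i j - W k j)) =
      (W i i - W k i - (W i j - W k j)) + (W i k - W k k - (W i j - W k j)) :=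
    Fintype.sum_eq_add i k hik fun m hm => by rw [hall m hm.1 hm.2, sub_self]
  rw [Finset.sum_sub_distrib, Finset.sum_sub_distrib, h.sum, h.sum, h.diag, h.diag, h.symm i k,
    Finset.sum_const, Finset.card_univ, Fintype.card_fin, ← Nat.cast_smul_eq_nsmul ℂ] at hsum
  have star : ((n : ℂ) - 2) • (W i j - W k j) = (ε - 1) • W i k := by
    linear_combination (norm := module) (-1 : ℂ) • hsum
  have hn2 : (n : ℂ) - 2 ≠ 0 := by
    intro h0
    have : (n : ℂ) = (2 : ℕ) := by push_cast; linear_combination h0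
    have := Nat.cast_injective this
    omega
  have hn1 : (n : ℂ) - 1 ≠ 0 := by
    intro h0
    have : (n : ℂ) = (1 : ℕ) := by push_cast; linear_combination h0
    have := Nat.cast_injective this
    omega
  have hn3 : (n : ℂ) - 3 ≠ 0 := by
    intro h0
    have : (n : ℂ) = (3 : ℕ) := by push_cast; linear_combination h0
    have := Nat.cast_injective this
    omega
  have hn0 : (n : ℂ) ≠ 0 := by
    intro h0
    have := Nat.cast_eq_zero.1 h0
    omega
  rcases hε with rfl | rfl
  · rw [sub_self, zero_smul] at star
    -- In the symmetric case row `j` becomes constant off the diagonal, so its vanishing sum gives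
    -- `(n - 1) • W j i = 0`.
    have e1 : W i j = W k j := sub_eq_zero.1 ((smul_eq_zero.1 star).resolve_left hn2)
    have hconst : ∀ m, m ≠ j → W j m = W j i := by
      intro m hmj
      rw [h.symm m j, h.symm i j, one_smul, one_smul]
      by_cases hmi : m = i
      · rw [hmi]
      by_cases hmk : m = k
      · rw [hmk, e1]
      · have := congrArg (ρ (swap k m)) e1
        rw [h.map, h.map, swap_apply_left, swap_apply_of_ne_of_ne hik (Ne.symm hmi),
          swap_apply_of_ne_of_ne hkj.symm (Ne.symm hmj)] at this
        exact this.symm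
    have h2 : ∑ m, (W j m - W j i) = W j j - W j i :=
      Fintype.sum_eq_single j fun m hm => by rw [hconst m hm, sub_self]
    rw [Finset.sum_sub_distrib, h.sum, h.diag, Finset.sum_const, Finset.card_univ,
      Fintype.card_fin, ← Nat.cast_smul_eq_nsmul ℂ] at h2
    have h3 : ((n : ℂ) - 1) • W j i = 0 := by linear_combination (norm := module) (-1 : ℂ) • h2
    exact h.ne j i hij.symm ((smul_eq_zero.1 h3).resolve_left hn1)
  -- In the antisymmetric case `star` and its images under `(i j)` and `(j k)` give `W i k = W k j`,
  -- then `n (n - 3) • W k j = 0`. This is where `n = 3` must be excluded.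
  · have s2 := congrArg (ρ (swap i j)) star
    have s3 := congrArg (ρ (swap j k)) star
    rw [map_smul, map_smul, map_sub, h.map, h.map, h.map, swap_apply_left, swap_apply_right,
      swap_apply_of_ne_of_ne hik.symm hkj, h.symm i j, h.symm i k, h.symm k j] at s2
    rw [map_smul, map_smul, map_sub, h.map, h.map, h.map, swap_apply_left, swap_apply_right,
      swap_apply_of_ne_of_ne hij hik, h.symm k j] at s3
    have e1 : (n : ℂ) • (W i k - W k j) = 0 := by linear_combination (norm := module) star + s2
    have e2 := (smul_eq_zero.1 e1).resolve_left hn0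
    have e3 : W i k = W k j := sub_eq_zero.1 e2
    rw [e3] at star s2 s3
    have e4 : ((n : ℂ) * (n - 3)) • W k j = 0 := by
      linear_combination (norm := module) s2 + (((n : ℂ) - 2) / 2) • s3
    exact h.ne k j hkj ((smul_eq_zero.1 e4).resolve_left (mul_ne_zero hn0 hn3))

lemma isSwapFamily (h : PairSystem ρ ε W) (hε : ε = 1 ∨ ε = -1) (hn : 4 ≤ n) {p q : Fin n}
    (hpq : p ≠ q) : IsSwapFamily (fun j => W p j - W q j) {p, q}ᶜ := by
  refine ⟨fun i hi j hj => ⟨ρ (swap i j), fun k _ => ?_⟩, fun i hi j hj hij => ?_⟩ <;>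
  · simp only [Finset.mem_compl, Finset.mem_insert, Finset.mem_singleton, not_or] at hi hj
    first
    | rw [map_sub, h.map, h.map, swap_apply_of_ne_of_ne (Ne.symm hi.1) (Ne.symm hj.1),
        swap_apply_of_ne_of_ne (Ne.symm hi.2) (Ne.symm hj.2)]
    | exact h.diff_ne hε hn hpq (Ne.symm hi.1) (Ne.symm hj.1) (Ne.symm hi.2) (Ne.symm hj.2) hij

lemma card_compl_pair {p q : Fin n} (hpq : p ≠ q) : ({p, q}ᶜ : Finset (Fin n)).card = n - 2 := by
  rw [Finset.card_compl, Finset.card_pair hpq, Fintype.card_fin]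

lemma diff_mem (h : PairSystem ρ ε W) {p q k : Fin n} (hk : k ∈ ({p, q}ᶜ : Finset (Fin n))) :
    W p k - W q k ∈ End.eigenspace (ρ (swap p q)) (-1) := by
  simp only [Finset.mem_compl, Finset.mem_insert, Finset.mem_singleton, not_or] at hk
  rw [End.mem_eigenspace_iff, map_sub, h.map, h.map, swap_apply_left, swap_apply_right,
    swap_apply_of_ne_of_ne hk.1 hk.2]
  module

lemma sum_diff (h : PairSystem ρ ε W) {p q : Fin n} (hpq : p ≠ q) :
    ∑ k ∈ ({p, q}ᶜ : Finset (Fin n)), (W p k - W q k) = (ε - 1) • W p q := by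
  have h1 : ∑ k, (W p k - W q k) = 0 := by
    rw [Finset.sum_sub_distrib, h.sum, h.sum, sub_zero]
  rw [← Finset.sum_add_sum_compl {p, q}, Finset.sum_pair hpq, h.diag, h.diag, h.symm p q] at h1
  linear_combination (norm := module) h1

/-- For `ε = -1` the differences `W p k - W q k` sum to `-2 • W p q`, which is not 0, so the swap
family of all `n - 2` of them is independent. -/
lemma le_eigDim_neg_one_of_neg [FiniteDimensional ℂ M] (h : PairSystem ρ (-1) W) (hn : 4 ≤ n)
    {p q : Fin n} (hpq : p ≠ q) : n - 2 ≤ eigDim ρ (-1) p q := by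
  have := (h.isSwapFamily (Or.inr rfl) hn hpq).card_le_of_sum_ne_zero
    (N := End.eigenspace (ρ (swap p q)) (-1)) (fun k hk => h.diff_mem hk) (by
      rw [h.sum_diff hpq]
      exact smul_ne_zero (by norm_num) (h.ne _ _ hpq))
  rwa [card_compl_pair hpq] at this

/-- The independent vectors are the `n - 3` vectors `W a j`, `j ∉ {p, q, a}`, and one more, `W b c`,
stored at the free index `a`. The hypothesis `5 ≤ n` provides three points `a`, `b`, `c` outside
`{p, q}`. -/
lemma le_eigDim_one [FiniteDimensional ℂ M] (h : PairSystem ρ ε W) (hε : ε = 1 ∨ ε = -1)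
    (hn : 5 ≤ n) {p q : Fin n} (hpq : p ≠ q) : n - 2 ≤ eigDim ρ 1 p q := by
  obtain ⟨a, b, c, ha, hb, hc, hab, hac, hbc⟩ := Finset.two_lt_card_iff.1
    (show 2 < ({p, q}ᶜ : Finset (Fin n)).card by rw [card_compl_pair hpq]; omega)
  have ha' := ha
  simp only [Finset.mem_compl, Finset.mem_insert, Finset.mem_singleton, not_or] at ha' hb hc
  rw [← card_compl_pair hpq]
  refine card_le_finrank _ (fun j => if j = a then W b c else W a j) _ (fun k hk => ?_)
    fun c' hc' => ?_
  · simp only [Finset.mem_compl, Finset.mem_insert, Finset.mem_singleton, not_or] at hk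
    rw [End.mem_eigenspace_iff, one_smul]
    split_ifs
    · rw [h.map, swap_apply_of_ne_of_ne hb.1 hb.2, swap_apply_of_ne_of_ne hc.1 hc.2]
    · rw [h.map, swap_apply_of_ne_of_ne ha'.1 ha'.2, swap_apply_of_ne_of_ne hk.1 hk.2]
  · rw [← Finset.add_sum_erase _ _ ha, if_pos rfl] at hc'
    have hc2 : c' a • W b c + ∑ j ∈ ({p, q}ᶜ : Finset (Fin n)).erase a, c' j • W a j = 0 := by
      rw [← hc']
      congr 1
      exact Finset.sum_congr rfl fun j hj => by rw [if_neg (Finset.ne_of_mem_erase hj)]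
    have hset : ({p, q}ᶜ : Finset (Fin n)).erase a = ({a, p}ᶜ : Finset (Fin n)).erase q := by
      ext j
      simp only [Finset.mem_erase, Finset.mem_compl, Finset.mem_insert, Finset.mem_singleton]
      tauto
    have hq : q ∈ ({a, p}ᶜ : Finset (Fin n)) := by
      simp [hpq.symm, Ne.symm ha'.2]
    -- Subtracting the image under `(a p)` removes `W b c`. What remains is a relation in the swap
    -- family of the differences for the pair `a, p`, without its member `q`.
    have hc3 : ∑ j ∈ ({a, p}ᶜ : Finset (Fin n)).erase q, c' j • (W a j - W p j) = 0 := by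
      rw [← hset]
      have h2 := congrArg (ρ (swap a p)) hc2
      rw [map_add, map_zero, map_smul, h.map, swap_apply_of_ne_of_ne hab.symm hb.1,
        swap_apply_of_ne_of_ne hac.symm hc.1, map_sum] at h2
      have h3 : ∑ j ∈ ({p, q}ᶜ : Finset (Fin n)).erase a, ρ (swap a p) (c' j • W a j) =
          ∑ j ∈ ({p, q}ᶜ : Finset (Fin n)).erase a, c' j • W p j := by
        refine Finset.sum_congr rfl fun j hj => ?_
        simp only [Finset.mem_erase, Finset.mem_compl, Finset.mem_insert, Finset.mem_singleton,
          not_or] at hj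
        rw [map_smul, h.map, swap_apply_left, swap_apply_of_ne_of_ne hj.1 hj.2.1]
      rw [h3] at h2
      simp only [smul_sub, Finset.sum_sub_distrib]
      linear_combination (norm := module) hc2 - h2
    have h0 : ∀ j ∈ ({p, q}ᶜ : Finset (Fin n)).erase a, c' j = 0 := fun j hj =>
      (h.isSwapFamily hε (by omega) ha'.1).coeff_eq_zero_erase hq hc3 (hset ▸ hj)
    rw [Finset.sum_eq_zero fun j hj => by rw [h0 j hj, zero_smul], add_zero] at hc2
    intro k hk
    by_cases hka : k = a
    · rw [hka]
      exact (smul_eq_zero.1 hc2).resolve_right (h.ne _ _ hbc)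
    · exact h0 k (Finset.mem_erase.2 ⟨hka, hk⟩)

lemma span_eq_top (h : PairSystem ρ ε W) (hρ : IsSimpleRep ρ) {p q : Fin n} (hpq : p ≠ q) :
    Submodule.span ℂ (Set.range fun x : Fin n × Fin n => W x.1 x.2) = ⊤ := by
  rw [eq_top_iff, ← hρ.span_orbit (h.ne p q hpq)]
  refine Submodule.span_mono ?_
  rintro _ ⟨g, rfl⟩
  exact ⟨(g p, g q), (h.map g p q).symm⟩

/-- Up to scalars, the vectors `W i j - (p q) W i j` are the differences `W p j - W q j` or `(ε - 1)
• W p q`, and `sum_diff` writes the latter through the former. -/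
lemma eigenspace_neg_one_le (h : PairSystem ρ ε W) (hρ : IsSimpleRep ρ) {p q : Fin n}
    (hpq : p ≠ q) : End.eigenspace (ρ (swap p q)) (-1) ≤
      Submodule.span ℂ ((fun j => W p j - W q j) '' (({p, q}ᶜ : Finset (Fin n)) : Set (Fin n))) := by
  have hm : ∀ j, j ≠ p → j ≠ q → W p j - W q j ∈ Submodule.span ℂ
      ((fun j => W p j - W q j) '' (({p, q}ᶜ : Finset (Fin n)) : Set (Fin n))) :=
    fun j hp hq => Submodule.subset_span ⟨j, by simp [hp, hq], rfl⟩
  have hs := h.sum_diff hpq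
  have hs' : (ε - 1) • W p q ∈ Submodule.span ℂ
      ((fun j => W p j - W q j) '' (({p, q}ᶜ : Finset (Fin n)) : Set (Fin n))) := by
    rw [← hs]
    refine Submodule.sum_mem _ fun j hj => ?_
    simp only [Finset.mem_compl, Finset.mem_insert, Finset.mem_singleton, not_or] at hj
    exact hm j hj.1 hj.2
  refine eigenspace_swap_le (h.span_eq_top hρ hpq) (Or.inr rfl) ?_
  rintro ⟨i, j⟩
  simp only [h.map, neg_one_smul, ← sub_eq_add_neg]
  by_cases hip : i = p
  · subst hip
    rw [swap_apply_left]
    by_cases hji : j = i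
    · rw [hji, swap_apply_left, h.diag, h.diag, sub_self]
      exact Submodule.zero_mem _
    by_cases hjq : j = q
    · rw [hjq, swap_apply_right, h.symm i q]
      convert Submodule.neg_mem _ hs' using 1
      module
    · rw [swap_apply_of_ne_of_ne hji hjq]
      exact hm j hji hjq
  by_cases hiq : i = q
  · subst hiq
    rw [swap_apply_right]
    by_cases hji : j = i
    · rw [hji, swap_apply_right, h.diag, h.diag, sub_self]
      exact Submodule.zero_mem _
    by_cases hjp : j = p
    · rw [hjp, swap_apply_left, h.symm p i]
      convert hs' using 1
      module
    · rw [swap_apply_of_ne_of_ne hjp hji, ← neg_sub]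
      exact Submodule.neg_mem _ (hm j hjp hji)
  rw [swap_apply_of_ne_of_ne hip hiq]
  by_cases hjp : j = p
  · rw [hjp, swap_apply_left, h.symm p i, h.symm q i, ← smul_sub]
    exact Submodule.smul_mem _ _ (hm i hip hiq)
  by_cases hjq : j = q
  · rw [hjq, swap_apply_right, h.symm p i, h.symm q i, ← smul_sub, ← neg_sub, smul_neg]
    exact Submodule.neg_mem _ (Submodule.smul_mem _ _ (hm i hip hiq))
  · rw [swap_apply_of_ne_of_ne hjp hjq, sub_self]
    exact Submodule.zero_mem _

lemma eigDim_neg_one_le (h : PairSystem ρ ε W) (hρ : IsSimpleRep ρ) {p q : Fin n} (hpq : p ≠ q) :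
    eigDim ρ (-1) p q ≤ n - 2 := by
  rw [← card_compl_pair hpq]
  exact finrank_le_card _ _ _ (h.eigenspace_neg_one_le hρ hpq)

/-- For `ε = 1` the spanning differences have sum 0, so one of them is superfluous. -/
lemma eigDim_neg_one_le_of_one (h : PairSystem ρ 1 W) (hρ : IsSimpleRep ρ) {p q : Fin n}
    (hpq : p ≠ q) (hn : 3 ≤ n) : eigDim ρ (-1) p q ≤ n - 3 := by
  obtain ⟨l, hl⟩ := Finset.card_pos.1
    (show 0 < ({p, q}ᶜ : Finset (Fin n)).card by rw [card_compl_pair hpq]; omega)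
  have hcard : (({p, q}ᶜ : Finset (Fin n)).erase l).card = n - 3 := by
    rw [Finset.card_erase_of_mem hl, card_compl_pair hpq]
    omega
  rw [← hcard]
  refine finrank_le_card _ (fun j => W p j - W q j) _
    ((h.eigenspace_neg_one_le hρ hpq).trans ?_)
  have hm : ∀ j ∈ ({p, q}ᶜ : Finset (Fin n)).erase l, W p j - W q j ∈ Submodule.span ℂ
      ((fun j => W p j - W q j) '' ((({p, q}ᶜ : Finset (Fin n)).erase l : Finset _) : Set (Fin n))) :=
    fun j hj => Submodule.subset_span ⟨j, hj, rfl⟩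
  rw [Submodule.span_le]
  rintro _ ⟨j, hj, rfl⟩
  by_cases hjl : j = l
  · have hs := h.sum_diff hpq
    rw [sub_self, zero_smul, ← Finset.add_sum_erase _ _ hl] at hs
    rw [hjl]
    change W p l - W q l ∈ _
    rw [eq_neg_of_add_eq_zero_left hs]
    exact Submodule.neg_mem _ (Submodule.sum_mem _ hm)
  · exact hm j (Finset.mem_erase.2 ⟨hjl, hj⟩)

/-- The vectors of the pairs disjoint from `{p, q}` suffice: the row sums give `W j p + W j q` in
terms of them, and then `W p q + W q p`. -/
lemma eigDim_one_le (h : PairSystem ρ ε W) (hρ : IsSimpleRep ρ) {p q : Fin n} (hpq : p ≠ q) :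
    eigDim ρ 1 p q ≤ ((({p, q}ᶜ : Finset (Fin n)) ×ˢ ({p, q}ᶜ : Finset (Fin n))).filter
      fun x => x.1 < x.2).card := by
  set S := (({p, q}ᶜ : Finset (Fin n)) ×ˢ ({p, q}ᶜ : Finset (Fin n))).filter
      fun x => x.1 < x.2 with hS
  refine finrank_le_card _ (fun x => W x.1 x.2) S ?_
  set U := Submodule.span ℂ ((fun x : Fin n × Fin n => W x.1 x.2) '' (S : Set (Fin n × Fin n)))
  have h1 : ∀ i j, i ≠ p → i ≠ q → j ≠ p → j ≠ q → W i j ∈ U := by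
    intro i j hip hiq hjp hjq
    rcases lt_trichotomy i j with hij | hij | hij
    · exact Submodule.subset_span ⟨(i, j), by simp [hS, hip, hiq, hjp, hjq, hij], rfl⟩
    · rw [hij, h.diag]
      exact U.zero_mem
    · rw [h.symm j i]
      exact U.smul_mem _ (Submodule.subset_span ⟨(j, i), by simp [hS, hip, hiq, hjp, hjq, hij], rfl⟩)
  have h2 : ∀ j, j ≠ p → j ≠ q → W j p + W j q ∈ U := by
    intro j hjp hjq
    have := h.sum j
    rw [← Finset.sum_add_sum_compl {p, q}, Finset.sum_pair hpq] at this
    rw [eq_neg_of_add_eq_zero_left this]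
    refine U.neg_mem (U.sum_mem fun i hi => ?_)
    simp only [Finset.mem_compl, Finset.mem_insert, Finset.mem_singleton, not_or] at hi
    exact h1 j i hjp hjq hi.1 hi.2
  have h2' : ∀ j, j ≠ p → j ≠ q → W p j + W q j ∈ U := by
    intro j hjp hjq
    rw [h.symm j p, h.symm j q, ← smul_add]
    exact U.smul_mem _ (h2 j hjp hjq)
  have h3 : W p q + W q p ∈ U := by
    have : ∑ j, (W p j + W q j) = 0 := by
      rw [Finset.sum_add_distrib, h.sum, h.sum, add_zero]
    rw [← Finset.sum_add_sum_compl {p, q}, Finset.sum_pair hpq, h.diag, h.diag, zero_add,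
      add_zero, add_comm (W q p)] at this
    rw [eq_neg_of_add_eq_zero_left this]
    refine U.neg_mem (U.sum_mem fun i hi => ?_)
    simp only [Finset.mem_compl, Finset.mem_insert, Finset.mem_singleton, not_or] at hi
    exact h2' i hi.1 hi.2
  refine eigenspace_swap_le (h.span_eq_top hρ hpq) (Or.inl rfl) ?_
  rintro ⟨i, j⟩
  simp only [h.map, one_smul]
  by_cases hip : i = p
  · subst hip
    rw [swap_apply_left]
    by_cases hji : j = i
    · rw [hji, swap_apply_left, h.diag, h.diag, add_zero]
      exact U.zero_mem
    by_cases hjq : j = q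
    · rw [hjq, swap_apply_right]
      exact h3
    · rw [swap_apply_of_ne_of_ne hji hjq]
      exact h2' j hji hjq
  by_cases hiq : i = q
  · subst hiq
    rw [swap_apply_right]
    by_cases hji : j = i
    · rw [hji, swap_apply_right, h.diag, h.diag, add_zero]
      exact U.zero_mem
    by_cases hjp : j = p
    · rw [hjp, swap_apply_left, add_comm]
      exact h3
    · rw [swap_apply_of_ne_of_ne hjp hji, add_comm]
      exact h2' j hjp hji
  rw [swap_apply_of_ne_of_ne hip hiq]
  by_cases hjp : j = p
  · rw [hjp, swap_apply_left]
    exact h2 i hip hiq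
  by_cases hjq : j = q
  · rw [hjq, swap_apply_right, add_comm]
    exact h2 i hip hiq
  · rw [swap_apply_of_ne_of_ne hjp hjq]
    exact U.add_mem (h1 i j hip hiq hjp hjq) (h1 i j hip hiq hjp hjq)

end PairSystem

end Pairs

/-! ### A criterion for being isomorphic to a Specht module -/

lemma perm_apply_inv {α : Type*} (g : Perm α) (a : α) : g (g⁻¹ a) = a := g.apply_symm_apply a

lemma perm_inv_apply {α : Type*} (g : Perm α) (a : α) : g⁻¹ (g a) = a := g.symm_apply_apply a

/-- The largest of `m + 1` distinct naturals is at least `m`. This inequality and its case of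
equality stand in for the dominance order in `exists_column_perm`. -/
lemma sum_range_card_le (s : Finset ℕ) : ∑ k ∈ Finset.range s.card, k ≤ ∑ k ∈ s, k := by
  induction hn : s.card generalizing s with
  | zero => simp
  | succ m ih =>
    have hne : s.Nonempty := Finset.card_pos.1 (by omega)
    have hmax := s.max'_mem hne
    rw [← Finset.add_sum_erase _ _ hmax, Finset.sum_range_succ, add_comm]
    refine add_le_add ?_ (ih _ (by rw [Finset.card_erase_of_mem hmax]; omega))
    have hsub : s ⊆ Finset.range (s.max' hne + 1) := fun k hk => by
      rw [Finset.mem_range]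
      exact Nat.lt_succ_of_le (s.le_max' k hk)
    have := Finset.card_le_card hsub
    rw [Finset.card_range] at this
    omega

lemma eq_range_of_sum_le (s : Finset ℕ) (h : ∑ k ∈ s, k ≤ ∑ k ∈ Finset.range s.card, k) :
    s = Finset.range s.card := by
  induction hn : s.card generalizing s with
  | zero => simpa using hn
  | succ m ih =>
    have hne : s.Nonempty := Finset.card_pos.1 (by omega)
    have hmax := s.max'_mem hne
    have hc : (s.erase (s.max' hne)).card = m := by rw [Finset.card_erase_of_mem hmax]; omega
    have h1 := sum_range_card_le (s.erase (s.max' hne))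
    rw [← Finset.add_sum_erase _ _ hmax, hn, Finset.sum_range_succ, add_comm] at h
    rw [hc] at h1
    have hsub : s ⊆ Finset.range (s.max' hne + 1) := fun k hk => by
      rw [Finset.mem_range]
      exact Nat.lt_succ_of_le (s.le_max' k hk)
    have h2 := Finset.card_le_card hsub
    rw [Finset.card_range] at h2
    have h3 : s.max' hne = m := by omega
    refine Finset.eq_of_subset_of_card_le (h3 ▸ hsub) (by simp [hn])

section Specht

variable {n : ℕ} {μ : YoungDiagram} (T : Fin n ≃ μ.cells)

/-- The row of an entry. -/
def rowOf (i : Fin n) : ℕ := (T i).1.1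

/-- The column of an entry. -/
def colOf (i : Fin n) : ℕ := (T i).1.2

lemma rowOf_colOf_injective {i j : Fin n} (hr : rowOf T i = rowOf T j)
    (hc : colOf T i = colOf T j) : i = j :=
  T.injective (Subtype.ext (Prod.ext hr hc))

lemma image_rowOf_column (c : ℕ) :
    (Finset.univ.filter fun i => colOf T i = c).image (rowOf T) = Finset.range (μ.colLen c) := by
  ext r
  simp only [Finset.mem_image, Finset.mem_filter, Finset.mem_univ, true_and, Finset.mem_range,
    ← YoungDiagram.mem_iff_lt_colLen]
  constructor
  · rintro ⟨i, rfl, rfl⟩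
    exact (T i).2
  · intro h
    refine ⟨T.symm ⟨(r, c), h⟩, ?_, ?_⟩ <;> simp [rowOf, colOf]

/-- In each column the values of `t` are distinct, so their sum is at least that of `0, 1, …`, which
are the row indices of the column. The totals over all columns agree because `t` rearranges the row
indices. So equality holds in each column, and there `t` takes exactly the row indices. -/
lemma exists_column_perm (t : Fin n → ℕ) (h : Perm (Fin n)) (ht : ∀ i, t (h i) = rowOf T i)
    (hinj : ∀ a b, a ≠ b → colOf T a = colOf T b → t a ≠ t b) :
    ∃ π : Perm (Fin n), (∀ i, colOf T (π i) = colOf T i) ∧ ∀ i, t (π i) = rowOf T i := by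
  classical
  let C : ℕ → Finset (Fin n) := fun c => Finset.univ.filter fun i => colOf T i = c
  have hC : ∀ c i, i ∈ C c ↔ colOf T i = c := fun c i => by simp [C]
  have hti : ∀ c, Set.InjOn t (C c) := fun c a ha b hb hab => by
    by_contra hne
    exact hinj a b hne (((hC c a).1 ha).trans ((hC c b).1 hb).symm) hab
  have hri : ∀ c, Set.InjOn (rowOf T) (C c) := fun c a ha b hb hab =>
    rowOf_colOf_injective T hab (((hC c a).1 ha).trans ((hC c b).1 hb).symm)
  have hrow : ∀ c, (C c).image (rowOf T) = Finset.range (C c).card := by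
    intro c
    have h1 : (C c).image (rowOf T) = Finset.range (μ.colLen c) := image_rowOf_column T c
    have h2 := congrArg Finset.card h1
    rw [Finset.card_image_of_injOn (hri c), Finset.card_range] at h2
    rw [h1, h2]
  have hle : ∀ c, ∑ i ∈ C c, rowOf T i ≤ ∑ i ∈ C c, t i := by
    intro c
    have h1 := sum_range_card_le ((C c).image t)
    rw [Finset.card_image_of_injOn (hti c), Finset.sum_image (hti c)] at h1
    rwa [← hrow, Finset.sum_image (hri c)] at h1
  have htot : ∑ c ∈ Finset.univ.image (colOf T), ∑ i ∈ C c, rowOf T i =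
      ∑ c ∈ Finset.univ.image (colOf T), ∑ i ∈ C c, t i := by
    rw [Finset.sum_fiberwise_of_maps_to (fun i _ => Finset.mem_image_of_mem _ (Finset.mem_univ i)),
      Finset.sum_fiberwise_of_maps_to (fun i _ => Finset.mem_image_of_mem _ (Finset.mem_univ i)),
      ← Equiv.sum_comp h t]
    exact Finset.sum_congr rfl fun i _ => (ht i).symm
  have heq := (Finset.sum_eq_sum_iff_of_le fun c _ => hle c).1 htot
  have hex : ∀ i, ∃ j, colOf T j = colOf T i ∧ t j = rowOf T i := by
    intro i
    have e := heq (colOf T i) (Finset.mem_image_of_mem _ (Finset.mem_univ i))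
    have h1 : (C (colOf T i)).image t = Finset.range (C (colOf T i)).card := by
      have := eq_range_of_sum_le ((C (colOf T i)).image t) (by
        rw [Finset.card_image_of_injOn (hti _), Finset.sum_image (hti _), ← e, ← hrow,
          Finset.sum_image (hri _)])
      rwa [Finset.card_image_of_injOn (hti _)] at this
    have h2 : rowOf T i ∈ (C (colOf T i)).image t := by
      rw [h1, ← hrow]
      exact Finset.mem_image_of_mem _ ((hC _ _).2 rfl)
    obtain ⟨j, hj, hj'⟩ := Finset.mem_image.1 h2
    exact ⟨j, (hC _ _).1 hj, hj'⟩
  choose f hf1 hf2 using hex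
  have hf : Function.Injective f := fun a b hab =>
    rowOf_colOf_injective T (by rw [← hf2, hab, hf2]) (by rw [← hf1, hab, hf1])
  exact ⟨Equiv.ofBijective f (Finite.injective_iff_bijective.1 hf), hf1, hf2⟩

lemma tabloidRep_apply (g : Perm (Fin n)) (f : (Fin n → ℕ) →₀ ℂ) (t : Fin n → ℕ) :
    tabloidRep n g f t = f (t ∘ ⇑g) := by
  change Finsupp.mapDomain (fun t : Fin n → ℕ => t ∘ ⇑g⁻¹) f t = _
  have hinj : Function.Injective fun t : Fin n → ℕ => t ∘ ⇑g⁻¹ :=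
    (g⁻¹).surjective.injective_comp_right
  have := Finsupp.mapDomain_apply hinj f (t ∘ ⇑g)
  rw [← this]
  congr 1
  ext i
  simp

/-- `f` is alternating under the column stabilizer of `T`. -/
def IsColumnSign (f : (Fin n → ℕ) →₀ ℂ) : Prop :=
  ∀ π : Perm (Fin n), (∀ i, colOf T (π i) = colOf T i) →
    tabloidRep n π f = ((Perm.sign π : ℤ) : ℂ) • f

/-- The transposition `(a b)` lies in the column stabilizer and fixes `t`, so the coefficient at `t`
is its own negative. -/
lemma IsColumnSign.apply_eq_zero {f : (Fin n → ℕ) →₀ ℂ} (hf : IsColumnSign T f) {t : Fin n → ℕ}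
    {a b : Fin n} (hab : a ≠ b) (hc : colOf T a = colOf T b) (ht : t a = t b) : f t = 0 := by
  have hs : ∀ {f : Fin n → ℕ}, f a = f b → ∀ i, f (swap a b i) = f i := by
    intro f h i
    rw [swap_apply_def]
    split_ifs with e e
    · rw [e, h]
    · rw [e, h]
    · rfl
  have h1 := DFunLike.congr_fun (hf (swap a b) (hs hc)) t
  rw [tabloidRep_apply, show t ∘ ⇑(swap a b) = t from funext (hs ht)] at h1
  simp only [Perm.sign_swap hab, Finsupp.smul_apply] at h1
  push_cast at h1
  exact eq_zero_of_eq_neg (by simpa using h1)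

lemma IsColumnSign.eq_zero {f : (Fin n → ℕ) →₀ ℂ} (hf : IsColumnSign T f)
    (hs : ∀ t, f t ≠ 0 → ∃ h : Perm (Fin n), ∀ i, t (h i) = rowOf T i)
    (h0 : f (rowOf T) = 0) : f = 0 := by
  ext t
  by_contra hne
  change f t ≠ 0 at hne
  obtain ⟨h, hh⟩ := hs t hne
  obtain ⟨π, hπ, hπ'⟩ := exists_column_perm T t h hh fun a b hab hc e =>
    hne (hf.apply_eq_zero T hab hc e)
  have h1 := DFunLike.congr_fun (hf π hπ) t
  rw [tabloidRep_apply, show t ∘ ⇑π = rowOf T from funext hπ', h0, Finsupp.smul_apply,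
    smul_eq_mul, eq_comm, mul_eq_zero] at h1
  refine h1.elim (fun h2 => ?_) hne
  have := sign_mul_self_complex π
  rw [h2, zero_mul] at this
  exact zero_ne_one this

lemma polytabloid_isColumnSign : IsColumnSign T (polytabloid T) := by
  classical
  intro π hπ
  simp only [polytabloid, map_sum, Finset.smul_sum]
  refine Finset.sum_bij' (fun σ _ => π * σ) (fun σ _ => π⁻¹ * σ) ?_ ?_ ?_ ?_ ?_
  · intro σ hσ
    simp only [Finset.mem_filter, Finset.mem_univ, true_and] at hσ ⊢
    intro i
    exact (hπ (σ i)).trans (hσ i)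
  · intro σ hσ
    simp only [Finset.mem_filter, Finset.mem_univ, true_and] at hσ ⊢
    intro i
    rw [← hσ i]
    have := hπ (π⁻¹ (σ i))
    rw [perm_apply_inv] at this
    exact this.symm
  · intro σ _
    group
  · intro σ _
    group
  · intro σ _
    simp only [tabloidRep, MonoidHom.coe_mk, OneHom.coe_mk, Finsupp.lmapDomain_apply,
      Finsupp.mapDomain_single, Finsupp.smul_single]
    congr 1
    rw [Perm.sign_mul, smul_eq_mul]
    push_cast
    rw [← mul_assoc, sign_mul_self_complex, one_mul]

lemma polytabloid_apply_rowOf : polytabloid T (rowOf T) = 1 := by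
  classical
  rw [polytabloid, Finsupp.finsetSum_apply, Finset.sum_eq_single 1]
  · rw [Finsupp.single_apply, if_pos (by ext i; simp [rowOf])]
    simp
  · intro π hπ hne
    rw [Finsupp.single_apply, if_neg]
    intro e
    apply hne
    simp only [Finset.mem_filter, Finset.mem_univ, true_and] at hπ
    ext i
    have h1 := congrFun e (π i)
    rw [perm_inv_apply] at h1
    rw [rowOf_colOf_injective T (i := π i) (j := i) h1.symm (hπ i)]
    rfl
  · intro h
    simp at h

lemma exists_of_polytabloid_apply_ne_zero {t : Fin n → ℕ} (h : polytabloid T t ≠ 0) :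
    ∃ h : Perm (Fin n), ∀ i, t (h i) = rowOf T i := by
  classical
  rw [polytabloid, Finsupp.finsetSum_apply] at h
  obtain ⟨π, -, hπ⟩ := Finset.exists_ne_zero_of_sum_ne_zero h
  rw [Finsupp.single_apply] at hπ
  split_ifs at hπ with e
  · exact ⟨π, fun i => by rw [← e]; simp [rowOf]⟩
  · exact absurd rfl hπ

variable {T} in
-- By `exists_column_perm` a column-alternating combination of tabloids of the shape of `T` is
-- determined by its coefficient at the tabloid of `T`, which is 1 for the polytabloid.
lemma IsColumnSign.eq_smul {f : (Fin n → ℕ) →₀ ℂ} (hf : IsColumnSign T f)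
    (hs : ∀ t, f t ≠ 0 → ∃ h : Perm (Fin n), ∀ i, t (h i) = rowOf T i) :
    f = f (rowOf T) • polytabloid T := by
  rw [← sub_eq_zero]
  refine IsColumnSign.eq_zero T (fun π hπ => ?_) (fun t ht => ?_) ?_
  · rw [map_sub, map_smul, hf π hπ, polytabloid_isColumnSign T π hπ]
    module
  · by_cases h1 : f t = 0
    · refine exists_of_polytabloid_apply_ne_zero T fun h2 => ht ?_
      simp [h1, h2]
    · exact hs t h1
  · simp [polytabloid_apply_rowOf]

variable {M : Type*} [AddCommGroup M] [Module ℂ M] {ρ : Representation ℂ (Perm (Fin n)) M}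

/-- The map to the tabloids given by the translates of a linear form. -/
def toTabloids (ρ : Representation ℂ (Perm (Fin n)) M) (l : Dual ℂ M) :
    M →ₗ[ℂ] ((Fin n → ℕ) →₀ ℂ) :=
  ∑ g : Perm (Fin n), Finsupp.lsingle (rowOf T ∘ ⇑g⁻¹) ∘ₗ l ∘ₗ ρ g⁻¹

lemma toTabloids_apply (l : Dual ℂ M) (x : M) :
    toTabloids T ρ l x = ∑ g : Perm (Fin n), Finsupp.single (rowOf T ∘ ⇑g⁻¹) (l (ρ g⁻¹ x)) := by
  simp [toTabloids]

lemma toTabloids_equivariant (l : Dual ℂ M) (h : Perm (Fin n)) (x : M) :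
    toTabloids T ρ l (ρ h x) = tabloidRep n h (toTabloids T ρ l x) := by
  rw [toTabloids_apply, toTabloids_apply, map_sum, ← Equiv.sum_comp (Equiv.mulLeft h)]
  refine Finset.sum_congr rfl fun g _ => ?_
  simp only [tabloidRep, MonoidHom.coe_mk, OneHom.coe_mk, Finsupp.lmapDomain_apply,
    Finsupp.mapDomain_single, Equiv.coe_mulLeft, mul_inv_rev]
  rw [← Module.End.mul_apply, ← map_mul, inv_mul_cancel_right]
  rfl

lemma exists_of_toTabloids_ne_zero (l : Dual ℂ M) (x : M) {t : Fin n → ℕ}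
    (h : toTabloids T ρ l x t ≠ 0) : ∃ h : Perm (Fin n), ∀ i, t (h i) = rowOf T i := by
  classical
  rw [toTabloids_apply, Finsupp.finsetSum_apply] at h
  obtain ⟨g, -, hg⟩ := Finset.exists_ne_zero_of_sum_ne_zero h
  rw [Finsupp.single_apply] at hg
  split_ifs at hg with e
  · exact ⟨g, fun i => by rw [← e]; simp⟩
  · exact absurd rfl hg

/-- The row stabilizer of a tableau. -/
def rowStabilizer : Finset (Perm (Fin n)) :=
  Finset.univ.filter fun g => ∀ i, rowOf T (g i) = rowOf T i

lemma mem_rowStabilizer {g : Perm (Fin n)} :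
    g ∈ rowStabilizer T ↔ ∀ i, rowOf T (g i) = rowOf T i := by
  simp [rowStabilizer]

lemma toTabloids_apply_rowOf (l : Dual ℂ M) (x : M) :
    toTabloids T ρ l x (rowOf T) = l (∑ g ∈ rowStabilizer T, ρ g x) := by
  classical
  rw [toTabloids_apply, Finsupp.finsetSum_apply, map_sum, ← Equiv.sum_comp (Equiv.inv _),
    rowStabilizer, Finset.sum_filter]
  refine Finset.sum_congr rfl fun g _ => ?_
  simp only [Equiv.inv_apply, inv_inv, Finsupp.single_apply, funext_iff, Function.comp_apply]

lemma polytabloid_mem : polytabloid T ∈ spechtSubmodule n μ :=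
  Submodule.subset_span ⟨T, rfl⟩

/-- Since `x` generates `M` and row symmetrization does not kill `w`, it does not kill some
translate of `x`; a linear form `l` detects this. The translates of `l` define an equivariant map to
tabloids that sends `x` to a column-alternating element, that is a nonzero multiple of the
polytabloid of `T`. Its image is therefore the Specht module, and simplicity of `ρ` makes it
injective. -/
theorem iso_spechtRep (hρ : IsSimpleRep ρ) {w x : M} (hw : w ≠ 0) (hx : x ≠ 0)
    (hR : ∀ g : Perm (Fin n), (∀ i, rowOf T (g i) = rowOf T i) → ρ g w = w)
    (hC : ∀ g : Perm (Fin n), (∀ i, colOf T (g i) = colOf T i) →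
      ρ g x = ((Perm.sign g : ℤ) : ℂ) • x) : Iso ρ (spechtRep n μ) := by
  obtain ⟨h, hh⟩ : ∃ h, ∑ g ∈ rowStabilizer T, ρ g (ρ h x) ≠ 0 := by
    by_contra! hc
    have h0 : ∀ y, ∑ g ∈ rowStabilizer T, ρ g y = 0 := by
      intro y
      have hy : y ∈ Submodule.span ℂ (Set.range fun g => ρ g x) :=
        hρ.span_orbit hx ▸ Submodule.mem_top
      induction hy using Submodule.span_induction with
      | mem y hy => obtain ⟨g, rfl⟩ := hy; exact hc g
      | zero => simp
      | add y z _ _ hy hz => simp only [map_add, Finset.sum_add_distrib, hy, hz, add_zero]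
      | smul c y _ hy => simp only [map_smul, ← Finset.smul_sum, hy, smul_zero]
    have h1 := h0 w
    rw [Finset.sum_congr rfl fun g hg => hR g ((mem_rowStabilizer T).1 hg), Finset.sum_const,
      ← Nat.cast_smul_eq_nsmul ℂ, smul_eq_zero, Nat.cast_eq_zero, Finset.card_eq_zero] at h1
    refine h1.elim (fun h2 => ?_) hw
    have : (1 : Perm (Fin n)) ∈ rowStabilizer T := (mem_rowStabilizer T).2 fun i => rfl
    rw [h2] at this
    simp at this
  obtain ⟨l, hl⟩ : ∃ l : Dual ℂ M, l (∑ g ∈ rowStabilizer T, ρ g (ρ h x)) ≠ 0 := by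
    by_contra! hc
    exact hh ((Module.forall_dual_apply_eq_zero_iff ℂ _).1 hc)
  have hψ := toTabloids_equivariant T (ρ := ρ) l
  set ψ := toTabloids T ρ l with hψdef
  have hsign : IsColumnSign T (ψ x) := fun π hπ => by rw [← hψ, hC π hπ, map_smul]
  have hx' : ψ x = ψ x (rowOf T) • polytabloid T :=
    hsign.eq_smul fun t ht => exists_of_toTabloids_ne_zero T l x ht
  have hc : ψ x (rowOf T) ≠ 0 := by
    intro h0
    rw [h0, zero_smul] at hx'
    apply hl
    rw [← toTabloids_apply_rowOf, ← hψdef, hψ, hx', map_zero, Finsupp.zero_apply]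
  have hmem : ∀ y, ψ y ∈ spechtSubmodule n μ := by
    intro y
    have hy : y ∈ Submodule.span ℂ (Set.range fun g => ρ g x) :=
      hρ.span_orbit hx ▸ Submodule.mem_top
    induction hy using Submodule.span_induction with
    | mem y hy =>
      obtain ⟨g, rfl⟩ := hy
      rw [hψ, hx', map_smul]
      exact Submodule.smul_mem _ _ (spechtSubmodule_le_comap n μ g (polytabloid_mem T))
    | zero => simp
    | add y z _ _ hy hz => rw [map_add]; exact Submodule.add_mem _ hy hz
    | smul c y _ hy => rw [map_smul]; exact Submodule.smul_mem _ _ hy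
  have hsub : ∀ g y, ψ.codRestrict _ hmem (ρ g y) =
      spechtRep n μ g (ψ.codRestrict _ hmem y) := fun g y => Subtype.ext (hψ g y)
  refine Iso.of_surjective (N := spechtSubmodule n μ) (τ := spechtRep n μ) hρ
    (ψ.codRestrict _ hmem) hsub ?_ ?_
  · intro h0
    have : ψ x = 0 := congrArg Subtype.val (LinearMap.congr_fun h0 x)
    rw [this] at hc
    exact hc rfl
  · rw [← LinearMap.range_eq_top, eq_top_iff]
    rintro ⟨y, hy⟩ -
    have : y ∈ LinearMap.range ψ := by
      refine (Submodule.span_le.2 ?_ : spechtSubmodule n μ ≤ LinearMap.range ψ) hy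
      rintro _ ⟨T', rfl⟩
      refine ⟨(ψ x (rowOf T))⁻¹ • ρ (T.trans T'.symm) x, ?_⟩
      rw [map_smul, hψ, hx', map_smul, smul_smul, ← hx', inv_mul_cancel₀ hc, one_smul,
        tabloidRep_polytabloid]
      exact congrArg polytabloid (Equiv.ext fun i => T.apply_symm_apply _)
    obtain ⟨z, hz⟩ := this
    exact ⟨z, Subtype.ext hz⟩

/-! ### Fixed and alternating vectors of a Specht module -/

lemma spechtRep_coe (g : Perm (Fin n)) (x : spechtSubmodule n μ) :
    ((spechtRep n μ g x : spechtSubmodule n μ) : (Fin n → ℕ) →₀ ℂ) = tabloidRep n g x := rfl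

lemma exists_spechtRep_sign : ∃ x : spechtSubmodule n μ, x ≠ 0 ∧
    ∀ g : Perm (Fin n), (∀ i, colOf T (g i) = colOf T i) →
      spechtRep n μ g x = ((Perm.sign g : ℤ) : ℂ) • x := by
  refine ⟨⟨polytabloid T, polytabloid_mem T⟩, fun h => ?_, fun g hg => ?_⟩
  · have h1 : polytabloid T = 0 := congrArg Subtype.val h
    have h2 := polytabloid_apply_rowOf T
    rw [h1] at h2
    simp at h2
  · exact Subtype.ext (polytabloid_isColumnSign T g hg)

/-- The row symmetrization of the polytabloid is not 0: its coefficient at the tabloid of `T` is the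
order of the row stabilizer. -/
lemma exists_spechtRep_fixed : ∃ x : spechtSubmodule n μ, x ≠ 0 ∧
    ∀ g : Perm (Fin n), (∀ i, rowOf T (g i) = rowOf T i) → spechtRep n μ g x = x := by
  refine ⟨∑ g ∈ rowStabilizer T, spechtRep n μ g ⟨polytabloid T, polytabloid_mem T⟩, fun h => ?_,
    fun g hg => ?_⟩
  · have h1 := congrArg Subtype.val h
    rw [AddSubmonoidClass.coe_finsetSum] at h1
    have h2 := DFunLike.congr_fun h1 (rowOf T)
    rw [Finsupp.finsetSum_apply, Finset.sum_congr rfl (g := fun _ => (1 : ℂ)) fun g hg => by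
      rw [spechtRep_coe, tabloidRep_apply,
        show rowOf T ∘ ⇑g = rowOf T from funext ((mem_rowStabilizer T).1 hg),
        polytabloid_apply_rowOf]] at h2
    simp only [Finset.sum_const, nsmul_eq_mul, mul_one, ZeroMemClass.coe_zero,
      Finsupp.coe_zero, Pi.zero_apply, Nat.cast_eq_zero, Finset.card_eq_zero] at h2
    have : (1 : Perm (Fin n)) ∈ rowStabilizer T := (mem_rowStabilizer T).2 fun i => rfl
    rw [h2] at this
    simp at this
  · rw [map_sum]
    refine Finset.sum_bij' (fun r _ => g * r) (fun r _ => g⁻¹ * r) ?_ ?_ ?_ ?_ ?_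
    · intro r hr
      rw [mem_rowStabilizer] at hr ⊢
      exact fun i => (hg (r i)).trans (hr i)
    · intro r hr
      rw [mem_rowStabilizer] at hr ⊢
      intro i
      have := hg (g⁻¹ (r i))
      rw [perm_apply_inv] at this
      exact this.symm.trans (hr i)
    · intro r _
      group
    · intro r _
      group
    · intro r _
      rw [map_mul, Module.End.mul_apply]

/-- When `A` has more elements than there are columns, two of them share a column in any tableau.
Their transposition negates the polytabloid, so symmetrizing over the permutations of `A` kills the
whole Specht module, whereas it multiplies `x` by a nonzero integer. -/
lemma spechtRep_eq_zero_of_fixedOn {k : ℕ} (hk : ∀ c ∈ μ.cells, c.2 < k) {A : Finset (Fin n)}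
    (hA : k < A.card) {x : spechtSubmodule n μ} (hx : FixedOn (spechtRep n μ) A x) : x = 0 := by
  classical
  set P : Finset (Perm (Fin n)) := Finset.univ.filter fun g => ∀ i ∉ A, g i = i with hP
  have hkill : ∀ y ∈ spechtSubmodule n μ, ∑ g ∈ P, tabloidRep n g y = 0 := by
    intro y hy
    induction hy using Submodule.span_induction with
    | mem y hy =>
      obtain ⟨T, rfl⟩ := hy
      obtain ⟨a, ha, b, hb, hab, hc⟩ := Finset.exists_ne_map_eq_of_card_lt_of_maps_to
        (s := A) (t := Finset.range k) (f := colOf T) (by simpa using hA)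
        (fun i _ => by simpa [colOf] using hk _ (T i).2)
      have hcol : ∀ i, colOf T (swap a b i) = colOf T i := by
        intro i
        rw [swap_apply_def]
        split_ifs with e e
        · rw [e, hc]
        · rw [e, hc]
        · rfl
      have h1 := polytabloid_isColumnSign T (swap a b) hcol
      rw [Perm.sign_swap hab] at h1
      have h2 : ∑ g ∈ P, tabloidRep n g (polytabloid T) =
          ∑ g ∈ P, tabloidRep n g (tabloidRep n (swap a b) (polytabloid T)) := by
        have hmem : ∀ g ∈ P, g * swap a b ∈ P := by
          intro g hg
          simp only [hP, Finset.mem_filter, Finset.mem_univ, true_and] at hg ⊢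
          intro i hi
          rw [Perm.mul_apply, swap_apply_of_ne_of_ne (ne_of_mem_of_not_mem ha hi).symm
            (ne_of_mem_of_not_mem hb hi).symm, hg i hi]
        refine Finset.sum_bij' (fun g _ => g * swap a b) (fun g _ => g * swap a b) hmem hmem ?_ ?_ ?_
        · intro g _
          rw [mul_assoc, swap_mul_self, mul_one]
        · intro g _
          rw [mul_assoc, swap_mul_self, mul_one]
        · intro g _
          rw [← Module.End.mul_apply, ← map_mul, mul_assoc, swap_mul_self, mul_one]
      rw [h1] at h2
      simp only [map_smul, ← Finset.smul_sum] at h2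
      refine eq_zero_of_eq_neg (h2.trans ?_)
      push_cast
      rw [neg_one_smul]
    | zero => simp
    | add y z _ _ hy hz => simp only [map_add, Finset.sum_add_distrib, hy, hz, add_zero]
    | smul c y _ hy => simp only [map_smul, ← Finset.smul_sum, hy, smul_zero]
  have h1 := hkill x x.2
  rw [Finset.sum_congr rfl (g := fun _ => (x : (Fin n → ℕ) →₀ ℂ)) fun g hg => by
    rw [← spechtRep_coe, hx.apply g (Finset.mem_filter.1 hg).2], Finset.sum_const,
    ← Nat.cast_smul_eq_nsmul ℂ, smul_eq_zero, Nat.cast_eq_zero, Finset.card_eq_zero] at h1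
  refine h1.elim (fun h2 => ?_) fun h2 => Subtype.ext h2
  have : (1 : Perm (Fin n)) ∈ P := by simp [hP]
  rw [h2] at this
  simp at this

/-- When `A` has more elements than there are rows, every tabloid has two elements of `A` in one
row. Their transposition fixes the tabloid and negates `x`, so the coefficient is 0. -/
lemma spechtRep_eq_zero_of_signTwist_fixedOn {k : ℕ} (hk : ∀ c ∈ μ.cells, c.1 < k)
    {A : Finset (Fin n)} (hA : k < A.card) {x : spechtSubmodule n μ}
    (hx : FixedOn (signTwist (spechtRep n μ)) A x) : x = 0 := by
  have hsupp : ∀ y ∈ spechtSubmodule n μ, ∀ t, y t ≠ 0 → ∀ i, t i < k := by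
    intro y hy
    induction hy using Submodule.span_induction with
    | mem y hy =>
      obtain ⟨T, rfl⟩ := hy
      intro t ht i
      obtain ⟨h, hh⟩ := exists_of_polytabloid_apply_ne_zero T ht
      have := hh (h⁻¹ i)
      rw [perm_apply_inv] at this
      rw [this]
      exact hk _ (T _).2
    | zero => intro t ht; exact absurd rfl ht
    | add y z _ _ hy hz =>
      intro t ht
      by_cases h1 : y t = 0
      · exact hz t fun h2 => ht (by simp [h1, h2])
      · exact hy t h1
    | smul c y _ hy =>
      intro t ht
      exact hy t fun h2 => ht (by simp [h2])
  apply Subtype.ext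
  ext t
  by_contra hne
  change (x : (Fin n → ℕ) →₀ ℂ) t ≠ 0 at hne
  obtain ⟨a, ha, b, hb, hab, hc⟩ := Finset.exists_ne_map_eq_of_card_lt_of_maps_to
    (s := A) (t := Finset.range k) (f := t) (by simpa using hA)
    (fun i _ => by simpa using hsupp x x.2 t hne i)
  have h1 := hx a ha b hb
  rw [signTwist_swap _ hab] at h1
  have h2 := DFunLike.congr_fun (congrArg Subtype.val h1) t
  have h3 : t ∘ ⇑(swap a b) = t := by
    ext i
    rw [Function.comp_apply, swap_apply_def]
    split_ifs with e e
    · rw [e, hc]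
    · rw [e, hc]
    · rfl
  rw [Submodule.coe_neg, Finsupp.neg_apply, spechtRep_coe, tabloidRep_apply, h3] at h2
  exact hne (eq_zero_of_eq_neg h2.symm)

end Specht

/-! ### Specht modules of small shapes -/

section Shapes

variable {n : ℕ} {M : Type*} [AddCommGroup M] [Module ℂ M]
  {ρ : Representation ℂ (Perm (Fin n)) M}

/-- `p` gives the positions of the entries of a tableau of shape `l`. -/
structure IsFilling (l : List ℕ) (p : Fin n → ℕ × ℕ) : Prop where
  sorted : l.SortedGE
  inj : Function.Injective p
  mem : ∀ i, ∃ h : (p i).1 < l.length, (p i).2 < l[(p i).1]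
  surj : ∀ a (h : a < l.length), ∀ b < l[a], ∃ i, p i = (a, b)

lemma IsFilling.exists_tableau {l : List ℕ} {p : Fin n → ℕ × ℕ} (hp : IsFilling l p)
    (hl : l.SortedGE) :
    ∃ T : Fin n ≃ (YoungDiagram.ofRowLens l hl).cells, ∀ i, (T i).1 = p i := by
  have hmem : ∀ i, p i ∈ (YoungDiagram.ofRowLens l hl).cells := fun i =>
    YoungDiagram.mem_ofRowLens.2 (hp.mem i)
  refine ⟨Equiv.ofBijective (fun i => ⟨p i, hmem i⟩) ⟨fun i j h => hp.inj ?_, ?_⟩, fun i => rfl⟩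
  · exact congrArg Subtype.val h
  · rintro ⟨⟨a, b⟩, hc⟩
    obtain ⟨h1, h2⟩ := YoungDiagram.mem_ofRowLens.1 ((YoungDiagram.mem_cells _).1 hc)
    obtain ⟨i, hi⟩ := hp.surj a h1 b h2
    exact ⟨i, Subtype.ext hi⟩

theorem IsFilling.hasShape {l : List ℕ} {p : Fin n → ℕ × ℕ} (hp : IsFilling l p)
    (hρ : IsSimpleRep ρ) {w x : M} (hw : w ≠ 0) (hx : x ≠ 0)
    (hR : ∀ i j, (p i).1 = (p j).1 → ρ (swap i j) w = w)
    (hC : ∀ i j, i ≠ j → (p i).2 = (p j).2 → ρ (swap i j) x = -x) : HasShape ρ l := by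
  obtain ⟨T, hT⟩ := hp.exists_tableau hp.sorted
  refine ⟨hp.sorted, iso_spechtRep T hρ hw hx (fun g hg => ?_) fun g hg => ?_⟩
  · refine fixed_of_swaps ρ (rowOf T) (fun i j hij => hR i j ?_) g hg
    rwa [rowOf, rowOf, hT, hT] at hij
  · refine sign_of_swaps ρ (colOf T) (fun i j hne hij => hC i j hne ?_) g hg
    rwa [colOf, colOf, hT, hT] at hij

lemma swap_apply_preserves {κ : Type*} {f : Fin n → κ} {i j : Fin n} (h : f i = f j) (k : Fin n) :
    f (swap i j k) = f k := by
  rw [swap_apply_def]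
  split_ifs with e e
  · rw [e, h]
  · rw [e, h]
  · rfl

lemma HasShape.exists_fixed {l : List ℕ} {p : Fin n → ℕ × ℕ} (hp : IsFilling l p)
    (h : HasShape ρ l) : ∃ w ≠ 0, ∀ i j, (p i).1 = (p j).1 → ρ (swap i j) w = w := by
  obtain ⟨hl, hiso⟩ := h
  obtain ⟨e, he⟩ := hiso.symm'.exists_equiv
  obtain ⟨T, hT⟩ := hp.exists_tableau hl
  obtain ⟨x, hx, hfix⟩ := exists_spechtRep_fixed T
  refine ⟨e x, fun h0 => hx (e.map_eq_zero_iff.1 h0), fun i j hij => ?_⟩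
  rw [← he, hfix _ (swap_apply_preserves ?_)]
  rwa [rowOf, rowOf, hT, hT]

lemma HasShape.exists_sign {l : List ℕ} {p : Fin n → ℕ × ℕ} (hp : IsFilling l p)
    (h : HasShape ρ l) : ∃ w ≠ 0, ∀ i j, i ≠ j → (p i).2 = (p j).2 → ρ (swap i j) w = -w := by
  obtain ⟨hl, hiso⟩ := h
  obtain ⟨e, he⟩ := hiso.symm'.exists_equiv
  obtain ⟨T, hT⟩ := hp.exists_tableau hl
  obtain ⟨x, hx, hfix⟩ := exists_spechtRep_sign T
  refine ⟨e x, fun h0 => hx (e.map_eq_zero_iff.1 h0), fun i j hne hij => ?_⟩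
  rw [← he, hfix _ (swap_apply_preserves ?_), Perm.sign_swap hne, map_smul]
  · simp
  · rwa [colOf, colOf, hT, hT]

lemma HasShape.noFixed {l : List ℕ} (h : HasShape ρ l) {k : ℕ} (hk : ∀ b ∈ l, b ≤ k) :
    NoFixed ρ (k + 1) := by
  obtain ⟨hl, hiso⟩ := h
  obtain ⟨e, he⟩ := hiso.exists_equiv
  intro A hA w hw
  rw [← e.map_eq_zero_iff]
  refine spechtRep_eq_zero_of_fixedOn (k := k) (fun c hc => ?_) (A := A) (by omega)
    fun i hi j hj => ?_
  · obtain ⟨h1, h2⟩ := YoungDiagram.mem_ofRowLens.1 ((YoungDiagram.mem_cells _).1 hc)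
    have := hk _ (List.getElem_mem h1)
    omega
  · rw [← he, hw i hi j hj]

lemma HasShape.noFixed_signTwist {l : List ℕ} (h : HasShape ρ l) :
    NoFixed (signTwist ρ) (l.length + 1) := by
  obtain ⟨hl, hiso⟩ := h
  obtain ⟨e, he⟩ := hiso.exists_equiv
  intro A hA w hw
  rw [← e.map_eq_zero_iff]
  refine spechtRep_eq_zero_of_signTwist_fixedOn (k := l.length) (fun c hc => ?_) (A := A)
    (by omega) fun i hi j hj => ?_
  · exact (YoungDiagram.mem_ofRowLens.1 ((YoungDiagram.mem_cells _).1 hc)).1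
  · rw [signTwist_apply, ← he, ← map_smul, ← signTwist_apply, hw i hi j hj]

lemma isFilling_two_two : IsFilling [2, 2] ![(0, 0), (0, 1), (1, 0), (1, 1)] := by
  refine ⟨by decide, by decide, by decide, ?_⟩
  intro a h b hb
  simp only [List.length_cons, List.length_nil] at h
  interval_cases a <;> simp at hb <;> interval_cases b <;> decide

lemma isFilling_four_two :
    IsFilling [4, 2] ![(0, 0), (0, 1), (0, 2), (0, 3), (1, 0), (1, 1)] := by
  refine ⟨by decide, by decide, by decide, ?_⟩
  intro a h b hb
  simp only [List.length_cons, List.length_nil] at h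
  interval_cases a <;> simp at hb <;> interval_cases b <;> decide

lemma isFilling_three_three :
    IsFilling [3, 3] ![(0, 0), (0, 1), (0, 2), (1, 0), (1, 1), (1, 2)] := by
  refine ⟨by decide, by decide, by decide, ?_⟩
  intro a h b hb
  simp only [List.length_cons, List.length_nil] at h
  interval_cases a <;> simp at hb <;> interval_cases b <;> decide

lemma isFilling_two_two_two :
    IsFilling [2, 2, 2] ![(0, 0), (1, 0), (2, 0), (0, 1), (1, 1), (2, 1)] := by
  refine ⟨by decide, by decide, by decide, ?_⟩
  intro a h b hb
  simp only [List.length_cons, List.length_nil] at h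
  interval_cases a <;> simp at hb <;> interval_cases b <;> decide

end Shapes

/-! ### The shapes (4,2) and (2,2) from systems of pairs -/

section ShapesOfPairs

variable {M : Type*} [AddCommGroup M] [Module ℂ M]

lemma PairSystem.hasShape_four_two {ρ : Representation ℂ (Perm (Fin 6)) M}
    {W : Fin 6 → Fin 6 → M} (h : PairSystem ρ 1 W) (hρ : IsSimpleRep ρ) : HasShape ρ [4, 2] := by
  have hs : ∀ i j, W j i = W i j := fun i j => by rw [h.symm i j, one_smul]
  -- The column-alternating vector is `(1 - (0 4)) (1 - (1 5))` applied to `W 4 5`; `diff_ne` says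
  -- that it is not 0.
  refine isFilling_four_two.hasShape hρ (w := W 4 5) (x := W 4 5 - W 0 5 - (W 4 1 - W 0 1))
    (h.ne _ _ (by decide)) ?_ ?_ ?_
  · exact sub_ne_zero.2 (h.diff_ne (Or.inl rfl) (by norm_num) (by decide) (by decide) (by decide)
      (by decide) (by decide) (by decide))
  · intro i j hij
    rw [h.map]
    have : (swap i j 4 = 4 ∧ swap i j 5 = 5) ∨ (swap i j 4 = 5 ∧ swap i j 5 = 4) := by
      revert i j
      decide
    rcases this with ⟨h1, h2⟩ | ⟨h1, h2⟩
    · rw [h1, h2]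
    · rw [h1, h2, hs]
  · intro i j hne hij
    have : (i = 0 ∧ j = 4) ∨ (i = 4 ∧ j = 0) ∨ (i = 1 ∧ j = 5) ∨ (i = 5 ∧ j = 1) := by
      revert i j
      decide
    have e1 : ρ (swap 0 4) (W 4 5 - W 0 5 - (W 4 1 - W 0 1)) =
        -(W 4 5 - W 0 5 - (W 4 1 - W 0 1)) := by
      simp only [map_sub, h.map]
      change W 0 5 - W 4 5 - (W 0 1 - W 4 1) = _
      abel
    have e2 : ρ (swap 1 5) (W 4 5 - W 0 5 - (W 4 1 - W 0 1)) =
        -(W 4 5 - W 0 5 - (W 4 1 - W 0 1)) := by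
      simp only [map_sub, h.map]
      change W 4 1 - W 0 1 - (W 4 5 - W 0 5) = _
      abel
    rcases this with ⟨rfl, rfl⟩ | ⟨rfl, rfl⟩ | ⟨rfl, rfl⟩ | ⟨rfl, rfl⟩
    · exact e1
    · rw [swap_comm]; exact e1
    · exact e2
    · rw [swap_comm]; exact e2

lemma PairSystem.hasShape_two_two {ρ : Representation ℂ (Perm (Fin 4)) M}
    {W : Fin 4 → Fin 4 → M} (h : PairSystem (signTwist ρ) 1 W) (hρ : IsSimpleRep ρ) :
    HasShape ρ [2, 2] := by
  have hs : ∀ i j, W j i = W i j := fun i j => by rw [h.symm i j, one_smul]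
  have hmap : ∀ i j a b, i ≠ j → ρ (swap i j) (W a b) = -W (swap i j a) (swap i j b) := by
    intro i j a b hij
    rw [← h.map, signTwist_swap _ hij, neg_neg]
  have hd := h.diff_ne (i := 0) (k := 1) (j := 2) (l := 3) (Or.inl rfl) (by norm_num) (by decide)
    (by decide) (by decide) (by decide) (by decide) (by decide)
  have hsum : (W 0 2 - W 1 2) + (W 0 3 - W 1 3) = 0 := by
    have h0 := h.sum 0
    have h1 := h.sum 1
    rw [Fin.sum_univ_four, h.diag] at h0 h1
    rw [hs 0 1] at h1
    linear_combination (norm := module) h0 - h1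
  -- The twist exchanges fixed and alternating vectors: `W 0 2` now alternates along the columns
  -- `{0, 2}` and `{1, 3}`, while the row-fixed vector is the difference `W 0 2 - W 1 2`.
  refine isFilling_two_two.hasShape hρ (w := W 0 2 - W 1 2) (x := W 0 2) ?_
    (h.ne _ _ (by decide)) ?_ ?_
  · intro h0
    rw [h0, zero_add] at hsum
    exact hd (h0.trans hsum.symm)
  · intro i j hij
    by_cases hne : i = j
    · rw [hne, rep_swap_self]
    have : (i = 0 ∧ j = 1) ∨ (i = 1 ∧ j = 0) ∨ (i = 2 ∧ j = 3) ∨ (i = 3 ∧ j = 2) := by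
      revert i j
      decide
    have e1 : ρ (swap 0 1) (W 0 2 - W 1 2) = W 0 2 - W 1 2 := by
      rw [map_sub, hmap _ _ _ _ (by decide), hmap _ _ _ _ (by decide)]
      change -W 1 2 - -W 0 2 = _
      abel
    have e2 : ρ (swap 2 3) (W 0 2 - W 1 2) = W 0 2 - W 1 2 := by
      rw [map_sub, hmap _ _ _ _ (by decide), hmap _ _ _ _ (by decide)]
      change -W 0 3 - -W 1 3 = _
      linear_combination (norm := module) (-1 : ℂ) • hsum
    rcases this with ⟨rfl, rfl⟩ | ⟨rfl, rfl⟩ | ⟨rfl, rfl⟩ | ⟨rfl, rfl⟩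
    · exact e1
    · rw [swap_comm]; exact e1
    · exact e2
    · rw [swap_comm]; exact e2
  · intro i j hne hij
    rw [hmap _ _ _ _ hne]
    have : (swap i j 0 = 0 ∧ swap i j 2 = 2) ∨ (swap i j 0 = 2 ∧ swap i j 2 = 0) := by
      revert i j
      decide
    rcases this with ⟨h1, h2⟩ | ⟨h1, h2⟩
    · rw [h1, h2]
    · rw [h1, h2, hs]

end ShapesOfPairs

/-! ### Systems of vectors indexed by the triples of six points -/

section Triples

variable {M : Type*} [AddCommGroup M] [Module ℂ M]
  {ρ : Representation ℂ (Perm (Fin 6)) M}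

/-- Vectors indexed by the three-element subsets of six points, permuted by the group, such that
the sum over the subsets containing a given pair vanishes. -/
structure TripleSystem (ρ : Representation ℂ (Perm (Fin 6)) M) (W : Fin 6 → Fin 6 → Fin 6 → M) :
    Prop where
  map : ∀ g i j k, ρ g (W i j k) = W (g i) (g j) (g k)
  symm₁ : ∀ i j k, W j i k = W i j k
  symm₂ : ∀ i j k, W i k j = W i j k
  diag : ∀ i k, W i i k = 0
  sum : ∀ i j, i ≠ j → ∑ k, W i j k = 0
  ne : W 0 1 2 ≠ 0

/-- The sum over the triples containing a given pair is fixed by the permutations of the four other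
points, so it is 0 by `hf`. -/
lemma exists_tripleSystem (hf : NoFixed ρ 4) {w : M} (hw : w ≠ 0) (h₁ : FixedOn ρ {0, 1, 2} w)
    (h₂ : FixedOn ρ {3, 4, 5} w) : ∃ W, TripleSystem ρ W := by
  obtain ⟨W, h0, hW, hoff⟩ := exists_equivariant ρ w ((0, 1, 2) : Fin 6 × Fin 6 × Fin 6)
    fun g hg => h₂.apply g (by
      simp only [Prod.smul_mk, Prod.mk.injEq] at hg
      intro i hi
      have : i = 0 ∨ i = 1 ∨ i = 2 := by
        revert i
        decide
      rcases this with rfl | rfl | rfl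
      · exact hg.1
      · exact hg.2.1
      · exact hg.2.2)
  have hmap : ∀ g i j k, ρ g (W (i, j, k)) = W (g i, g j, g k) := fun g i j k => hW g (i, j, k)
  have hval : ∀ g : Perm (Fin 6), W (g 0, g 1, g 2) = ρ g w := fun g => by rw [← hmap, h0]
  have hex : ∀ i j k, (∃ g : Perm (Fin 6), g 0 = i ∧ g 1 = j ∧ g 2 = k) ∨ W (i, j, k) = 0 := by
    intro i j k
    by_cases h : ∃ g : Perm (Fin 6), g 0 = i ∧ g 1 = j ∧ g 2 = k
    · exact Or.inl h
    · exact Or.inr (hoff _ fun g hg => h ⟨g, congrArg (fun x => x.1) hg,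
        congrArg (fun x => x.2.1) hg, congrArg (fun x => x.2.2) hg⟩)
  have hs1 : ∀ i j k, (∃ g : Perm (Fin 6), g 0 = i ∧ g 1 = j ∧ g 2 = k) →
      W (j, i, k) = W (i, j, k) := by
    rintro _ _ _ ⟨g, rfl, rfl, rfl⟩
    rw [hval, ← h₁ 0 (by decide) 1 (by decide), ← Module.End.mul_apply, ← map_mul, ← hval]
    rfl
  have hs2 : ∀ i j k, (∃ g : Perm (Fin 6), g 0 = i ∧ g 1 = j ∧ g 2 = k) →
      W (i, k, j) = W (i, j, k) := by
    rintro _ _ _ ⟨g, rfl, rfl, rfl⟩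
    rw [hval, ← h₁ 1 (by decide) 2 (by decide), ← Module.End.mul_apply, ← map_mul, ← hval]
    rfl
  refine ⟨fun i j k => W (i, j, k), hmap, fun i j k => ?_, fun i j k => ?_, fun i k => ?_,
    fun i j hij => ?_, h0 ▸ hw⟩
  · rcases hex i j k with h | h
    · exact hs1 i j k h
    · rcases hex j i k with h' | h'
      · exact (hs1 j i k h').symm
      · exact h'.trans h.symm
  · rcases hex i j k with h | h
    · exact hs2 i j k h
    · rcases hex i k j with h' | h'
      · exact (hs2 i k j h').symm
      · exact h'.trans h.symm
  · rcases hex i i k with ⟨g, h1, h2, -⟩ | h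
    · exact absurd (g.injective (h1.trans h2.symm)) (by decide)
    · exact h
  · refine hf {i, j}ᶜ (by rw [Finset.card_compl, Finset.card_pair hij, Fintype.card_fin]) _
      fun k hk l hl => ?_
    simp only [Finset.mem_compl, Finset.mem_insert, Finset.mem_singleton, not_or] at hk hl
    rw [map_sum]
    simp only [hmap, swap_apply_of_ne_of_ne (Ne.symm hk.1) (Ne.symm hl.1),
      swap_apply_of_ne_of_ne (Ne.symm hk.2) (Ne.symm hl.2)]
    exact Equiv.sum_comp (swap k l) fun m => W (i, j, m)

namespace TripleSystem

variable {W : Fin 6 → Fin 6 → Fin 6 → M}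

lemma diag₁ (h : TripleSystem ρ W) (i k : Fin 6) : W i k i = 0 := by
  rw [h.symm₂, h.diag]

lemma diag₂ (h : TripleSystem ρ W) (i k : Fin 6) : W k i i = 0 := by
  rw [h.symm₁, h.diag₁]

/-- The vectors of complementary triples are opposite. -/
lemma compl (h : TripleSystem ρ W) : W 3 4 5 = -W 0 1 2 := by
  have r : ∀ i j, i ≠ j → W i j 0 + W i j 1 + W i j 2 + W i j 3 + W i j 4 + W i j 5 = 0 := by
    intro i j hij
    rw [← h.sum i j hij, Fin.sum_univ_six]
  have e1 := r 3 4 (by decide)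
  have e2 := r 3 5 (by decide)
  have e3 := r 4 5 (by decide)
  have f03 := r 0 3 (by decide)
  have f04 := r 0 4 (by decide)
  have f05 := r 0 5 (by decide)
  have f13 := r 1 3 (by decide)
  have f14 := r 1 4 (by decide)
  have f15 := r 1 5 (by decide)
  have f23 := r 2 3 (by decide)
  have f24 := r 2 4 (by decide)
  have f25 := r 2 5 (by decide)
  have g01 := r 0 1 (by decide)
  have g02 := r 0 2 (by decide)
  have g12 := r 1 2 (by decide)
  simp only [h.diag₁, h.diag₂, zero_add, add_zero] at *
  -- Weights 2, -1, 2 for the pairs with two, one or no points in `{3, 4, 5}` cancel every triple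
  -- that meets both halves.
  have key : (6 : ℂ) • (W 3 4 5 + W 0 1 2) = 0 := by
    linear_combination (norm := skip) (2 : ℂ) • (e1 + e2 + e3) -
      (f03 + f04 + f05 + f13 + f14 + f15 + f23 + f24 + f25) + (2 : ℂ) • (g01 + g02 + g12)
    simp only [h.symm₁, h.symm₂]
    module
  exact eq_neg_of_add_eq_zero_left ((smul_eq_zero.1 key).resolve_left (by norm_num))

lemma compl_apply (h : TripleSystem ρ W) (g : Perm (Fin 6)) :
    W (g 3) (g 4) (g 5) = -W (g 0) (g 1) (g 2) := by
  rw [← h.map, ← h.map, h.compl, map_neg]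

/-- The alternating sum of the `W i j k` over the transversals of `{0,3}, {1,4}, {2,5}`. -/
lemma alternating_ne_zero (h : TripleSystem ρ W) :
    W 0 1 2 - W 3 1 2 - W 0 4 2 - W 0 1 5 + W 3 4 2 + W 3 1 5 + W 0 4 5 - W 3 4 5 ≠ 0 := by
  intro e
  have c1 : W 0 4 5 = -W 3 1 2 := h.compl_apply (swap 0 3)
  have c2 : W 3 1 5 = -W 0 4 2 := h.compl_apply (swap 1 4)
  have c3 : W 3 4 2 = -W 0 1 5 := h.compl_apply (swap 2 5)
  rw [c1, c2, c3, h.compl] at e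
  -- Opposite transversals contribute equally, so half of the sum vanishes. Adding its images under
  -- the cyclic permutations of 3, 4, 5 and the three pair sums inside `{0, 1, 2}` leaves `6 • W 0 1
  -- 2`.
  have e1 : W 0 1 2 - W 3 1 2 - W 0 4 2 - W 0 1 5 = 0 := by
    have : (2 : ℂ) • (W 0 1 2 - W 3 1 2 - W 0 4 2 - W 0 1 5) = 0 := by
      rw [← e]
      module
    exact (smul_eq_zero.1 this).resolve_left two_ne_zero
  have e2 : W 0 1 2 - W 4 1 2 - W 0 5 2 - W 0 1 3 = 0 := by
    have := congrArg (ρ (swap 3 4 * swap 4 5)) e1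
    simp only [map_sub, h.map, map_zero] at this
    exact this
  have e3 : W 0 1 2 - W 5 1 2 - W 0 3 2 - W 0 1 4 = 0 := by
    have := congrArg (ρ (swap 3 5 * swap 4 5)) e1
    simp only [map_sub, h.map, map_zero] at this
    exact this
  have r : ∀ i j, i ≠ j → W i j 0 + W i j 1 + W i j 2 + W i j 3 + W i j 4 + W i j 5 = 0 := by
    intro i j hij
    rw [← h.sum i j hij, Fin.sum_univ_six]
  have g01 := r 0 1 (by decide)
  have g02 := r 0 2 (by decide)
  have g12 := r 1 2 (by decide)
  simp only [h.diag₁, h.diag₂, zero_add, add_zero] at g01 g02 g12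
  have key : (6 : ℂ) • W 0 1 2 = 0 := by
    linear_combination (norm := skip) e1 + e2 + e3 + g01 + g02 + g12
    simp only [h.symm₁, h.symm₂]
    module
  exact h.ne ((smul_eq_zero.1 key).resolve_left (by norm_num))

lemma hasShape_three_three (h : TripleSystem ρ W) (hρ : IsSimpleRep ρ) : HasShape ρ [3, 3] := by
  refine isFilling_three_three.hasShape hρ h.ne h.alternating_ne_zero ?_ ?_
  · intro i j hij
    rw [h.map]
    have : (swap i j 0 = 0 ∧ swap i j 1 = 1 ∧ swap i j 2 = 2) ∨
        (swap i j 0 = 1 ∧ swap i j 1 = 0 ∧ swap i j 2 = 2) ∨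
        (swap i j 0 = 2 ∧ swap i j 1 = 1 ∧ swap i j 2 = 0) ∨
        (swap i j 0 = 0 ∧ swap i j 1 = 2 ∧ swap i j 2 = 1) := by
      revert i j
      decide
    rcases this with ⟨h1, h2, h3⟩ | ⟨h1, h2, h3⟩ | ⟨h1, h2, h3⟩ | ⟨h1, h2, h3⟩
    · rw [h1, h2, h3]
    · rw [h1, h2, h3, h.symm₁]
    · rw [h1, h2, h3, h.symm₁, h.symm₂, h.symm₁]
    · rw [h1, h2, h3, h.symm₂]
  · intro i j hne hij
    have : (i = 0 ∧ j = 3) ∨ (i = 3 ∧ j = 0) ∨ (i = 1 ∧ j = 4) ∨ (i = 4 ∧ j = 1) ∨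
        (i = 2 ∧ j = 5) ∨ (i = 5 ∧ j = 2) := by
      revert i j
      decide
    rcases this with ⟨rfl, rfl⟩ | ⟨rfl, rfl⟩ | ⟨rfl, rfl⟩ | ⟨rfl, rfl⟩ | ⟨rfl, rfl⟩ | ⟨rfl, rfl⟩ <;>
    · simp only [map_add, map_sub, h.map, neg_sub]
      first
      | change W 3 1 2 - W 0 1 2 - W 3 4 2 - W 3 1 5 + W 0 4 2 + W 0 1 5 + W 3 4 5 - W 0 4 5 = _
        abel
      | change W 0 4 2 - W 3 4 2 - W 0 1 2 - W 0 4 5 + W 3 1 2 + W 3 4 5 + W 0 1 5 - W 3 1 5 = _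
        abel
      | change W 0 1 5 - W 3 1 5 - W 0 4 5 - W 0 1 2 + W 3 4 5 + W 3 1 2 + W 0 4 2 - W 3 4 2 = _
        abel

lemma hasShape_two_two_two (h : TripleSystem (signTwist ρ) W) (hρ : IsSimpleRep ρ) :
    HasShape ρ [2, 2, 2] := by
  have hmap : ∀ i j a b c, i ≠ j →
      ρ (swap i j) (W a b c) = -W (swap i j a) (swap i j b) (swap i j c) := by
    intro i j a b c hij
    rw [← h.map, signTwist_swap _ hij, neg_neg]
  refine isFilling_two_two_two.hasShape hρ h.alternating_ne_zero h.ne ?_ ?_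
  · intro i j hij
    by_cases hne : i = j
    · rw [hne, rep_swap_self]
    have : (i = 0 ∧ j = 3) ∨ (i = 3 ∧ j = 0) ∨ (i = 1 ∧ j = 4) ∨ (i = 4 ∧ j = 1) ∨
        (i = 2 ∧ j = 5) ∨ (i = 5 ∧ j = 2) := by
      revert i j
      decide
    rcases this with ⟨rfl, rfl⟩ | ⟨rfl, rfl⟩ | ⟨rfl, rfl⟩ | ⟨rfl, rfl⟩ | ⟨rfl, rfl⟩ | ⟨rfl, rfl⟩ <;>
    · simp only [map_add, map_sub, hmap _ _ _ _ _ hne]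
      first
      | change -W 3 1 2 - -W 0 1 2 - -W 3 4 2 - -W 3 1 5 + -W 0 4 2 + -W 0 1 5 + -W 3 4 5 -
          -W 0 4 5 = _
        abel
      | change -W 0 4 2 - -W 3 4 2 - -W 0 1 2 - -W 0 4 5 + -W 3 1 2 + -W 3 4 5 + -W 0 1 5 -
          -W 3 1 5 = _
        abel
      | change -W 0 1 5 - -W 3 1 5 - -W 0 4 5 - -W 0 1 2 + -W 3 4 5 + -W 3 1 2 + -W 0 4 2 -
          -W 3 4 2 = _
        abel
  · intro i j hne hij
    rw [hmap _ _ _ _ _ hne, neg_inj]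
    have : (swap i j 0 = 0 ∧ swap i j 1 = 1 ∧ swap i j 2 = 2) ∨
        (swap i j 0 = 1 ∧ swap i j 1 = 0 ∧ swap i j 2 = 2) ∨
        (swap i j 0 = 2 ∧ swap i j 1 = 1 ∧ swap i j 2 = 0) ∨
        (swap i j 0 = 0 ∧ swap i j 1 = 2 ∧ swap i j 2 = 1) := by
      revert i j
      decide
    rcases this with ⟨h1, h2, h3⟩ | ⟨h1, h2, h3⟩ | ⟨h1, h2, h3⟩ | ⟨h1, h2, h3⟩
    · rw [h1, h2, h3]
    · rw [h1, h2, h3, h.symm₁]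
    · rw [h1, h2, h3, h.symm₁, h.symm₂, h.symm₁]
    · rw [h1, h2, h3, h.symm₂]

lemma span_eq_top (h : TripleSystem ρ W) (hρ : IsSimpleRep ρ) :
    Submodule.span ℂ (Set.range fun x : Fin 6 × Fin 6 × Fin 6 => W x.1 x.2.1 x.2.2) = ⊤ := by
  rw [eq_top_iff, ← hρ.span_orbit h.ne]
  refine Submodule.span_mono ?_
  rintro _ ⟨g, rfl⟩
  exact ⟨(g 0, g 1, g 2), (h.map g 0 1 2).symm⟩

/-- To bound an eigenspace of `swap 0 1` it is enough to look at the triples in increasing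
order. -/
lemma eigenspace_le (h : TripleSystem ρ W) (hρ : IsSimpleRep ρ) {ε : ℂ} (hε : ε = 1 ∨ ε = -1)
    {U : Submodule ℂ M} (h2 : ∀ k, 1 < k → (1 + ε) • W 0 1 k ∈ U)
    (h1 : ∀ j k, 1 < j → j < k → W 0 j k + ε • W 1 j k ∈ U)
    (h0 : ∀ i j k, 1 < i → i < j → j < k → (1 + ε) • W i j k ∈ U) :
    End.eigenspace (ρ (swap 0 1)) ε ≤ U := by
  have hεε : ε * ε = 1 := by rcases hε with rfl | rfl <;> norm_num
  let P : Fin 6 → Fin 6 → Fin 6 → Prop := fun i j k =>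
    W i j k + ε • W (swap 0 1 i) (swap 0 1 j) (swap 0 1 k) ∈ U
  have hP1 : ∀ i j k, P i j k → P j i k := fun i j k hp => by
    simp only [P] at hp ⊢
    rwa [h.symm₁, h.symm₁ (swap 0 1 i)]
  have hP2 : ∀ i j k, P i j k → P i k j := fun i j k hp => by
    simp only [P] at hp ⊢
    rwa [h.symm₂, h.symm₂ (swap 0 1 i) (swap 0 1 j)]
  have hd : ∀ i k, P i i k := fun i k => by
    simp only [P, h.diag, smul_zero, add_zero, U.zero_mem]
  have hd2 : ∀ i k, P k i i := fun i k => hP1 _ _ _ (hP2 _ _ _ (hd i k))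
  have hd1 : ∀ i k, P i k i := fun i k => hP2 _ _ _ (hd i k)
  have hsw : ∀ i : Fin 6, 1 < i → swap 0 1 i = i := fun i hi => by
    revert i
    decide
  have htri : ∀ i : Fin 6, i = 0 ∨ i = 1 ∨ 1 < i := by decide
  have a2 : ∀ k, P 0 1 k := by
    intro k
    rcases htri k with rfl | rfl | hk
    · exact hd1 _ _
    · exact hd2 _ _
    · have := h2 k hk
      simp only [P]
      rwa [swap_apply_left, swap_apply_right, hsw k hk, h.symm₁ 0 1 k, ← one_smul ℂ (W 0 1 k),
        smul_smul, ← add_smul, mul_one]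
  have a1 : ∀ j k, 1 < j → j < k → P 0 j k := by
    intro j k hj hk
    simp only [P]
    rw [swap_apply_left, hsw j hj, hsw k (hj.trans hk)]
    exact h1 j k hj hk
  have b1 : ∀ j k, 1 < j → j < k → P 1 j k := by
    intro j k hj hk
    have := U.smul_mem ε (h1 j k hj hk)
    rw [smul_add, smul_smul, hεε, one_smul, add_comm] at this
    simp only [P]
    rwa [swap_apply_right, hsw j hj, hsw k (hj.trans hk)]
  have c1 : ∀ i j k, 1 < i → i < j → j < k → P i j k := by
    intro i j k hi hj hk
    have := h0 i j k hi hj hk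
    simp only [P]
    rwa [hsw i hi, hsw j (hi.trans hj), hsw k (hi.trans (hj.trans hk)), ← one_smul ℂ (W i j k),
      smul_smul, ← add_smul, mul_one]
  have a0 : ∀ j k, P 0 j k := by
    intro j k
    rcases htri j with rfl | rfl | hj
    · exact hd _ _
    · exact a2 k
    rcases htri k with rfl | rfl | hk
    · exact hd1 _ _
    · exact hP2 _ _ _ (a2 j)
    rcases lt_trichotomy j k with hjk | rfl | hjk
    · exact a1 j k hj hjk
    · exact hd2 _ _
    · exact hP2 _ _ _ (a1 k j hk hjk)
  have b0 : ∀ j k, P 1 j k := by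
    intro j k
    rcases htri j with rfl | rfl | hj
    · exact hP1 _ _ _ (a2 k)
    · exact hd _ _
    rcases htri k with rfl | rfl | hk
    · exact hP2 _ _ _ (hP1 _ _ _ (a2 j))
    · exact hd1 _ _
    rcases lt_trichotomy j k with hjk | rfl | hjk
    · exact b1 j k hj hjk
    · exact hd2 _ _
    · exact hP2 _ _ _ (b1 k j hk hjk)
  have c0 : ∀ i j k, 1 < i → i < j → P i j k := by
    intro i j k hi hj
    rcases htri k with rfl | rfl | hk
    · exact hP2 _ _ _ (hP1 _ _ _ (a0 i j))
    · exact hP2 _ _ _ (hP1 _ _ _ (b0 i j))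
    rcases lt_trichotomy j k with hjk | rfl | hjk
    · exact c1 i j k hi hj hjk
    · exact hd2 _ _
    rcases lt_trichotomy i k with hik | rfl | hik
    · exact hP2 _ _ _ (c1 i k j hi hik hjk)
    · exact hd1 _ _
    · exact hP2 _ _ _ (hP1 _ _ _ (c1 k i j hk hik hj))
  refine eigenspace_swap_le (h.span_eq_top hρ) hε ?_
  rintro ⟨i, j, k⟩
  simp only [h.map]
  change P i j k
  rcases htri i with rfl | rfl | hi
  · exact a0 j k
  · exact b0 j k
  rcases htri j with rfl | rfl | hj
  · exact hP1 _ _ _ (a0 i k)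
  · exact hP1 _ _ _ (b0 i k)
  rcases lt_trichotomy i j with hij | rfl | hij
  · exact c0 i j k hi hij
  · exact hd _ _
  · exact hP1 _ _ _ (c0 j i k hj hij)

/-- The differences `W 0 j k - W 1 j k` are indexed by the six edges on `{2, 3, 4, 5}` and sum to 0
at each vertex. The relations at 2, 3 and 4 already leave three generators, which is enough. -/
lemma eigDim_neg_one_le (h : TripleSystem ρ W) (hρ : IsSimpleRep ρ) : eigDim ρ (-1) 0 1 ≤ 3 := by
  let v : Fin 3 → M := ![W 0 2 3 - W 1 2 3, W 0 2 4 - W 1 2 4, W 0 3 4 - W 1 3 4]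
  refine (finrank_le_card _ v Finset.univ ?_).trans (by simp)
  set U := Submodule.span ℂ (v '' ((Finset.univ : Finset (Fin 3)) : Set (Fin 3)))
  have hv : ∀ i, v i ∈ U := fun i => Submodule.subset_span ⟨i, by simp, rfl⟩
  have d23 : W 0 2 3 - W 1 2 3 ∈ U := hv 0
  have d24 : W 0 2 4 - W 1 2 4 ∈ U := hv 1
  have d34 : W 0 3 4 - W 1 3 4 ∈ U := hv 2
  have r : ∀ j, j ≠ 0 → j ≠ 1 → (W 0 j 2 - W 1 j 2) + (W 0 j 3 - W 1 j 3) + (W 0 j 4 - W 1 j 4) +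
      (W 0 j 5 - W 1 j 5) = 0 := by
    intro j hj0 hj1
    have e0 := h.sum 0 j hj0.symm
    have e1 := h.sum 1 j hj1.symm
    rw [Fin.sum_univ_six, h.diag₁] at e0 e1
    linear_combination (norm := skip) e0 - e1
    simp only [h.symm₁, h.symm₂]
    module
  have d25 : W 0 2 5 - W 1 2 5 ∈ U := by
    convert U.neg_mem (U.add_mem d23 d24) using 1
    have := r 2 (by decide) (by decide)
    rw [h.diag₂, h.diag₂] at this
    linear_combination (norm := module) this
  have d35 : W 0 3 5 - W 1 3 5 ∈ U := by
    convert U.neg_mem (U.add_mem d23 d34) using 1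
    have := r 3 (by decide) (by decide)
    rw [h.diag₂, h.diag₂, h.symm₂ 0 2 3, h.symm₂ 1 2 3] at this
    linear_combination (norm := module) this
  have d45 : W 0 4 5 - W 1 4 5 ∈ U := by
    convert U.neg_mem (U.add_mem d24 d34) using 1
    have := r 4 (by decide) (by decide)
    rw [h.diag₂, h.diag₂, h.symm₂ 0 2 4, h.symm₂ 1 2 4, h.symm₂ 0 3 4, h.symm₂ 1 3 4] at this
    linear_combination (norm := module) this
  refine h.eigenspace_le hρ (Or.inr rfl) (fun k _ => by simp) (fun j k hj hk => ?_)
    fun i j k _ _ _ => by simp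
  rw [neg_one_smul, ← sub_eq_add_neg]
  have : (j = 2 ∧ k = 3) ∨ (j = 2 ∧ k = 4) ∨ (j = 2 ∧ k = 5) ∨ (j = 3 ∧ k = 4) ∨ (j = 3 ∧ k = 5) ∨
      (j = 4 ∧ k = 5) := by
    revert j k
    decide
  rcases this with ⟨rfl, rfl⟩ | ⟨rfl, rfl⟩ | ⟨rfl, rfl⟩ | ⟨rfl, rfl⟩ | ⟨rfl, rfl⟩ | ⟨rfl, rfl⟩ <;>
    assumption

/-- The vectors `W 0 1 k` span: complementation gives the triples inside `{2, 3, 4, 5}`, and the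
pair sums then give `W 0 j k + W 1 j k`. -/
lemma eigDim_one_le (h : TripleSystem ρ W) (hρ : IsSimpleRep ρ) : eigDim ρ 1 0 1 ≤ 3 := by
  let v : Fin 3 → M := ![W 0 1 2, W 0 1 3, W 0 1 4]
  refine (finrank_le_card _ v Finset.univ ?_).trans (by simp)
  set U := Submodule.span ℂ (v '' ((Finset.univ : Finset (Fin 3)) : Set (Fin 3)))
  have hv : ∀ i, v i ∈ U := fun i => Submodule.subset_span ⟨i, by simp, rfl⟩
  have d2 : W 0 1 2 ∈ U := hv 0
  have d3 : W 0 1 3 ∈ U := hv 1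
  have d4 : W 0 1 4 ∈ U := hv 2
  have d5 : W 0 1 5 ∈ U := by
    convert U.neg_mem (U.add_mem (U.add_mem d2 d3) d4) using 1
    have := h.sum 0 1 (by decide)
    rw [Fin.sum_univ_six, h.diag₁, h.diag₂] at this
    linear_combination (norm := module) this
  have c345 : W 3 4 5 ∈ U := by
    rw [h.compl]
    exact U.neg_mem d2
  have c245 : W 2 4 5 ∈ U := by
    have : W 2 4 5 = -W 0 1 3 := h.compl_apply (swap 2 3)
    rw [this]
    exact U.neg_mem d3
  have c235 : W 2 3 5 ∈ U := by
    have : W 3 2 5 = -W 0 1 4 := h.compl_apply (swap 2 4)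
    rw [← h.symm₁, this]
    exact U.neg_mem d4
  have c234 : W 2 3 4 ∈ U := by
    have : W 3 4 2 = -W 0 1 5 := h.compl_apply (swap 2 5)
    rw [← h.symm₁, ← h.symm₂, this]
    exact U.neg_mem d5
  have hc : ∀ i j k, 1 < i → i < j → j < k → W i j k ∈ U := by
    intro i j k hi hj hk
    have : (i = 2 ∧ j = 3 ∧ k = 4) ∨ (i = 2 ∧ j = 3 ∧ k = 5) ∨ (i = 2 ∧ j = 4 ∧ k = 5) ∨
        (i = 3 ∧ j = 4 ∧ k = 5) := by
      revert i j k
      decide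
    rcases this with ⟨rfl, rfl, rfl⟩ | ⟨rfl, rfl, rfl⟩ | ⟨rfl, rfl, rfl⟩ | ⟨rfl, rfl, rfl⟩ <;>
      assumption
  have hp : ∀ j k l m, j ≠ k → (∀ f : Fin 6 → M, ∑ i, f i = f 0 + f 1 + f j + f k + f l + f m) →
      W j k l ∈ U → W j k m ∈ U → W 0 j k + (1 : ℂ) • W 1 j k ∈ U := by
    intro j k l m hjk hf hl hm
    have e := h.sum j k hjk
    rw [hf, h.diag₁, h.diag₂, h.symm₂ j 0 k, h.symm₁ 0 j k, h.symm₂ j 1 k, h.symm₁ 1 j k] at e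
    convert U.neg_mem (U.add_mem hl hm) using 1
    linear_combination (norm := module) e
  have c : ∀ i j k, W i j k ∈ U → W j k i ∈ U ∧ W i k j ∈ U ∧ W k i j ∈ U := by
    intro i j k hi
    refine ⟨?_, ?_, ?_⟩
    · rwa [h.symm₂, h.symm₁]
    · rwa [h.symm₂]
    · rwa [h.symm₁, h.symm₂]
  refine h.eigenspace_le hρ (Or.inl rfl) ?_ ?_ fun i j k hi hj hk => U.smul_mem _ (hc i j k hi hj hk)
  · intro k hk
    refine U.smul_mem _ ?_
    have : k = 2 ∨ k = 3 ∨ k = 4 ∨ k = 5 := by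
      revert k
      decide
    rcases this with rfl | rfl | rfl | rfl <;> assumption
  · intro j k hj hk
    have : (j = 2 ∧ k = 3) ∨ (j = 2 ∧ k = 4) ∨ (j = 2 ∧ k = 5) ∨ (j = 3 ∧ k = 4) ∨
        (j = 3 ∧ k = 5) ∨ (j = 4 ∧ k = 5) := by
      revert j k
      decide
    rcases this with ⟨rfl, rfl⟩ | ⟨rfl, rfl⟩ | ⟨rfl, rfl⟩ | ⟨rfl, rfl⟩ | ⟨rfl, rfl⟩ | ⟨rfl, rfl⟩
    · exact hp 2 3 4 5 (by decide) (fun f => by rw [Fin.sum_univ_six]) c234 c235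
    · exact hp 2 4 3 5 (by decide) (fun f => by rw [Fin.sum_univ_six]; abel) (c _ _ _ c234).2.1 c245
    · exact hp 2 5 3 4 (by decide) (fun f => by rw [Fin.sum_univ_six]; abel) (c _ _ _ c235).2.1
        (c _ _ _ c245).2.1
    · exact hp 3 4 2 5 (by decide) (fun f => by rw [Fin.sum_univ_six]; abel) (c _ _ _ c234).1 c345
    · exact hp 3 5 2 4 (by decide) (fun f => by rw [Fin.sum_univ_six]; abel) (c _ _ _ c235).1
        (c _ _ _ c345).2.1
    · exact hp 4 5 2 3 (by decide) (fun f => by rw [Fin.sum_univ_six]; abel) (c _ _ _ c245).1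
        (c _ _ _ c345).1

end TripleSystem
end Triples

/-! ### Restriction along an embedding of points -/

section Embedding

variable {m n : ℕ}

lemma viaEmbedding_swap (f : Fin m ↪ Fin n) (i j : Fin m) :
    (swap i j).viaEmbedding f = swap (f i) (f j) := by
  ext x
  by_cases hx : x ∈ Set.range f
  · obtain ⟨y, rfl⟩ := hx
    rw [Perm.viaEmbedding_apply, swap_apply_def, swap_apply_def]
    simp only [f.injective.eq_iff]
    split_ifs <;> rfl
  · rw [Perm.viaEmbedding_apply_of_notMem _ _ _ hx, swap_apply_of_ne_of_ne]
    · rintro rfl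
      exact hx ⟨i, rfl⟩
    · rintro rfl
      exact hx ⟨j, rfl⟩

variable {M : Type*} [AddCommGroup M] [Module ℂ M]

/-- The restriction of a representation to the permutations of a set of points. -/
def restrictEmb (ρ : Representation ℂ (Perm (Fin n)) M) (f : Fin m ↪ Fin n) :
    Representation ℂ (Perm (Fin m)) M :=
  MonoidHom.comp ρ (Perm.viaEmbeddingHom f)

lemma restrictEmb_swap (ρ : Representation ℂ (Perm (Fin n)) M) (f : Fin m ↪ Fin n) (i j : Fin m) :
    restrictEmb ρ f (swap i j) = ρ (swap (f i) (f j)) := by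
  rw [← viaEmbedding_swap]
  rfl

end Embedding

/-! ### Vectors fixed or negated by three points -/

section ThreePoints

variable {n : ℕ} {M : Type*} [AddCommGroup M] [Module ℂ M]

lemma FixedOn.symmetrize_pair (ρ : Representation ℂ (Perm (Fin n)) M) (i j : Fin n) (x : M) :
    FixedOn ρ {i, j} (x + ρ (swap i j) x) := by
  have h : ρ (swap i j) (x + ρ (swap i j) x) = x + ρ (swap i j) x := by
    rw [map_add, rep_swap_swap, add_comm]
  intro a ha b hb
  simp only [Finset.mem_insert, Finset.mem_singleton] at ha hb
  rcases ha with rfl | rfl <;> rcases hb with rfl | rfl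
  · exact rep_swap_self _ _ _
  · exact h
  · rwa [swap_comm]
  · exact rep_swap_self _ _ _

lemma FixedOn.symmetrize_triple (ρ : Representation ℂ (Perm (Fin n)) M) {i j k : Fin n}
    (hij : i ≠ j) (hik : i ≠ k) (hjk : j ≠ k) (x : M) :
    FixedOn ρ {k, i, j} (x + ρ (swap i j) x + (ρ (swap i k) x + ρ (swap i k) (ρ (swap i j) x) +
      (ρ (swap j k) x + ρ (swap j k) (ρ (swap i j) x)))) := by
  have := (FixedOn.symmetrize_pair ρ i j x).insert (l := k) (by simp [hik.symm, hjk.symm])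
  rwa [Finset.sum_pair hij, map_add, map_add] at this

/-- The symmetrizer and the antisymmetrizer of three points both vanish; half their sum is the sum
over the alternating group, the identity and the two 3-cycles. -/
lemma add_rep_add_rep_eq_zero {ρ : Representation ℂ (Perm (Fin n)) M} (h : NoFixed ρ 3)
    (h' : NoFixed (signTwist ρ) 3) {i j k : Fin n} (hij : i ≠ j) (hik : i ≠ k) (hjk : j ≠ k)
    (x : M) : x + ρ (swap i k) (ρ (swap i j) x) + ρ (swap j k) (ρ (swap i j) x) = 0 := by
  have hc : ({k, i, j} : Finset (Fin n)).card = 3 :=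
    Finset.card_eq_three.2 ⟨k, i, j, hik.symm, hjk.symm, hij, rfl⟩
  have e := h _ hc _ (FixedOn.symmetrize_triple ρ hij hik hjk x)
  have e' := h' _ hc _ (FixedOn.symmetrize_triple (signTwist ρ) hij hik hjk x)
  simp only [signTwist_swap ρ hij, signTwist_swap ρ hik, signTwist_swap ρ hjk, map_neg] at e'
  linear_combination (norm := module) (2⁻¹ : ℂ) • e + (2⁻¹ : ℂ) • e'

lemma eq_zero_of_add_rep_add_rep (τ : Representation ℂ (Perm (Fin 5)) M)
    (h : ∀ i j k : Fin 5, i ≠ j → i ≠ k → j ≠ k → ∀ x,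
      x + τ (swap i k) (τ (swap i j) x) + τ (swap j k) (τ (swap i j) x) = 0) (x : M) : x = 0 := by
  simp only [← Module.End.mul_apply, ← map_mul] at h
  have key : ∀ x, τ (swap 0 1 * swap 2 3) x = x := by
    -- In the group algebra of `A_4`, the sum over `A_3` times the sum over the Klein group is the
    -- sum over `A_4`, which therefore acts as 0. The four subgroups `A_3` of `A_4` together count
    -- every 3-cycle once and the identity four times. Comparing, the Klein group sum acts as 4.
    have hN : ∀ x, x + τ (swap 0 1 * swap 2 3) x + τ (swap 0 2 * swap 1 3) x +
        τ (swap 0 3 * swap 1 2) x = (4 : ℂ) • x := by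
      intro x
      have h0 := h 0 1 2 (by decide) (by decide) (by decide) x
      have h1 := h 0 2 3 (by decide) (by decide) (by decide) x
      have h2 := h 1 3 2 (by decide) (by decide) (by decide) x
      have h3 := h 0 3 1 (by decide) (by decide) (by decide) x
      have h4 := h 0 1 2 (by decide) (by decide) (by decide) (x + τ (swap 0 1 * swap 2 3) x +
        τ (swap 0 2 * swap 1 3) x + τ (swap 0 3 * swap 1 2) x)
      simp only [map_add, ← Module.End.mul_apply, ← map_mul] at h4
      have a1 : (swap 0 2 * swap 0 1 * (swap 0 1 * swap 2 3) : Perm (Fin 5)) =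
        swap 0 3 * swap 0 2 := by decide
      have a2 : (swap 0 2 * swap 0 1 * (swap 0 2 * swap 1 3) : Perm (Fin 5)) =
        swap 1 2 * swap 1 3 := by decide
      have a3 : (swap 0 2 * swap 0 1 * (swap 0 3 * swap 1 2) : Perm (Fin 5)) =
        swap 0 1 * swap 0 3 := by decide
      have b1 : (swap 1 2 * swap 0 1 * (swap 0 1 * swap 2 3) : Perm (Fin 5)) =
        swap 3 2 * swap 1 3 := by decide
      have b2 : (swap 1 2 * swap 0 1 * (swap 0 2 * swap 1 3) : Perm (Fin 5)) =
        swap 3 1 * swap 0 3 := by decide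
      have b3 : (swap 1 2 * swap 0 1 * (swap 0 3 * swap 1 2) : Perm (Fin 5)) =
        swap 2 3 * swap 0 2 := by decide
      rw [a1, a2, a3, b1, b2, b3] at h4
      linear_combination (norm := module) h4 - h0 - h1 - h2 - h3
    intro x
    -- The Klein group sum absorbs its own elements, so each of them acts trivially.
    have h1 := hN (τ (swap 0 1 * swap 2 3) x)
    simp only [← Module.End.mul_apply, ← map_mul] at h1
    rw [show (swap 0 1 * swap 2 3 * (swap 0 1 * swap 2 3) : Perm (Fin 5)) = 1 by decide,
      show (swap 0 2 * swap 1 3 * (swap 0 1 * swap 2 3) : Perm (Fin 5)) = swap 0 3 * swap 1 2 by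
        decide,
      show (swap 0 3 * swap 1 2 * (swap 0 1 * swap 2 3) : Perm (Fin 5)) = swap 0 2 * swap 1 3 by
        decide, map_one, Module.End.one_apply] at h1
    linear_combination (norm := module) (4⁻¹ : ℂ) • hN x - (4⁻¹ : ℂ) • h1
  have key2 : ∀ x, τ (swap 0 1 * swap 2 4) x = x := by
    intro x
    rw [show (swap 0 1 * swap 2 4 : Perm (Fin 5)) =
      swap 3 4 * (swap 0 1 * swap 2 3) * swap 3 4 by decide, map_mul, map_mul,
      Module.End.mul_apply, Module.End.mul_apply, key, rep_swap_swap]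
  -- A fifth point makes a 3-cycle a product of two double transpositions. It acts trivially, and
  -- the hypothesis becomes `3 • x = 0`.
  have key3 : ∀ x, τ (swap 2 4 * swap 2 3) x = x := by
    intro x
    rw [show (swap 2 4 * swap 2 3 : Perm (Fin 5)) = swap 0 1 * swap 2 4 * (swap 0 1 * swap 2 3) by
      decide, map_mul, Module.End.mul_apply, key, key2]
  have key4 : ∀ x, τ (swap 3 4 * swap 2 3) x = x := by
    intro x
    rw [show (swap 3 4 * swap 2 3 : Perm (Fin 5)) = swap 2 4 * swap 2 3 * (swap 2 4 * swap 2 3) by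
      decide, map_mul, Module.End.mul_apply, key3, key3]
  have h5 := h 2 3 4 (by decide) (by decide) (by decide) x
  rw [key3, key4] at h5
  have h6 : (3 : ℂ) • x = 0 := by linear_combination (norm := module) h5
  exact (smul_eq_zero.1 h6).resolve_left (by norm_num)

lemma not_noFixed_three [Nontrivial M] (ρ : Representation ℂ (Perm (Fin n)) M) (hn : 5 ≤ n)
    (h : NoFixed ρ 3) : ¬ NoFixed (signTwist ρ) 3 := by
  intro h'
  obtain ⟨x, hx⟩ := exists_ne (0 : M)
  let f : Fin 5 ↪ Fin n := Fin.castLEEmb hn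
  refine hx (eq_zero_of_add_rep_add_rep (restrictEmb ρ f) (fun i j k hij hik hjk x => ?_) x)
  simp only [restrictEmb_swap]
  exact add_rep_add_rep_eq_zero h h' (f.injective.ne hij) (f.injective.ne hik)
    (f.injective.ne hjk) x

end ThreePoints

/-! ### Small representations of the symmetric group on at least five points -/

section Small

variable {n : ℕ} {M : Type*} [AddCommGroup M] [Module ℂ M]

/-- A nontrivial 5-cycle would have a primitive fifth root of unity as eigenvalue. Being conjugate
to its first four powers, it would have all four of them, in dimension at most 3. -/
lemma rep_five_cycle_eq_one [FiniteDimensional ℂ M] (τ : Representation ℂ (Perm (Fin 5)) M)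
    (hM : finrank ℂ M ≤ 3) : τ (finRotate 5) = 1 := by
  by_contra hne
  obtain ⟨x, hx⟩ : ∃ x, τ (finRotate 5) x ≠ x := by
    by_contra! hc
    exact hne (LinearMap.ext hc)
  set z := τ (finRotate 5) with hz
  have hz5 : z ^ 5 = 1 := by
    rw [hz, ← map_pow, show (finRotate 5) ^ 5 = 1 by decide, map_one]
  have hz5' : ∀ x, z (z (z (z (z x)))) = x := fun x => LinearMap.congr_fun hz5 x
  -- On `K` the eigenvalues are roots of `1 + ζ + ζ² + ζ³ + ζ⁴`, and `K` is not 0 because it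
  -- contains `z x - x`.
  let K := LinearMap.ker (1 + z + z ^ 2 + z ^ 3 + z ^ 4)
  have hK : ∀ y, y ∈ K ↔ y + z y + z (z y) + z (z (z y)) + z (z (z (z y))) = 0 := fun y => Iff.rfl
  have hinv : ∀ y ∈ K, z y ∈ K := by
    intro y hy
    rw [hK] at hy ⊢
    have := congrArg z hy
    simpa only [map_add, map_zero] using this
  have hmem : z x - x ∈ K := by
    rw [hK]
    simp only [map_sub, hz5']
    abel
  have : Nontrivial K := ⟨⟨⟨_, hmem⟩, 0, fun e => hx (sub_eq_zero.1 (congrArg Subtype.val e))⟩⟩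
  obtain ⟨ζ, hζ⟩ := Module.End.exists_eigenvalue (z.restrict hinv)
  obtain ⟨⟨y, hyK⟩, hy⟩ := hζ.exists_hasEigenvector
  have hy0 : y ≠ 0 := fun e => hy.2 (Subtype.ext e)
  have hzy : z y = ζ • y := congrArg Subtype.val hy.apply_eq_smul
  have hsum : 1 + ζ + ζ ^ 2 + ζ ^ 3 + ζ ^ 4 = 0 := by
    rw [hK] at hyK
    simp only [hzy, map_smul] at hyK
    have : (1 + ζ + ζ ^ 2 + ζ ^ 3 + ζ ^ 4) • y = 0 := by
      rw [← hyK]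
      module
    exact (smul_eq_zero.1 this).resolve_right hy0
  have h5 : ζ ^ 5 = 1 := by linear_combination (ζ - 1) * hsum
  have h1 : ζ ≠ 1 := by
    rintro rfl
    norm_num at hsum
  have hprim : IsPrimitiveRoot ζ 5 := by
    have : Fact (Nat.Prime 5) := ⟨by norm_num⟩
    rw [← orderOf_eq_prime h5 h1]
    exact IsPrimitiveRoot.orderOf ζ
  have hconj : ∀ k : Fin 4, ∃ g : Perm (Fin 5), finRotate 5 * g = g * finRotate 5 ^ (k.1 + 1) := by
    decide
  choose g hg using hconj
  have hli : LinearIndependent ℂ fun k : Fin 4 => τ (g k) y := by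
    refine Module.End.eigenvectors_linearIndependent' z (fun k : Fin 4 => ζ ^ (k.1 + 1)) ?_ _ ?_
    · intro k l hkl
      have := hprim.pow_inj (by omega) (by omega) hkl
      exact Fin.ext (by omega)
    · intro k
      refine ⟨?_, ?_⟩
      · rw [End.mem_eigenspace_iff, hz, ← Module.End.mul_apply, ← map_mul, hg, map_mul,
          Module.End.mul_apply, map_pow, ← hz]
        have : ∀ m : ℕ, (z ^ m) y = ζ ^ m • y := by
          intro m
          induction m with
          | zero => simp
          | succ m ih => rw [pow_succ', Module.End.mul_apply, ih, map_smul, hzy, smul_smul, pow_succ]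
        rw [this, map_smul]
      · exact rep_ne_zero (g k) hy0
  have := hli.fintype_card_le_finrank
  rw [Fintype.card_fin] at this
  omega

/-- Transpositions are conjugate, so in dimension at most 1, where the image is commutative, they
act alike. In the other case the 5-cycle acts trivially and conjugates `(0 1)` to `(1 2)`; any two
transpositions are joined by a chain of adjacent ones. -/
lemma rep_swap_congr [FiniteDimensional ℂ M] (τ : Representation ℂ (Perm (Fin n)) M)
    (hM : finrank ℂ M ≤ 1 ∨ 5 ≤ n ∧ finrank ℂ M ≤ 3) {i j k l : Fin n} (hij : i ≠ j)
    (hkl : k ≠ l) : τ (swap i j) = τ (swap k l) := by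
  rcases hM with hM | ⟨hn, hM⟩
  · obtain ⟨v, hv⟩ := finrank_le_one_iff.1 hM
    obtain ⟨g, rfl, rfl⟩ := exists_perm_pair hij hkl
    have hcomm : ∀ a b : Perm (Fin n), τ a * τ b = τ b * τ a := by
      intro a b
      refine LinearMap.ext fun x => ?_
      obtain ⟨c, rfl⟩ := hv x
      obtain ⟨ca, ha⟩ := hv (τ a v)
      obtain ⟨cb, hb⟩ := hv (τ b v)
      rw [Module.End.mul_apply, Module.End.mul_apply, map_smul, map_smul, map_smul, map_smul, ← ha,
        ← hb, map_smul, map_smul, ← ha, ← hb, smul_comm ca cb]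
    rw [swap_apply_apply, map_mul, hcomm, ← map_mul, inv_mul_cancel_left]
  let f : Fin 5 ↪ Fin n := Fin.castLEEmb hn
  have base : τ (swap (f 0) (f 1)) = τ (swap (f 1) (f 2)) := by
    have h := rep_five_cycle_eq_one (restrictEmb τ f) hM
    have hc : (finRotate 5 * swap 0 1 : Perm (Fin 5)) = swap 1 2 * finRotate 5 := by decide
    have h2 := congrArg (restrictEmb τ f) hc
    rwa [map_mul, map_mul, h, one_mul, mul_one, restrictEmb_swap, restrictEmb_swap] at h2
  have step : ∀ i j k, i ≠ j → j ≠ k → τ (swap i j) = τ (swap j k) := by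
    intro i j k hij hjk
    by_cases hik : i = k
    · rw [hik, swap_comm]
    obtain ⟨g, rfl, rfl⟩ := exists_perm_pair (f.injective.ne (show (0 : Fin 5) ≠ 1 by decide)) hij
    let g' := swap (g (f 2)) k * g
    have h0 : g' (f 0) = g (f 0) := swap_apply_of_ne_of_ne
      (g.injective.ne (f.injective.ne (by decide))) hik
    have h1 : g' (f 1) = g (f 1) := swap_apply_of_ne_of_ne
      (g.injective.ne (f.injective.ne (by decide))) hjk
    have h2 : g' (f 2) = k := swap_apply_left _ _
    rw [← h0, ← h1, ← h2, swap_apply_apply, swap_apply_apply, map_mul, map_mul, base, ← map_mul,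
      ← map_mul]
  by_cases hjk : j = k
  · subst hjk
    exact step _ _ _ hij hkl
  · exact (step _ _ _ hij hjk).trans (step _ _ _ hjk hkl)

lemma exists_rep_swap_eq_smul [FiniteDimensional ℂ M] [Nontrivial M]
    (τ : Representation ℂ (Perm (Fin n)) M) (hn : 2 ≤ n)
    (hM : finrank ℂ M ≤ 1 ∨ 5 ≤ n ∧ finrank ℂ M ≤ 3) :
    ∃ x ≠ 0, (∀ i j, τ (swap i j) x = x) ∨ ∀ i j, i ≠ j → τ (swap i j) x = -x := by
  obtain ⟨x, hx⟩ := exists_ne (0 : M)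
  let a : Fin n := ⟨0, by omega⟩
  let b : Fin n := ⟨1, by omega⟩
  have hab : a ≠ b := by simp [a, b]
  by_cases h : x + τ (swap a b) x = 0
  · refine ⟨x, hx, Or.inr fun i j hij => ?_⟩
    rw [rep_swap_congr τ hM hij hab]
    exact (neg_eq_of_add_eq_zero_right h).symm
  · refine ⟨_, h, Or.inl fun i j => ?_⟩
    by_cases hij : i = j
    · rw [hij, rep_swap_self]
    · rw [rep_swap_congr τ hM hij hab, map_add, rep_swap_swap, add_comm]

/-- The permutations of the other `n - 2` points commute with `(p q)`, so they act on its
`-1`-eigenspace. This representation of `S_{n-2}` is small enough for `exists_rep_swap_eq_smul`; the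
bound `7 ≤ n` ensures `n - 2 ≥ 5`. -/
lemma exists_fixedOn_compl_pair [FiniteDimensional ℂ M] (ρ : Representation ℂ (Perm (Fin n)) M)
    (hn : 4 ≤ n) {p q : Fin n} (hpq : p ≠ q) (h0 : eigDim ρ (-1) p q ≠ 0)
    (h3 : eigDim ρ (-1) p q ≤ 1 ∨ 7 ≤ n ∧ eigDim ρ (-1) p q ≤ 3) : ∃ x ≠ 0, ρ (swap p q) x = -x ∧
      (FixedOn ρ {p, q}ᶜ x ∨ FixedOn (signTwist ρ) {p, q}ᶜ x) := by
  let N := End.eigenspace (ρ (swap p q)) (-1)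
  have : Nontrivial N := Module.nontrivial_of_finrank_pos (Nat.pos_of_ne_zero h0)
  let f : Fin (n - 2) ↪ Fin n :=
    (({p, q}ᶜ : Finset (Fin n)).orderEmbOfFin (PairSystem.card_compl_pair hpq)).toEmbedding
  have hf : ∀ i, f i ≠ p ∧ f i ≠ q := fun i => by
    have := Finset.orderEmbOfFin_mem _ (PairSystem.card_compl_pair hpq) i
    simp only [Finset.mem_compl, Finset.mem_insert, Finset.mem_singleton, not_or] at this
    exact this
  have hf' : ∀ i ∈ ({p, q}ᶜ : Finset (Fin n)), ∃ j, f j = i := fun i hi => by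
    rw [← Finset.mem_coe, ← Finset.range_orderEmbOfFin _ (PairSystem.card_compl_pair hpq)] at hi
    exact hi
  have hcomm : ∀ g : Perm (Fin (n - 2)), g.viaEmbedding f * swap p q = swap p q * g.viaEmbedding f := by
    intro g
    have hfix : ∀ x, (∀ i, f i ≠ x) → g.viaEmbedding f x = x := fun x hx =>
      Perm.viaEmbedding_apply_of_notMem _ _ _ (by rintro ⟨i, hi⟩; exact hx i hi)
    have := swap_apply_apply (g.viaEmbedding f) p q
    rw [hfix p fun i => (hf i).1, hfix q fun i => (hf i).2] at this
    rw [eq_mul_inv_iff_mul_eq] at this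
    exact this.symm
  have hinv : ∀ g, N ≤ N.comap (restrictEmb ρ f g) := by
    intro g x hx
    rw [End.mem_eigenspace_iff] at hx
    change ρ (g.viaEmbedding f) x ∈ N
    rw [End.mem_eigenspace_iff, ← Module.End.mul_apply, ← map_mul, ← hcomm, map_mul,
      Module.End.mul_apply, hx, map_smul]
  obtain ⟨⟨x, hxN⟩, hx0, hx⟩ := exists_rep_swap_eq_smul
    ((restrictEmb ρ f).subrepresentation N hinv) (by omega)
    (h3.imp id fun h => ⟨by omega, h.2⟩)
  refine ⟨x, fun e => hx0 (Subtype.ext e), by simpa using End.mem_eigenspace_iff.1 hxN, ?_⟩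
  refine hx.imp (fun hx i hi j hj => ?_) fun hx i hi j hj => ?_
  · obtain ⟨i, rfl⟩ := hf' i hi
    obtain ⟨j, rfl⟩ := hf' j hj
    have := congrArg Subtype.val (hx i j)
    change restrictEmb ρ f (swap i j) x = x at this
    rwa [restrictEmb_swap] at this
  · obtain ⟨i, rfl⟩ := hf' i hi
    obtain ⟨j, rfl⟩ := hf' j hj
    by_cases hij : i = j
    · rw [hij, rep_swap_self]
    have := congrArg Subtype.val (hx i j hij)
    change restrictEmb ρ f (swap i j) x = -x at this
    rw [restrictEmb_swap] at this
    rw [signTwist_swap _ (f.injective.ne hij), this, neg_neg]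

end Small

/-! ### Six points: vectors fixed by three points -/

section Mixed

variable {M : Type*} [AddCommGroup M] [Module ℂ M] {ρ : Representation ℂ (Perm (Fin 6)) M}

/-- Vectors indexed by the triples of distinct points of six points, permuted by the group, on
which the permutations of the three places act as on copies of the reflection representation. -/
structure MixedSystem (ρ : Representation ℂ (Perm (Fin 6)) M) (Y : Fin 6 → Fin 6 → Fin 6 → M) :
    Prop where
  map : ∀ g i j k, ρ g (Y i j k) = Y (g i) (g j) (g k)
  symm : ∀ i j k, Y i k j = Y i j k
  cyc : ∀ i j k, Y i j k + Y j i k + Y k j i = 0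
  diag : ∀ i k, Y i i k = 0
  sum₁ : ∀ j k, j ≠ k → ∑ i, Y i j k = 0
  sum₂ : ∀ i k, i ≠ k → ∑ j, Y i j k = 0
  ne : Y 0 1 2 ≠ 0

/-- The conditions `h₂` and `h₃` place `y` in the two-dimensional isotypic part for the permutations
of 0, 1, 2. As before, `hf` makes the sums with two fixed indices vanish. -/
lemma exists_mixedSystem (hf : NoFixed ρ 4) {y : M} (hy : y ≠ 0) (h₁ : FixedOn ρ {3, 4, 5} y)
    (h₂ : ρ (swap 1 2) y = y) (h₃ : y + ρ (swap 0 1) y + ρ (swap 0 2) y = 0) :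
    ∃ Y, MixedSystem ρ Y := by
  obtain ⟨Y, h0, hY, hoff⟩ := exists_equivariant ρ y ((0, 1, 2) : Fin 6 × Fin 6 × Fin 6)
    fun g hg => h₁.apply g (by
      simp only [Prod.smul_mk, Prod.mk.injEq] at hg
      intro i hi
      have : i = 0 ∨ i = 1 ∨ i = 2 := by
        revert i
        decide
      rcases this with rfl | rfl | rfl
      · exact hg.1
      · exact hg.2.1
      · exact hg.2.2)
  have hmap : ∀ g i j k, ρ g (Y (i, j, k)) = Y (g i, g j, g k) := fun g i j k => hY g (i, j, k)
  have hval : ∀ g : Perm (Fin 6), Y (g 0, g 1, g 2) = ρ g y := fun g => by rw [← hmap, h0]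
  have hex : ∀ i j k, (∃ g : Perm (Fin 6), g 0 = i ∧ g 1 = j ∧ g 2 = k) ∨ Y (i, j, k) = 0 := by
    intro i j k
    by_cases h : ∃ g : Perm (Fin 6), g 0 = i ∧ g 1 = j ∧ g 2 = k
    · exact Or.inl h
    · exact Or.inr (hoff _ fun g hg => h ⟨g, congrArg (fun x => x.1) hg,
        congrArg (fun x => x.2.1) hg, congrArg (fun x => x.2.2) hg⟩)
  have hs : ∀ i j k, (∃ g : Perm (Fin 6), g 0 = i ∧ g 1 = j ∧ g 2 = k) →
      Y (i, k, j) = Y (i, j, k) := by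
    rintro _ _ _ ⟨g, rfl, rfl, rfl⟩
    rw [hval, ← h₂, ← Module.End.mul_apply, ← map_mul, ← hval]
    rfl
  have hsum : ∀ i j (F : Fin 6 → M), i ≠ j → (∀ k l m, k ≠ i → k ≠ j → l ≠ i → l ≠ j →
      ρ (swap k l) (F m) = F (swap k l m)) → ∑ m, F m = 0 := by
    intro i j F hij hF
    refine hf {i, j}ᶜ (by rw [Finset.card_compl, Finset.card_pair hij, Fintype.card_fin]) _
      fun k hk l hl => ?_
    simp only [Finset.mem_compl, Finset.mem_insert, Finset.mem_singleton, not_or] at hk hl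
    rw [map_sum]
    simp only [hF _ _ _ hk.1 hk.2 hl.1 hl.2]
    exact Equiv.sum_comp (swap k l) F
  refine ⟨fun i j k => Y (i, j, k), hmap, fun i j k => ?_, fun i j k => ?_, fun i k => ?_,
    fun j k hjk => ?_, fun i k hik => ?_, h0 ▸ hy⟩
  · rcases hex i j k with h | h
    · exact hs i j k h
    · rcases hex i k j with h' | h'
      · exact (hs i k j h').symm
      · exact h'.trans h.symm
  · rcases hex i j k with ⟨g, rfl, rfl, rfl⟩ | h
    · have := congrArg (ρ g) h₃
      rwa [map_add, map_add, map_zero, ← Module.End.mul_apply, ← map_mul, ← Module.End.mul_apply,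
        ← map_mul, ← hval, ← hval, ← hval] at this
    · have h' : ∀ a b c, (∀ g : Perm (Fin 6), g 0 = a → g 1 = b → g 2 = c →
          ∃ g : Perm (Fin 6), g 0 = i ∧ g 1 = j ∧ g 2 = k) → Y (a, b, c) = 0 := by
        intro a b c habc
        rcases hex a b c with ⟨g, h1, h2, h3⟩ | h'
        · obtain ⟨g', rfl, rfl, rfl⟩ := habc g h1 h2 h3
          rw [hval] at h
          exact absurd h (rep_ne_zero g' hy)
        · exact h'
      rw [h, h' j i k fun g h1 h2 h3 => ⟨g * swap 0 1, h2, h1, h3⟩,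
        h' k j i fun g h1 h2 h3 => ⟨g * swap 0 2, h3, h2, h1⟩, add_zero, add_zero]
  · rcases hex i i k with ⟨g, h1, h2, -⟩ | h
    · exact absurd (g.injective (h1.trans h2.symm)) (by decide)
    · exact h
  · refine hsum j k _ hjk fun a b m ha ha' hb hb' => ?_
    rw [hmap, swap_apply_of_ne_of_ne ha.symm hb.symm, swap_apply_of_ne_of_ne ha'.symm hb'.symm]
  · refine hsum i k _ hik fun a b m ha ha' hb hb' => ?_
    rw [hmap, swap_apply_of_ne_of_ne ha.symm hb.symm, swap_apply_of_ne_of_ne ha'.symm hb'.symm]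

namespace MixedSystem

variable {Y : Fin 6 → Fin 6 → Fin 6 → M}

lemma diag₁ (h : MixedSystem ρ Y) (i k : Fin 6) : Y i k i = 0 := by
  rw [h.symm, h.diag]

lemma diag₂ (h : MixedSystem ρ Y) (i k : Fin 6) : Y k i i = 0 := by
  have := h.cyc k i i
  rwa [h.diag₁, h.diag, add_zero, add_zero] at this

lemma swap_ne (h : MixedSystem ρ Y) : Y 0 1 2 ≠ Y 1 0 2 := by
  intro e
  have e2 : Y 0 2 1 = Y 2 0 1 := by
    have := congrArg (ρ (swap 1 2)) e
    rwa [h.map, h.map] at this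
  have key : (3 : ℂ) • Y 0 1 2 = 0 := by
    have := h.cyc 0 1 2
    rw [← e, h.symm 2 0 1, ← e2, h.symm 0 1 2] at this
    rw [← this]
    module
  exact h.ne ((smul_eq_zero.1 key).resolve_left (by norm_num))

/-- If no vector alternated under three points, the alternating sum of `Y 0 1 2` over `{0, 1, m}`
would vanish. Added over `m = 3, 4, 5` and simplified by the sum relations, this gives `5 • (Y 0 1 2
- Y 1 0 2) = 0`. -/
lemma not_noFixed_signTwist (h : MixedSystem ρ Y) : ¬ NoFixed (signTwist ρ) 3 := by
  intro hf
  have alt : ∀ m : Fin 6, m ≠ 0 → m ≠ 1 → m ≠ 2 →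
      Y 0 1 2 - Y 0 m 2 - Y m 1 2 - Y 1 0 2 + Y 1 m 2 + Y m 0 2 = 0 := by
    intro m h0 h1 h2
    have e := hf {m, 0, 1} (Finset.card_eq_three.2 ⟨m, 0, 1, h0, h1, by decide, rfl⟩) _
      (FixedOn.symmetrize_triple (signTwist ρ) (by decide) h0.symm h1.symm (Y 0 1 2))
    simp only [signTwist_swap ρ h0.symm, signTwist_swap ρ h1.symm,
      signTwist_swap ρ (show (0 : Fin 6) ≠ 1 by decide), map_neg, h.map, swap_apply_left,
      swap_apply_right, swap_apply_of_ne_of_ne (show (2 : Fin 6) ≠ 0 by decide) h2.symm,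
      swap_apply_of_ne_of_ne (show (2 : Fin 6) ≠ 1 by decide) h2.symm,
      swap_apply_of_ne_of_ne (show (1 : Fin 6) ≠ 0 by decide) h1.symm,
      swap_apply_of_ne_of_ne (show (0 : Fin 6) ≠ 1 by decide) h0.symm,
      swap_apply_of_ne_of_ne (show (2 : Fin 6) ≠ 0 by decide) (show (2 : Fin 6) ≠ 1 by decide)]
      at e
    rw [← e]
    abel
  have a3 := alt 3 (by decide) (by decide) (by decide)
  have a4 := alt 4 (by decide) (by decide) (by decide)
  have a5 := alt 5 (by decide) (by decide) (by decide)
  have s1 := h.sum₁ 1 2 (by decide)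
  have s2 := h.sum₁ 0 2 (by decide)
  have s3 := h.sum₂ 0 2 (by decide)
  have s4 := h.sum₂ 1 2 (by decide)
  simp only [Fin.sum_univ_six, h.diag, h.diag₁, h.diag₂, zero_add, add_zero] at s1 s2 s3 s4
  have key : (5 : ℂ) • (Y 0 1 2 - Y 1 0 2) = 0 := by
    linear_combination (norm := module) a3 + a4 + a5 + s1 - s2 + s3 - s4
  exact h.swap_ne (sub_eq_zero.1 ((smul_eq_zero.1 key).resolve_left (by norm_num)))

lemma isSwapFamily (h : MixedSystem ρ Y) :
    IsSwapFamily (fun k => Y 0 1 k - Y 1 0 k) {2, 3, 4, 5} := by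
  have hm : ∀ i ∈ ({2, 3, 4, 5} : Finset (Fin 6)), i ≠ 0 ∧ i ≠ 1 := by decide
  refine ⟨fun i hi j hj => ⟨ρ (swap i j), fun k _ => ?_⟩, fun i hi j hj hij e => ?_⟩
  · rw [map_sub, h.map, h.map, swap_apply_of_ne_of_ne (hm i hi).1.symm (hm j hj).1.symm,
      swap_apply_of_ne_of_ne (hm i hi).2.symm (hm j hj).2.symm]
  · have hall : ∀ m, m ≠ 0 → m ≠ 1 → Y 0 1 m - Y 1 0 m = Y 0 1 i - Y 1 0 i := by
      intro m h0 h1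
      by_cases hmi : m = i
      · rw [hmi]
      · have := congrArg (ρ (swap j m)) e
        rw [map_sub, map_sub, h.map, h.map, h.map, h.map, swap_apply_left,
          swap_apply_of_ne_of_ne hij (Ne.symm hmi), swap_apply_of_ne_of_ne (hm j hj).1.symm h0.symm,
          swap_apply_of_ne_of_ne (hm j hj).2.symm h1.symm] at this
        exact this.symm
    have s1 := h.sum₂ 0 1 (by decide)
    have s2 := h.sum₂ 1 0 (by decide)
    simp only [Fin.sum_univ_six, h.diag₁, h.diag₂, h.symm 0 1, h.symm 1 0, zero_add,
      add_zero] at s1 s2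
    have e2 := hall 2 (by decide) (by decide)
    have e3 := hall 3 (by decide) (by decide)
    have e4 := hall 4 (by decide) (by decide)
    have e5 := hall 5 (by decide) (by decide)
    rw [← e2] at e3 e4 e5
    have key : (4 : ℂ) • (Y 0 1 2 - Y 1 0 2) = 0 := by
      linear_combination (norm := module) s1 - s2 - e3 - e4 - e5
    exact h.swap_ne (sub_eq_zero.1 ((smul_eq_zero.1 key).resolve_left (by norm_num)))

/-- The system `Y` gives three independent vectors `Y 0 1 k - Y 1 0 k`, `k = 2, 3, 4`. The system of
the twist adds `Z 5 0 1`, stored at the index 5, which alternates under the permutations of 2, 3, 4.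
-/
lemma le_eigDim_neg_one [FiniteDimensional ℂ M] (h : MixedSystem ρ Y)
    {Z : Fin 6 → Fin 6 → Fin 6 → M} (h' : MixedSystem (signTwist ρ) Z) :
    4 ≤ eigDim ρ (-1) 0 1 := by
  have hZ : ∀ i j a b c, i ≠ j →
      ρ (swap i j) (Z a b c) = -Z (swap i j a) (swap i j b) (swap i j c) := by
    intro i j a b c hij
    rw [← h'.map, signTwist_swap _ hij, neg_neg]
  have hZ5 : Z 5 0 1 ≠ 0 := by
    intro e
    have : Z 0 1 2 = signTwist ρ (swap 5 0 * swap 0 1 * swap 1 2) (Z 5 0 1) := by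
      rw [h'.map]
      rfl
    exact h'.ne (by rw [this, e, map_zero])
  refine card_le_finrank (End.eigenspace (ρ (swap 0 1)) (-1))
    (fun k => if k = 5 then Z 5 0 1 else Y 0 1 k - Y 1 0 k) ({2, 3, 4, 5} : Finset (Fin 6)) ?_ ?_
  · intro k hk
    rw [End.mem_eigenspace_iff, neg_one_smul]
    split_ifs with hk5
    · rw [hZ _ _ _ _ _ (by decide), neg_inj, ← h'.symm 5 0 1]
      rfl
    · have : k ≠ 0 ∧ k ≠ 1 := by
        revert k
        decide
      rw [map_sub, h.map, h.map, swap_apply_left, swap_apply_right,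
        swap_apply_of_ne_of_ne this.1 this.2, neg_sub]
  · intro c hc
    have hc2 : c 2 • (Y 0 1 2 - Y 1 0 2) + c 3 • (Y 0 1 3 - Y 1 0 3) +
        c 4 • (Y 0 1 4 - Y 1 0 4) + c 5 • Z 5 0 1 = 0 := by
      rw [← hc, Finset.sum_insert (by decide), Finset.sum_insert (by decide),
        Finset.sum_insert (by decide), Finset.sum_singleton, if_neg (by decide), if_neg (by decide),
        if_neg (by decide), if_pos rfl]
      abel
    -- Antisymmetrizing the relation over the permutations of 2, 3, 4 kills the three vectors of
    -- `Y`, each being fixed by a transposition, and multiplies `Z 5 0 1` by 6.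
    have h5 : c 5 = 0 := by
      have e1 := congrArg (ρ (swap 2 3)) hc2
      have e2 := congrArg (ρ (swap 2 4)) hc2
      have e3 := congrArg (ρ (swap 3 4)) hc2
      have e4 := congrArg (ρ (swap 2 3)) e2
      have e5 := congrArg (ρ (swap 2 3)) e3
      simp only [map_add, map_sub, map_smul, map_neg, map_zero, h.map,
        hZ 2 3 _ _ _ (by decide), hZ 2 4 _ _ _ (by decide), hZ 3 4 _ _ _ (by decide)]
        at e1 e2 e3 e4 e5
      change c 2 • (Y 0 1 3 - Y 1 0 3) + c 3 • (Y 0 1 2 - Y 1 0 2) +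
        c 4 • (Y 0 1 4 - Y 1 0 4) + c 5 • -Z 5 0 1 = 0 at e1
      change c 2 • (Y 0 1 4 - Y 1 0 4) + c 3 • (Y 0 1 3 - Y 1 0 3) +
        c 4 • (Y 0 1 2 - Y 1 0 2) + c 5 • -Z 5 0 1 = 0 at e2
      change c 2 • (Y 0 1 2 - Y 1 0 2) + c 3 • (Y 0 1 4 - Y 1 0 4) +
        c 4 • (Y 0 1 3 - Y 1 0 3) + c 5 • -Z 5 0 1 = 0 at e3
      change c 2 • (Y 0 1 4 - Y 1 0 4) + c 3 • (Y 0 1 2 - Y 1 0 2) +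
        c 4 • (Y 0 1 3 - Y 1 0 3) + c 5 • - -Z 5 0 1 = 0 at e4
      change c 2 • (Y 0 1 3 - Y 1 0 3) + c 3 • (Y 0 1 4 - Y 1 0 4) +
        c 4 • (Y 0 1 2 - Y 1 0 2) + c 5 • - -Z 5 0 1 = 0 at e5
      have key : (6 * c 5) • Z 5 0 1 = 0 := by
        linear_combination (norm := module) hc2 - e1 - e2 - e3 + e4 + e5
      simpa using (smul_eq_zero.1 key).resolve_right hZ5
    rw [h5, zero_smul, add_zero] at hc2
    have hs : ({2, 3, 4, 5} : Finset (Fin 6)).erase 5 = {2, 3, 4} := by decide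
    have h0 := fun k hk => h.isSwapFamily.coeff_eq_zero_erase (l := 5) (c := c) (i := k) (by decide)
      (by
        rw [hs, Finset.sum_insert (by decide), Finset.sum_insert (by decide),
          Finset.sum_singleton, ← hc2]
        abel) hk
    intro k hk
    by_cases hk5 : k = 5
    · rw [hk5, h5]
    · exact h0 k (Finset.mem_erase.2 ⟨hk5, hk⟩)

end MixedSystem

/-- Symmetrizing over `{3, 4, 5}` and one more point, and antisymmetrizing over `{0, 1, 2}` and one
more point, both give 0. In the sum of the six relations the nine transpositions between the two
halves cancel and `6 • x` remains. -/
lemma eq_zero_of_fixedOn_of_fixedOn_signTwist (hf : NoFixed ρ 4) (hf' : NoFixed (signTwist ρ) 4)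
    {x : M} (h : FixedOn ρ {3, 4, 5} x) (h' : FixedOn (signTwist ρ) {0, 1, 2} x) : x = 0 := by
  have e0 := hf _ (by decide) _ (h.insert (l := 0) (by decide))
  have e1 := hf _ (by decide) _ (h.insert (l := 1) (by decide))
  have e2 := hf _ (by decide) _ (h.insert (l := 2) (by decide))
  have e3 := hf' _ (by decide) _ (h'.insert (l := 3) (by decide))
  have e4 := hf' _ (by decide) _ (h'.insert (l := 4) (by decide))
  have e5 := hf' _ (by decide) _ (h'.insert (l := 5) (by decide))
  have hs : ∀ F : Fin 6 → M, ∑ k ∈ {3, 4, 5}, F k = F 3 + (F 4 + F 5) := fun F => by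
    rw [Finset.sum_insert (by decide), Finset.sum_insert (by decide), Finset.sum_singleton]
  have hs' : ∀ F : Fin 6 → M, ∑ k ∈ {0, 1, 2}, F k = F 0 + (F 1 + F 2) := fun F => by
    rw [Finset.sum_insert (by decide), Finset.sum_insert (by decide), Finset.sum_singleton]
  have hsw : ∀ i j : Fin 6, i ≠ j → signTwist ρ (swap i j) x = -ρ (swap j i) x := fun i j hij => by
    rw [signTwist_swap _ hij, swap_comm]
  rw [hs] at e0 e1 e2
  rw [hs', hsw _ _ (by decide), hsw _ _ (by decide), hsw _ _ (by decide)] at e3 e4 e5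
  have key : (6 : ℂ) • x = 0 := by
    linear_combination (norm := module) e0 + e1 + e2 + e3 + e4 + e5
  exact (smul_eq_zero.1 key).resolve_left (by norm_num)

/-- The vectors fixed on `{3, 4, 5}` form a representation of the permutations of 0, 1, 2. A trivial
component gives a `TripleSystem`, a two-dimensional one a `MixedSystem`, and the sign is excluded by
`eq_zero_of_fixedOn_of_fixedOn_signTwist`. -/
lemma exists_tripleSystem_or_mixedSystem (hf : NoFixed ρ 4) (hf' : NoFixed (signTwist ρ) 4)
    (h3 : ¬ NoFixed ρ 3) : (∃ W, TripleSystem ρ W) ∨ ∃ Y, MixedSystem ρ Y := by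
  obtain ⟨x, hx0, hx⟩ := exists_fixedOn_of_not_noFixed h3 (B := {3, 4, 5}) (by decide)
  by_contra! hcon
  obtain ⟨hT, hY⟩ := hcon
  have hset : ∀ i j : Fin 6, i < 3 → j < 3 →
      ({3, 4, 5} : Finset (Fin 6)).map (swap i j).toEmbedding = {3, 4, 5} := by decide
  have hcl : ∀ i j : Fin 6, i < 3 → j < 3 → ∀ x, FixedOn ρ {3, 4, 5} x →
      FixedOn ρ {3, 4, 5} (ρ (swap i j) x) := by
    intro i j hi hj x hx
    have := hx.conj (swap i j)
    rwa [hset i j hi hj] at this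
  have hneg : ∀ x, FixedOn ρ {3, 4, 5} x → FixedOn ρ {3, 4, 5} (-x) := fun x hx i hi j hj => by
    rw [map_neg, hx i hi j hj]
  have h12 := hcl 1 2 (by decide) (by decide)
  have h10 := hcl 1 0 (by decide) (by decide)
  have h20 := hcl 2 0 (by decide) (by decide)
  have hsym : ∀ x, FixedOn ρ {3, 4, 5} x → x + ρ (swap 1 2) x + (ρ (swap 1 0) x +
      ρ (swap 1 0) (ρ (swap 1 2) x) + (ρ (swap 2 0) x + ρ (swap 2 0) (ρ (swap 1 2) x))) = 0 := by
    intro x hx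
    by_contra hne
    obtain ⟨W, hW⟩ := exists_tripleSystem hf hne
      (FixedOn.symmetrize_triple ρ (by decide) (by decide) (by decide) x)
      (((hx.add (h12 x hx))).add (((h10 x hx).add (h10 _ (h12 x hx))).add
        ((h20 x hx).add (h20 _ (h12 x hx)))))
    exact hT W hW
  have halt : x + -ρ (swap 1 2) x + (-ρ (swap 1 0) x + ρ (swap 1 0) (ρ (swap 1 2) x) +
      (-ρ (swap 2 0) x + ρ (swap 2 0) (ρ (swap 1 2) x))) = 0 := by
    have hF := FixedOn.symmetrize_triple (signTwist ρ) (i := 1) (j := 2) (k := 0) (by decide)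
      (by decide) (by decide) x
    simp only [signTwist_swap ρ (show (1 : Fin 6) ≠ 2 by decide),
      signTwist_swap ρ (show (1 : Fin 6) ≠ 0 by decide),
      signTwist_swap ρ (show (2 : Fin 6) ≠ 0 by decide), map_neg, neg_neg] at hF
    exact eq_zero_of_fixedOn_of_fixedOn_signTwist hf hf'
      ((hx.add (hneg _ (h12 x hx))).add (((hneg _ (h10 x hx)).add (h10 _ (h12 x hx))).add
        ((hneg _ (h20 x hx)).add (h20 _ (h12 x hx))))) hF
  -- A nonzero `x + (1 2) x` would generate a `MixedSystem`, its full symmetrization being 0. So `(1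
  -- 2)` negates every such `x`, which contradicts the vanishing of the antisymmetrization `halt`.
  have hanti : ∀ x, FixedOn ρ {3, 4, 5} x → x + ρ (swap 1 2) x = 0 := by
    intro x hx
    by_contra hne
    obtain ⟨Y, hY'⟩ := exists_mixedSystem hf hne (hx.add (h12 x hx))
      (by rw [map_add, rep_swap_swap, add_comm]) (by
        rw [← hsym x hx, map_add, map_add, swap_comm 0 1, swap_comm 0 2]
        abel)
    exact hY Y hY'
  have e1 := hanti x hx
  have e2 := hanti _ (h10 x hx)
  rw [← Module.End.mul_apply, ← map_mul, show (swap 1 2 * swap 1 0 : Perm (Fin 6)) =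
    swap 2 0 * swap 1 2 by decide, map_mul, Module.End.mul_apply] at e2
  have e3 : ρ (swap 1 2) x = -x := (neg_eq_of_add_eq_zero_right e1).symm
  rw [e3, map_neg] at e2
  rw [e3, map_neg, map_neg] at halt
  have e4 : x = (2 : ℂ) • ρ (swap 1 0) x := by
    linear_combination (norm := module) (2⁻¹ : ℂ) • halt - e2
  have e5 : ρ (swap 1 0) x = (2 : ℂ) • x := by
    have := congrArg (ρ (swap 1 0)) e4
    rwa [map_smul, rep_swap_swap] at this
  rw [e5] at e4
  have e6 : (3 : ℂ) • x = 0 := by linear_combination (norm := module) -e4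
  exact hx0 ((smul_eq_zero.1 e6).resolve_left (by norm_num))

/-- Without triple systems, a `MixedSystem` exists for `ρ` or its twist by `not_noFixed_three`, then
for the other by `not_noFixed_signTwist`. Both together force an eigenspace of dimension at least 4.
-/
lemma exists_tripleSystem_or_signTwist [FiniteDimensional ℂ M] [Nontrivial M] (hf : NoFixed ρ 4)
    (hf' : NoFixed (signTwist ρ) 4) (h3 : eigDim ρ (-1) 0 1 ≤ 3) :
    (∃ W, TripleSystem ρ W) ∨ ∃ W, TripleSystem (signTwist ρ) W := by
  by_contra! hcon
  obtain ⟨hT, hT'⟩ := hcon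
  have key : ∀ τ : Representation ℂ (Perm (Fin 6)) M, NoFixed τ 4 → NoFixed (signTwist τ) 4 →
      (∀ W, ¬ TripleSystem τ W) → ¬ NoFixed τ 3 →
      ∃ Y, MixedSystem τ Y := fun τ h h' hT h3 =>
    (exists_tripleSystem_or_mixedSystem h h' h3).resolve_left fun ⟨W, hW⟩ => hT W hW
  have hf2 : NoFixed (signTwist (signTwist ρ)) 4 := by rwa [signTwist_signTwist]
  have hY : ∃ Y, MixedSystem ρ Y := by
    refine key ρ hf hf' hT fun hn => ?_
    obtain ⟨Y, hY⟩ := key _ hf' hf2 hT' (not_noFixed_three ρ (by norm_num) hn)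
    exact hY.not_noFixed_signTwist (by rwa [signTwist_signTwist])
  obtain ⟨Y, hY⟩ := hY
  obtain ⟨Z, hZ⟩ := key _ hf' hf2 hT' hY.not_noFixed_signTwist
  have := hY.le_eigDim_neg_one hZ
  omega

end Mixed

/-! ### Representations with a small eigenspace of a transposition -/

section Classification

variable {n : ℕ} {M : Type*} [AddCommGroup M] [Module ℂ M]
  {ρ : Representation ℂ (Perm (Fin n)) M}

lemma iso_sign_iff : Iso ρ (charRep (signChar n)) ↔ Iso (signTwist ρ) (charRep 1) := by
  constructor <;> intro h <;> obtain ⟨e, he⟩ := h.exists_equiv <;> refine Iso.of_equiv e fun g x => ?_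
  · rw [signTwist_apply, map_smul, he, charRep_apply, charRep_apply, signChar_apply, smul_eq_mul,
      ← mul_assoc, sign_mul_self_complex]
    simp
  · have := he g x
    rw [signTwist_apply, map_smul, charRep_apply, smul_eq_mul] at this
    rw [charRep_apply, signChar_apply, ← one_mul (e (ρ g x)), ← sign_mul_self_complex g, mul_assoc,
      this]
    simp

lemma eigDim_neg_one_of_iso_sign {p q : Fin n} (hpq : p ≠ q) (h : Iso ρ (charRep (signChar n))) :
    eigDim ρ (-1) p q = 1 := by
  rw [eigDim, finrank_eigenspace_iso h]
  exact eigDim_charRep_sign hpq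

lemma iso_sign_of_noFixed_two (hρ : IsSimpleRep ρ) (h : NoFixed ρ 2) :
    Iso ρ (charRep (signChar n)) := by
  have := hρ.1
  obtain ⟨w, hw⟩ := exists_ne (0 : M)
  refine iso_sign_iff.2 (iso_trivial_of_fixedOn_univ hρ.signTwist hw fun i _ j _ => ?_)
  by_cases hij : i = j
  · rw [hij, rep_swap_self]
  · rw [signTwist_swap _ hij]
    exact neg_eq_of_add_eq_zero_left (h {i, j} (Finset.card_pair hij) _
      (FixedOn.symmetrize_pair ρ i j w))

lemma inShortList_of_le_three (hρ : IsSimpleRep ρ) (h2 : 2 ≤ n) (h3 : n ≤ 3) : InShortList ρ := by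
  by_cases hf : NoFixed ρ 2
  · exact Or.inr (Or.inl (iso_sign_of_noFixed_two hρ hf))
  have key : ∃ p : Fin n, ∃ w ≠ 0, FixedOn ρ {p}ᶜ w := by
    obtain rfl | rfl : n = 2 ∨ n = 3 := by omega
    -- For `n = 2` the complement of a point is a single point, so every vector qualifies.
    · have := hρ.1
      obtain ⟨w, hw⟩ := exists_ne (0 : M)
      refine ⟨0, w, hw, fun i hi j hj => ?_⟩
      have : i = j := by
        revert i j
        decide
      rw [this, rep_swap_self]
    · exact ⟨0, exists_fixedOn_of_not_noFixed hf (by decide)⟩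
  obtain ⟨p, w, hw, h⟩ := key
  rcases iso_trivial_or_pointSystem hρ hw h with h | ⟨W, hW⟩
  · exact Or.inl h
  · exact Or.inr (Or.inr (Or.inl (hW.iso_reflRep hρ)))

lemma iso_trivial_or_pointSystem_or_exists_pairSystem (hρ : IsSimpleRep ρ) (hn : 2 ≤ n)
    (h : ¬ NoFixed ρ (n - 2)) : Iso ρ (charRep 1) ∨ (∃ W, PointSystem ρ W) ∨
      ∃ ε : ℂ, (ε = 1 ∨ ε = -1) ∧ ∃ W, PairSystem ρ ε W := by
  let p : Fin n := ⟨0, by omega⟩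
  let q : Fin n := ⟨1, by omega⟩
  have hpq : p ≠ q := by simp [p, q]
  obtain ⟨w, hw, hfix⟩ := exists_fixedOn_of_not_noFixed h (PairSystem.card_compl_pair hpq)
  have key : ∀ ε : ℂ, (ε = 1 ∨ ε = -1) → ∀ w ≠ 0, FixedOn ρ {p, q}ᶜ w → ρ (swap p q) w = ε • w →
      Iso ρ (charRep 1) ∨ (∃ W, PointSystem ρ W) ∨
        ∃ ε : ℂ, (ε = 1 ∨ ε = -1) ∧ ∃ W, PairSystem ρ ε W := fun ε hε w hw hfix hs =>
    (iso_trivial_or_pointSystem_or_pairSystem hρ hpq hw hfix hs).imp id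
      (Or.imp id fun h => ⟨ε, hε, h⟩)
  by_cases h0 : w + ρ (swap p q) w = 0
  · refine key (-1) (Or.inr rfl) w hw hfix ?_
    rw [neg_one_smul]
    exact (neg_eq_of_add_eq_zero_right h0).symm
  · refine key 1 (Or.inl rfl) _ h0 (hfix.add fun i hi j hj => ?_) ?_
    · have hi' := hi
      have hj' := hj
      simp only [Finset.mem_compl, Finset.mem_insert, Finset.mem_singleton, not_or] at hi' hj'
      have e := swap_apply_apply (swap i j) p q
      rw [swap_apply_of_ne_of_ne (Ne.symm hi'.1) (Ne.symm hj'.1),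
        swap_apply_of_ne_of_ne (Ne.symm hi'.2) (Ne.symm hj'.2), eq_mul_inv_iff_mul_eq] at e
      rw [← Module.End.mul_apply, ← map_mul, ← e, map_mul, Module.End.mul_apply, hfix i hi j hj]
    · rw [map_add, rep_swap_swap, add_comm, one_smul]

/-- In both cases of `h` the eigenspace has dimension less than `n - 2`. This rules out the
antisymmetric pairs for `ρ` and, for the twist, the points and, if `n ≥ 5`, the symmetric pairs. For
`n = 4` the latter survive as the shape `(2,2)`. -/
lemma inShortList_of_eigDim_le [FiniteDimensional ℂ M] (hρ : IsSimpleRep ρ) (hn : 4 ≤ n)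
    {p q : Fin n} (hpq : p ≠ q) (h : eigDim ρ (-1) p q ≤ 1 ∨ 7 ≤ n ∧ eigDim ρ (-1) p q ≤ 3) :
    InShortList ρ := by
  by_cases h0 : eigDim ρ (-1) p q = 0
  · exact Or.inl ((iso_trivial_iff hρ hpq).1 h0)
  have hlt : eigDim ρ (-1) p q < n - 2 := by omega
  have htw : eigDim (signTwist ρ) 1 p q = eigDim ρ (-1) p q := eigDim_signTwist ρ hpq 1
  obtain ⟨x, hx, hs, hfix | hfix⟩ := exists_fixedOn_compl_pair ρ hn hpq h0 h
  · rcases iso_trivial_or_pointSystem_or_pairSystem hρ hpq hx hfix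
      (hs.trans (neg_one_smul ℂ x).symm) with h1 | ⟨W, hW⟩ | ⟨W, hW⟩
    · exact Or.inl h1
    · exact Or.inr (Or.inr (Or.inl (hW.iso_reflRep hρ)))
    · have := hW.le_eigDim_neg_one_of_neg hn hpq
      omega
  · rcases iso_trivial_or_pointSystem_or_pairSystem hρ.signTwist hpq hx hfix
      (show signTwist ρ (swap p q) x = (1 : ℂ) • x by
        rw [signTwist_swap _ hpq, hs, neg_neg, one_smul]) with h1 | ⟨W, hW⟩ | ⟨W, hW⟩
    · exact Or.inr (Or.inl (iso_sign_iff.2 h1))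
    · have := hW.le_eigDim_one hpq
      omega
    · by_cases h4 : n = 4
      · subst h4
        exact Or.inr (Or.inr (Or.inr ⟨rfl, hW.hasShape_two_two hρ⟩))
      · have := hW.le_eigDim_one (Or.inl rfl) (by omega) hpq
        omega

lemma eigDim_le_of_hasShape_two_two [FiniteDimensional ℂ M] {ρ : Representation ℂ (Perm (Fin 4)) M}
    (hρ : IsSimpleRep ρ) (h : HasShape ρ [2, 2]) : eigDim ρ (-1) 0 1 ≤ 1 := by
  obtain ⟨w, hw, hfix⟩ := h.exists_fixed isFilling_two_two
  obtain ⟨W, hW, -⟩ := exists_pairSystem (p := 0) (q := 1) (ε := 1)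
    (h.noFixed (k := 2) (by decide)) (by decide) hw
    (fun i hi j hj => hfix i j (by
      revert i j
      decide)) ((hfix 0 1 rfl).trans (one_smul ℂ w).symm)
  exact hW.eigDim_neg_one_le_of_one hρ (by decide) (by norm_num)

lemma eigDim_le_of_hasShape_four_two [FiniteDimensional ℂ M]
    {ρ : Representation ℂ (Perm (Fin 6)) M} (hρ : IsSimpleRep ρ) (h : HasShape ρ [4, 2]) :
    eigDim ρ (-1) 0 1 ≤ 3 := by
  obtain ⟨w, hw, hfix⟩ := h.exists_fixed isFilling_four_two
  obtain ⟨W, hW, -⟩ := exists_pairSystem (p := 4) (q := 5) (ε := 1)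
    (h.noFixed (k := 4) (by decide)) (by decide) hw
    (fun i hi j hj => hfix i j (by
      revert i j
      decide)) ((hfix 4 5 rfl).trans (one_smul ℂ w).symm)
  exact hW.eigDim_neg_one_le_of_one hρ (by decide) (by norm_num)

lemma eigDim_le_of_hasShape_three_three [FiniteDimensional ℂ M]
    {ρ : Representation ℂ (Perm (Fin 6)) M} (hρ : IsSimpleRep ρ) (h : HasShape ρ [3, 3]) :
    eigDim ρ (-1) 0 1 ≤ 3 := by
  obtain ⟨w, hw, hfix⟩ := h.exists_fixed isFilling_three_three
  obtain ⟨W, hW⟩ := exists_tripleSystem (h.noFixed (k := 3) (by decide)) hw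
    (fun i hi j hj => hfix i j (by
      revert i j
      decide)) (fun i hi j hj => hfix i j (by
      revert i j
      decide))
  exact hW.eigDim_neg_one_le hρ

lemma eigDim_le_of_hasShape_two_two_two [FiniteDimensional ℂ M]
    {ρ : Representation ℂ (Perm (Fin 6)) M} (hρ : IsSimpleRep ρ) (h : HasShape ρ [2, 2, 2]) :
    eigDim ρ (-1) 0 1 ≤ 3 := by
  obtain ⟨w, hw, hsgn⟩ := h.exists_sign isFilling_two_two_two
  have hfix : ∀ A : Finset (Fin 6), (∀ i ∈ A, ∀ j ∈ A,
      ((![(0, 0), (1, 0), (2, 0), (0, 1), (1, 1), (2, 1)] : Fin 6 → ℕ × ℕ) i).2 =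
        ((![(0, 0), (1, 0), (2, 0), (0, 1), (1, 1), (2, 1)] : Fin 6 → ℕ × ℕ) j).2) →
      FixedOn (signTwist ρ) A w := by
    intro A hA i hi j hj
    by_cases hij : i = j
    · rw [hij, rep_swap_self]
    · rw [signTwist_swap _ hij, hsgn i j hij (hA i hi j hj), neg_neg]
  -- The column-alternating vector of shape `(2,2,2)` is, for the twist, a vector fixed on two
  -- complementary triples. The `-1`-eigenspace of `ρ` is then bounded as the `1`-eigenspace of the
  -- twist.
  obtain ⟨W, hW⟩ := exists_tripleSystem h.noFixed_signTwist hw (hfix _ (by decide))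
    (hfix _ (by decide))
  have := hW.eigDim_one_le hρ.signTwist
  rwa [eigDim_signTwist _ (by decide)] at this

theorem eigDim_neg_one_le_one_iff [FiniteDimensional ℂ M] (hρ : IsSimpleRep ρ) {p q : Fin n}
    (hpq : p ≠ q) : eigDim ρ (-1) p q ≤ 1 ↔ InShortList ρ := by
  constructor
  · intro h
    by_cases hn : 4 ≤ n
    · exact inShortList_of_eigDim_le hρ hn hpq (Or.inl h)
    · refine inShortList_of_le_three hρ ?_ (by omega)
      have := p.isLt
      have := q.isLt
      have : p.1 ≠ q.1 := fun e => hpq (Fin.ext e)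
      omega
  · rintro (h | h | h | ⟨rfl, h⟩)
    · rw [(iso_trivial_iff hρ hpq).2 h]
      exact zero_le_one
    · rw [eigDim_neg_one_of_iso_sign hpq h]
    · obtain ⟨W, hW⟩ := exists_pointSystem_of_iso hρ h
      exact hW.eigDim_neg_one_le hρ p q
    · rw [eigDim_congr ρ _ hpq (show (0 : Fin 4) ≠ 1 by decide)]
      exact eigDim_le_of_hasShape_two_two hρ h

/-- For `n = 4, 5` a vector fixed by `n - 2` points gives dimension at most `n - 2`. If there is
none, `ρ` is the sign when `n = 4`; when `n = 5` the twist has one, and the three pairs among three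
points bound its `1`-eigenspace. -/
lemma eigDim_neg_one_le_three_of_le_five [FiniteDimensional ℂ M] (hρ : IsSimpleRep ρ) {p q : Fin n}
    (hpq : p ≠ q) (hn : n ≤ 5) : eigDim ρ (-1) p q ≤ 3 := by
  have hp := p.isLt
  have hq := q.isLt
  have hpq' : p.1 ≠ q.1 := fun e => hpq (Fin.ext e)
  by_cases h3 : n ≤ 3
  · exact ((eigDim_neg_one_le_one_iff hρ hpq).2
      (inShortList_of_le_three hρ (by omega) h3)).trans (by norm_num)
  by_cases hf : NoFixed ρ (n - 2)
  · obtain rfl | rfl : n = 4 ∨ n = 5 := by omega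
    · rw [eigDim_neg_one_of_iso_sign hpq (iso_sign_of_noFixed_two hρ hf)]
      norm_num
    · have := hρ.1
      have htw : eigDim (signTwist ρ) 1 p q = eigDim ρ (-1) p q := eigDim_signTwist ρ hpq 1
      rcases iso_trivial_or_pointSystem_or_exists_pairSystem hρ.signTwist (by norm_num)
        (not_noFixed_three ρ le_rfl hf) with h | ⟨W, hW⟩ | ⟨ε, -, W, hW⟩
      · rw [eigDim_neg_one_of_iso_sign hpq (iso_sign_iff.2 h)]
        norm_num
      · rw [← htw]
        exact hW.eigDim_one_le hρ.signTwist hpq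
      · rw [← htw, eigDim_congr _ _ hpq (show (0 : Fin 5) ≠ 1 by decide)]
        exact hW.eigDim_one_le hρ.signTwist (by decide)
  · rcases iso_trivial_or_pointSystem_or_exists_pairSystem hρ (by omega) hf with
      h | ⟨W, hW⟩ | ⟨ε, -, W, hW⟩
    · rw [(iso_trivial_iff hρ hpq).2 h]
      norm_num
    · exact (hW.eigDim_neg_one_le hρ p q).trans (by norm_num)
    · exact (hW.eigDim_neg_one_le hρ hpq).trans (by omega)

/-- A vector fixed by four points leaves, beyond the short list, only the symmetric pairs, of shape
`(4,2)`. Such a vector in the twist leaves only the sign, as the other systems there have a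
`1`-eigenspace of dimension at least 4. Otherwise triples appear. -/
lemma inShortList_or_hasShape_of_six [FiniteDimensional ℂ M] {ρ : Representation ℂ (Perm (Fin 6)) M}
    (hρ : IsSimpleRep ρ) (h : eigDim ρ (-1) 0 1 ≤ 3) :
    InShortList ρ ∨ HasShape ρ [3, 3] ∨ HasShape ρ [2, 2, 2] ∨ HasShape ρ [4, 2] := by
  have h01 : (0 : Fin 6) ≠ 1 := by decide
  by_cases hf : NoFixed ρ 4
  · by_cases hf' : NoFixed (signTwist ρ) 4
    · have := hρ.1
      rcases exists_tripleSystem_or_signTwist hf hf' h with ⟨W, hW⟩ | ⟨W, hW⟩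
      · exact Or.inr (Or.inl (hW.hasShape_three_three hρ))
      · exact Or.inr (Or.inr (Or.inl (hW.hasShape_two_two_two hρ)))
    · have htw : eigDim (signTwist ρ) 1 0 1 = eigDim ρ (-1) 0 1 := eigDim_signTwist ρ h01 1
      rcases iso_trivial_or_pointSystem_or_exists_pairSystem hρ.signTwist (by norm_num) hf' with
        h' | ⟨W, hW⟩ | ⟨ε, hε, W, hW⟩
      · exact Or.inl (Or.inr (Or.inl (iso_sign_iff.2 h')))
      · have := hW.le_eigDim_one h01
        omega
      · have := hW.le_eigDim_one hε (by norm_num) h01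
        omega
  · rcases iso_trivial_or_pointSystem_or_exists_pairSystem hρ (by norm_num) hf with
      h' | ⟨W, hW⟩ | ⟨ε, rfl | rfl, W, hW⟩
    · exact Or.inl (Or.inl h')
    · exact Or.inl (Or.inr (Or.inr (Or.inl (hW.iso_reflRep hρ))))
    · exact Or.inr (Or.inr (Or.inr (hW.hasShape_four_two hρ)))
    · have := hW.le_eigDim_neg_one_of_neg (by norm_num) h01
      omega

theorem eigDim_neg_one_le_three_iff [FiniteDimensional ℂ M] (hρ : IsSimpleRep ρ) {p q : Fin n}
    (hpq : p ≠ q) : eigDim ρ (-1) p q ≤ 3 ↔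
      Iso ρ (charRep 1) ∨ Iso ρ (charRep (signChar n)) ∨ Iso ρ (reflRep n) ∨ n ≤ 5 ∨
        (n = 6 ∧ (HasShape ρ [3, 3] ∨ HasShape ρ [2, 2, 2] ∨ HasShape ρ [4, 2])) := by
  constructor
  · intro h
    by_cases hn : n ≤ 5
    · tauto
    by_cases h6 : n = 6
    · subst h6
      rw [eigDim_congr ρ _ hpq (show (0 : Fin 6) ≠ 1 by decide)] at h
      rcases inShortList_or_hasShape_of_six hρ h with (h1 | h1 | h1 | ⟨h4, -⟩) | h1
      · tauto
      · tauto
      · tauto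
      · omega
      · tauto
    · rcases inShortList_of_eigDim_le hρ (by omega) hpq (Or.inr ⟨by omega, h⟩) with
        h1 | h1 | h1 | ⟨h4, -⟩
      · tauto
      · tauto
      · tauto
      · omega
  · have hle : InShortList ρ → eigDim ρ (-1) p q ≤ 3 := fun h =>
      ((eigDim_neg_one_le_one_iff hρ hpq).2 h).trans (by norm_num)
    rintro (h | h | h | h | ⟨rfl, h⟩)
    · exact hle (Or.inl h)
    · exact hle (Or.inr (Or.inl h))
    · exact hle (Or.inr (Or.inr (Or.inl h)))
    · exact eigDim_neg_one_le_three_of_le_five hρ hpq h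
    · rw [eigDim_congr ρ _ hpq (show (0 : Fin 6) ≠ 1 by decide)]
      rcases h with h | h | h
      · exact eigDim_le_of_hasShape_three_three hρ h
      · exact eigDim_le_of_hasShape_two_two_two hρ h
      · exact eigDim_le_of_hasShape_four_two hρ h

end Classification

end ReflHyp

end

theorem mainTheorem8 (n : ℕ) (H : Submodule ℂ ((Fin n → ℂ) ⧸ ReflHyp.diagLine n))
    (hH : H ∈ ReflHyp.hyperplanes (ReflHyp.reflRep n))
    {M : Type*} [AddCommGroup M] [Module ℂ M] [FiniteDimensional ℂ M]
    (ρ : Representation ℂ (Equiv.Perm (Fin n)) M) (hρ : ρ.IsIrreducible) :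
    (ReflHyp.IsExcellent (ReflHyp.reflRep n) H ρ ↔ ReflHyp.InShortList ρ) ∧
    (ReflHyp.IsGood (ReflHyp.reflRep n) H ρ ↔ ReflHyp.InShortList ρ) ∧
    (ReflHyp.IsPairGood (ReflHyp.reflRep n) H ρ 1 ↔ ReflHyp.InShortList ρ) ∧
    (ReflHyp.IsAcceptable (ReflHyp.reflRep n) H ρ (ReflHyp.signChar n) ↔
      ReflHyp.InShortList ρ) ∧
    (ReflHyp.IsPairGood (ReflHyp.reflRep n) H ρ (ReflHyp.signChar n) ↔
      ReflHyp.Iso ρ (ReflHyp.charRep 1)) ∧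
    (ReflHyp.IsAcceptable (ReflHyp.reflRep n) H ρ 1 ↔
      (ReflHyp.Iso ρ (ReflHyp.charRep 1) ∨
        ReflHyp.Iso ρ (ReflHyp.charRep (ReflHyp.signChar n)) ∨
        ReflHyp.Iso ρ (ReflHyp.reflRep n) ∨
        n ≤ 5 ∨
        (n = 6 ∧ (ReflHyp.HasShape ρ [3, 3] ∨ ReflHyp.HasShape ρ [2, 2, 2] ∨
          ReflHyp.HasShape ρ [4, 2])))) := by
  obtain ⟨p, q, hpq, rfl⟩ := ReflHyp.exists_eq_ker_coordDiff hH
  have hs := ReflHyp.isSimpleRep_of_isIrreducible hρ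
  rw [ReflHyp.isExcellent_iff ρ hpq, ReflHyp.isGood_iff ρ hpq, ReflHyp.isPairGood_one_iff ρ hpq,
    ReflHyp.isAcceptable_sign_iff ρ hpq, ReflHyp.isPairGood_sign_iff ρ hpq,
    ReflHyp.isAcceptable_one_iff ρ hpq]
  have h := ReflHyp.eigDim_neg_one_le_one_iff hs hpq
  exact ⟨h, h, h, h, ReflHyp.iso_trivial_iff hs hpq, ReflHyp.eigDim_neg_one_le_three_iff hs hpq⟩
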